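/- Let $n\ge 3$ and $h>0$. Write $\mathbb S^2\subset\mathbb C\oplus\mathbb R$, $\mathbb S^n\subset\mathbb C\oplus\mathbb R^{n-1}$ and $p=(0,0,1)\in\mathbb S^2$. For $H\in\mathbb R$, an $H$-curve is a $C^2$ immersed curve $\gamma=(z,b):\mathbb R\to\mathbb S^2$ with $b>0$, together with a unit normal field $\nu=(\nu_z,\nu_b)$ along $\gamma$ in $\mathbb S^2$, such that $$G_\gamma:\mathbb R\times\mathbb S^{n-2}\to\mathbb S^n,\qquad G_\gamma(t,x)=(z(t),\,b(t)x),$$ is an immersion whose mean curvature (the trace of the second fundamental form) with respect to the unit normal field $(t,x)\mapsto(\nu_z(t),\nu_b(t)x)$ is the constant $H$. It is complete if it has infinite length in both directions. It has integration constant $C$ if, wherever it can be written as $(\cos s\,e^{is_1(s)},\sin s)$ with $0<s<\pi/2$ and with $s$ as a regular parameter, one has $\Delta(s)>0$ and $$\frac{ds_1}{ds}=\pm\frac{C+\frac{H}{n-1}\sin^{n-1}s}{\cos s\,\sqrt{\Delta(s)}},\qquad \Delta(s)=\cos^2s\,\sin^{2(n-2)}s-\Big(C+\frac{H}{n-1}\sin^{n-1}s\Big)^2.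 \tag{1}$$ **Theorem.** (i) There is a complete $(-h)$-curve $(\gamma,\nu)$ passing through $p$. It can be taken smooth and parametrized by arc length, and such that away from $p$ its normal $\nu$ has a positive component in the direction leading away from $p$ along the meridian. In particular $G_\gamma$ is an immersion of $\mathbb R\times\mathbb S^{n-2}$ into $\mathbb S^n$ of constant mean curvature $-h$. (ii) It is unique: every complete $(-h)$-curve passing through $p$, with its normal field, is obtained from $(\gamma,\nu)$ by a phase rotation $(z,b)\mapsto(e^{i\theta}z,b)$ and a change of parameter. (iii) Its integration constant is $C=\frac h{n-1}$, and it is assembled from local pieces by reflections. Namely, for $H=-h$ and this $C$ the set $\{s\in(0,\pi/2):\Delta(s)>0\}$ is an interval $(z_0,\pi/2)$ with $0<z_0<\pi/2$; there is a continuous $s_1$ on $[z_0,\pi/2]$ that satisfies (1) with the plus sign on $(z_0,\pi/2)$; and for some $\ell>0$ the arc $\gamma|_{[0,\ell]}$ is the curve $s\mapsto(\cos s\,e^{is_1(s)},\sin s)$, run from $s=z_0$ to $s=\pi/2$, that is, to $p$. One has $\gamma(t)=p$ exactly for $t=(2m+1)\ell$ with $m\in\mathbb Z$. At each such $t_0$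 the curve is symmetric, $\gamma(t_0+\tau)=\rho(\gamma(t_0-\tau))$, where $\rho$ is the reflection in the plane spanned by $p$ and $\nu(t_0)$. At each $t_0=2m\ell$, $m\in\mathbb Z$, it is symmetric in the same way with respect to the plane spanned by $p$ and $\gamma(t_0)$. (iv) Call a curve avoiding $p$ whose height $b$ is periodic and not constant of unduloid type if its continuous phase is strictly monotone, and of nodoid type if its continuous phase is neither nondecreasing nor nonincreasing. The curve $\gamma$ is of neither type, and it is a bridge between them. Namely, let $C_{-h}$ be the supremum of all $C$ with $C-\frac h{n-1}\sin^{n-1}s<\cos s\,\sin^{n-2}s$ for some $s\in(0,\pi/2)$. Then $\frac h{n-1}<C_{-h}$, and there are complete $(-h)$-curves $(\gamma_C,\nu_C)$, $0<C<C_{-h}$, parametrized by arc length, such that $(C,t)\mapsto(\gamma_C(t),\nu_C(t))$ is continuous, $\gamma_C$ has integration constant $C$, $(\gamma_C,\nu_C)=(\gamma,\nu)$ for $C=\frac h{n-1}$, $\gamma_C$ is of nodoid type for $C<\frac h{n-1}$, and $\gamma_C$ is of unduloid type, with $\nu_C$ pointing away from $p$ as in (i), for $C>\frac h{n-1}$.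 -/

import Mathlib

open Set Filter Topology
open scoped Manifold ContDiff RealInnerProductSpace

noncomputable section

/-- The Euclidean space `ℂ ⊕ ℝ = ℝ³`, which contains the sphere `S²` of the generating curves. -/
abbrev Space3 : Type := WithLp 2 (ℂ × ℝ)

/-- The Euclidean space `ℝ^{n-1}` (for `n ≥ 2`). -/
abbrev Fibre (n : ℕ) : Type := EuclideanSpace ℝ (Fin (n - 2 + 1))

/-- The round unit sphere `S^{n-2} ⊆ ℝ^{n-1}`. -/
abbrev FibreSphere (n : ℕ) : Type := Metric.sphere (0 : Fibre n) 1

/-- The Euclidean space `ℂ ⊕ ℝ^{n-1} = ℝ^{n+1}`, whose unit sphere is `S^n`. -/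
abbrev Ambient (n : ℕ) : Type := WithLp 2 (ℂ × Fibre n)

/-- The model with corners of the manifold `ℝ × S^{n-2}`. -/
abbrev prodModel (n : ℕ) :=
  (𝓘(ℝ, ℝ)).prod (𝓡 (n - 2))

/-- The pole `p = (0, 0, 1)` of `S²`. -/
def pole : Space3 := WithLp.toLp 2 (0, 1)

/-- The rotation of `ℂ ⊕ ℝ` by the angle `θ` about the axis through the pole
(a change of phase by `θ`). -/
def phaseRotation (θ : ℝ) (w : Space3) : Space3 :=
  WithLp.toLp 2 (Complex.exp (θ * Complex.I) * w.fst, w.snd)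

/-- The point `(cos s · e^{iφ}, sin s)` of `S²`. -/
def spherePoint (s φ : ℝ) : Space3 :=
  WithLp.toLp 2 ((Real.cos s : ℂ) * Complex.exp (φ * Complex.I), Real.sin s)

/-- The singly spiral product `(t, x) ↦ (z(t), b(t) x)` of a curve `γ = (z, b)` in `ℂ ⊕ ℝ` with
the sphere `S^{n-2}`. For a curve in `S²` it has values in `S^n`. -/
def spiralProduct (n : ℕ) (γ : ℝ → Space3) (q : ℝ × FibreSphere n) : Ambient n :=
  WithLp.toLp 2 ((γ q.1).fst, (γ q.1).snd • (q.2 : Fibre n))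

/-- The differential at `q` of a map from `ℝ × S^{n-2}` to `ℂ ⊕ ℝ^{n-1}`. -/
def differential (n : ℕ) (F : ℝ × FibreSphere n → Ambient n) (q : ℝ × FibreSphere n) :
    TangentSpace (prodModel n) q →L[ℝ] Ambient n :=
  mfderiv (prodModel n) 𝓘(ℝ, Ambient n) F q

/-- The second fundamental form in `S^n` of an immersion `F : ℝ × S^{n-2} → S^n` with respect to
the unit normal field `N`, that is, `A(u, v) = ⟪N, D_u D_v F⟫ = -⟪D_u N, D_v F⟫`. -/
def secondFundamentalForm (n : ℕ) (F N : ℝ × FibreSphere n → Ambient n) (q : ℝ × FibreSphere n)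
    (u v : TangentSpace (prodModel n) q) : ℝ :=
  -⟪differential n N q u, differential n F q v⟫

/-- `F` is an immersion of `ℝ × S^{n-2}` into the unit sphere `S^n` whose mean curvature with
respect to the unit normal field `N` is the constant `H`. The mean curvature is not normalized: it
is the trace of the second fundamental form, computed in a basis of the tangent space which is
orthonormal for the induced metric. -/
structure IsCMCImmersion (n : ℕ) (H : ℝ) (F N : ℝ × FibreSphere n → Ambient n) : Prop where
  contMDiff : ContMDiff (prodModel n) 𝓘(ℝ, Ambient n) 2 F
  norm_eq_one : ∀ q, ‖F q‖ = 1
  immersive : ∀ q, Function.Injective (differential n F q)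
  normal_contMDiff : ContMDiff (prodModel n) 𝓘(ℝ, Ambient n) 1 N
  normal_norm_eq_one : ∀ q, ‖N q‖ = 1
  normal_tangent_sphere : ∀ q, ⟪N q, F q⟫ = 0
  normal_perp : ∀ q v, ⟪N q, differential n F q v⟫ = 0
  trace_eq : ∀ q, ∀ e : Fin (n - 2 + 1) → TangentSpace (prodModel n) q,
    Orthonormal ℝ (fun i => differential n F q (e i)) →
      ∑ i, secondFundamentalForm n F N q (e i) (e i) = H

/-- `γ` is an immersed `C²` curve in the open upper hemisphere of `S²` which generates, with the
unit normal field `ν` in `S²` along `γ`, a hypersurface of `S^n` of constant mean curvature `H`.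
The unit normal field of the hypersurface is the one induced by `ν = (ν_z, ν_b)`, namely
`(t, x) ↦ (ν_z(t), ν_b(t) x)`. -/
structure IsCMCCurve (n : ℕ) (H : ℝ) (γ ν : ℝ → Space3) : Prop where
  contDiff : ContDiff ℝ 2 γ
  regular : ∀ t, deriv γ t ≠ 0
  norm_eq_one : ∀ t, ‖γ t‖ = 1
  height_pos : ∀ t, 0 < (γ t).snd
  cmc : IsCMCImmersion n H (spiralProduct n γ) (spiralProduct n ν)

/-- A regular curve defined on `ℝ` is complete if it has infinite length in both directions. -/
def IsCompleteCurve (γ : ℝ → Space3) : Prop :=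
  Tendsto (fun t => ∫ τ in (0 : ℝ)..t, ‖deriv γ τ‖) atTop atTop ∧
    Tendsto (fun t => ∫ τ in (0 : ℝ)..t, ‖deriv γ τ‖) atBot atBot

/-- The unit normal field `ν` along `γ` points away from the pole, except at the pole itself.
At a point `γ = (a e^{iφ}, b)` of the upper hemisphere with `a > 0` the component of `ν` in the
direction `(b e^{iφ}, -a)`, which leads away from the pole along the meridian, is `-ν_b / a`. -/
def PointsAwayFromPole (γ ν : ℝ → Space3) : Prop :=
  ∀ t, γ t ≠ pole → (ν t).snd < 0

/-- The function `C + H/(n-1) · sin^{n-1} s`. -/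
def rhsFun (n : ℕ) (H C s : ℝ) : ℝ :=
  C + H / ((n : ℝ) - 1) * Real.sin s ^ (n - 1)

/-- The function `cos s · sin^{n-2} s`. -/
def lhsFun (n : ℕ) (s : ℝ) : ℝ :=
  Real.cos s * Real.sin s ^ (n - 2)

/-- The function
`cos² s · sin^{2(n-2)} s - (C + H/(n-1) · sin^{n-1} s)²`. -/
def discriminant (n : ℕ) (H C s : ℝ) : ℝ :=
  lhsFun n s ^ 2 - rhsFun n H C s ^ 2

/-- The derivative `ds₁/ds` prescribed by the solved mean curvature equation with integration
constant `C`, for curves of the form `s ↦ (cos s · e^{i s₁(s)}, sin s)`. -/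
def phaseSlope (n : ℕ) (H C s : ℝ) : ℝ :=
  rhsFun n H C s / (Real.cos s * Real.sqrt (discriminant n H C s))

/-- The curve `γ` has integration constant `C` (as a curve generating mean curvature `H`):
wherever it can be written as `(cos s · e^{iφ}, sin s)` with `0 < s < π/2` and with `s` as a local
parameter, `dφ/ds` is `± phaseSlope n H C s`. -/
def HasIntegrationConstant (n : ℕ) (H C : ℝ) (γ : ℝ → Space3) : Prop :=
  ∀ (t : ℝ) (s φ : ℝ → ℝ), DifferentiableAt ℝ s t → DifferentiableAt ℝ φ t →
    (∀ᶠ τ in 𝓝 t, γ τ = spherePoint (s τ) (φ τ)) →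
    s t ∈ Ioo 0 (Real.pi / 2) → deriv s t ≠ 0 →
      0 < discriminant n H C (s t) ∧
        (deriv φ t / deriv s t = phaseSlope n H C (s t) ∨
          deriv φ t / deriv s t = -phaseSlope n H C (s t))

/-- The constants `C` for which the graph of `C + H/(n-1) · sin^{n-1} s` goes below the graph of
`cos s · sin^{n-2} s` somewhere on `(0, π/2)`, that is, the half-line of all `C < C_H`, where `C_H`
is the constant for which the two graphs touch. -/
def belowContact (n : ℕ) (H : ℝ) : Set ℝ :=
  {C | ∃ s ∈ Ioo (0 : ℝ) (Real.pi / 2), rhsFun n H C s < lhsFun n s}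

/-- The height of `γ` over the equator of `S²` is periodic and not constant. -/
def OscillatesInHeight (γ : ℝ → Space3) : Prop :=
  (∃ T : ℝ, 0 < T ∧ ∀ t, (γ (t + T)).snd = (γ t).snd) ∧ ∃ t₁ t₂, (γ t₁).snd ≠ (γ t₂).snd

/-- The curve `γ` avoids the pole, and `φ` is a continuous phase along `γ`. -/
def IsPhase (γ : ℝ → Space3) (φ : ℝ → ℝ) : Prop :=
  Continuous φ ∧
    ∀ t, (γ t).fst ≠ 0 ∧ (γ t).fst = (‖(γ t).fst‖ : ℂ) * Complex.exp (φ t * Complex.I)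

/-- Unduloid type: the curve oscillates in height and its phase is strictly monotone. -/
def IsUnduloidType (γ : ℝ → Space3) : Prop :=
  OscillatesInHeight γ ∧ ∃ φ, IsPhase γ φ ∧ (StrictMono φ ∨ StrictAnti φ)

/-- Nodoid type: the curve oscillates in height and its phase moves back and forth (whirls). -/
def IsNodoidType (γ : ℝ → Space3) : Prop :=
  OscillatesInHeight γ ∧ ∃ φ, IsPhase γ φ ∧ ¬ Monotone φ ∧ ¬ Antitone φ

/-- The curve `γ` with unit normal field `ν` is assembled from a local piece
`s ↦ (cos s · e^{i s₁(s)}, sin s)`, `z ≤ s ≤ π/2`, with integration constant `C` by reflections.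
Here `(z, π/2)` is the whole domain on which the local equation makes sense. The piece is run
through for `0 ≤ t ≤ ℓ`, from its lowest point at `t = 0` to the pole at `t = ℓ`. The curve is
symmetric about each passage through the pole, by the reflection in the plane spanned by the
pole and the normal vector there, and about each lowest point, by the reflection in
the plane spanned by the pole and that point. -/
def IsAssembledByReflections (n : ℕ) (H C : ℝ) (γ ν : ℝ → Space3) : Prop :=
  ∃ (z ℓ : ℝ) (s₁ σ : ℝ → ℝ),
    z ∈ Ioo 0 (Real.pi / 2) ∧ 0 < ℓ ∧
    {s | s ∈ Ioo 0 (Real.pi / 2) ∧ 0 < discriminant n H C s} = Ioo z (Real.pi / 2) ∧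
    ContinuousOn s₁ (Icc z (Real.pi / 2)) ∧
    (∀ s ∈ Ioo z (Real.pi / 2), HasDerivAt s₁ (phaseSlope n H C s) s) ∧
    ContinuousOn σ (Icc 0 ℓ) ∧ StrictMonoOn σ (Icc 0 ℓ) ∧ σ 0 = z ∧ σ ℓ = Real.pi / 2 ∧
    (∀ t ∈ Icc 0 ℓ, γ t = spherePoint (σ t) (s₁ (σ t))) ∧
    (∀ t, γ t = pole ↔ ∃ m : ℤ, t = (2 * m + 1) * ℓ) ∧
    (∀ t₀, γ t₀ = pole →
      ∀ τ, γ (t₀ + τ) = (Submodule.span ℝ {pole, ν t₀}).reflection (γ (t₀ - τ))) ∧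
    (∀ m : ℤ, ∀ τ, γ (2 * m * ℓ + τ) =
      (Submodule.span ℝ {pole, γ (2 * m * ℓ)}).reflection (γ (2 * m * ℓ - τ)))

end

open Set Filter Topology
open scoped Manifold ContDiff RealInnerProductSpace

noncomputable section

/-! The mean curvature of a spiral product depends only on its generating curve: it is `κ - (n-2)
ν_b / b`, with `κ` the geodesic curvature in the sense `ν' = -κ γ'`
(`sum_secondFundamentalForm_spiralProduct`). So `(-h)`-curves are, up to parametrization, the
solutions of the Frenet equations for `(γ, T, ν)` with `κ = -h + (n-2) ν_b / b`. This system is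
autonomous and invariant under rotations about the axis of `p`. It is also invariant under
reflections in planes through that axis, combined with a reversal of time. It has the first integral
`C = h/(n-1) b^(n-1) - b^(n-2) ν_b` (`energy`), which is the integration constant.

If `C > 0`, the first integral bounds `b` away from `0`, where the system is singular. A cutoff that
is invisible to the solutions turns the field into a smooth one with compact support. This gives
solutions for all time, uniqueness, smoothness, and continuous dependence on `C`.

Where the height is critical one has `b = sin s`, `ν_b = -cos s` and `level n h s = C`. On `[0,
π/2]` the function `level` rises from `0` to a single peak and then falls to `h/(n-1)`. For `C`
between `0` and the peak value, start at the angle `z` on the rising branch with `level n h z = C`.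
The height increases until a second critical point (`exists_first_turning`), since otherwise it
would converge to an equilibrium, and equilibria occur at positive `C` only at the peak. Reflections
at the two critical points generate the whole curve and make its height periodic.

The phase has derivative `-ν_b / (1 - b²)`. If `C > h/(n-1)`, then `ν_b` is always negative:
unduloid type. If `C < h/(n-1)`, then `ν_b` is negative at the lowest point and positive at the next
turning point: nodoid type. If `C = h/(n-1)`, the second turning point is `p` itself; the zero of `1
- b²` there cancels against `ν_b`, so the phase of the arc extends continuously to `p`. No
continuous phase in the sense of the two types exists along the whole curve.

For uniqueness, every `(-h)`-curve through `p` has `b = 1` and `ν_b = 0` there, hence the same `C`.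
Frames at `p` differ by a rotation once the direction of travel is chosen, and uniqueness for the
Frenet system does the rest. -/

/-! ### Differential and mean curvature of spiral products -/

instance fact_finrank_fibre (n : ℕ) : Fact (Module.finrank ℝ (Fibre n) = n - 2 + 1) :=
  ⟨finrank_euclideanSpace_fin⟩

/-- The differential of the inclusion of `S^{n-2}` into `ℝ^{n-1}`. -/
def sphereDiff (n : ℕ) (x : FibreSphere n) : EuclideanSpace ℝ (Fin (n - 2)) →L[ℝ] Fibre n :=
  mfderiv (𝓡 (n - 2)) 𝓘(ℝ, Fibre n) ((↑) : FibreSphere n → Fibre n) x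

theorem sphereDiff_injective (n : ℕ) (x : FibreSphere n) :
    Function.Injective (sphereDiff n x) :=
  injective_mvfderiv_subtypeVal_sphere x

theorem inner_sphereDiff (n : ℕ) (x : FibreSphere n) (u : EuclideanSpace ℝ (Fin (n - 2))) :
    ⟪(x : Fibre n), sphereDiff n x u⟫ = 0 := by
  have h : sphereDiff n x u ∈ (ℝ ∙ (x : Fibre n))ᗮ := by
    rw [← range_mvfderiv_subtypeVal (n := n - 2) x]
    exact ⟨u, rfl⟩
  exact Submodule.mem_orthogonal_singleton_iff_inner_right.1 h

theorem hasMFDerivAt_coe_sphere (n : ℕ) (x : FibreSphere n) :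
    HasMFDerivAt (𝓡 (n - 2)) 𝓘(ℝ, Fibre n) ((↑) : FibreSphere n → Fibre n) x (sphereDiff n x) :=
  ((contMDiff_coe_sphere (m := 1) (n := n - 2)).mdifferentiable (by simp) x).hasMFDerivAt

theorem contMDiff_prodMap_coe_sphere (n : ℕ) (m : ℕ∞ω) :
    ContMDiff (prodModel n) 𝓘(ℝ, ℝ × Fibre n) m
      (fun q : ℝ × FibreSphere n => (q.1, (q.2 : Fibre n))) :=
  contMDiff_fst.prodMk_space (contMDiff_coe_sphere.comp contMDiff_snd)

theorem differential_spiralProduct (n : ℕ) (γ : ℝ → Space3) (γ' : Space3)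
    (q : ℝ × FibreSphere n) (hγ : HasDerivAt γ γ' q.1) (u : TangentSpace (prodModel n) q) :
    differential n (spiralProduct n γ) q u =
      WithLp.toLp 2 ((u.1 : ℝ) • γ'.fst, ((u.1 : ℝ) * γ'.snd) • (q.2 : Fibre n) +
        (γ q.1).snd • sphereDiff n q.2 u.2) := by
  have h1 : HasMFDerivAt (prodModel n) 𝓘(ℝ, ℝ) (Prod.fst : ℝ × FibreSphere n → ℝ) q _ :=
    hasMFDerivAt_fst q
  have h2 : HasMFDerivAt (prodModel n) 𝓘(ℝ, Fibre n)
    (fun q : ℝ × FibreSphere n => (q.2 : Fibre n)) q _ :=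
     (hasMFDerivAt_coe_sphere n q.2).comp q (hasMFDerivAt_snd q)
  have h12 : HasMFDerivAt (prodModel n) 𝓘(ℝ, ℝ × Fibre n)
      (fun q : ℝ × FibreSphere n => (q.1, (q.2 : Fibre n))) q
      ((ContinuousLinearMap.fst ℝ ℝ (EuclideanSpace ℝ (Fin (n - 2)))).prod
        ((sphereDiff n q.2).comp (ContinuousLinearMap.snd ℝ ℝ (EuclideanSpace ℝ (Fin (n - 2)))))) := by
    refine ⟨(h1.continuousAt.prodMk h2.continuousAt), ?_⟩
    exact h1.2.prodMk h2.2
  have hf1 : HasDerivAt (fun t => (γ t).fst) γ'.fst q.1 :=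
    (WithLp.fstL (p := 2) (𝕜 := ℝ) (α := ℂ) (β := ℝ)).hasFDerivAt.comp_hasDerivAt q.1 hγ
  have hf2 : HasDerivAt (fun t => (γ t).snd) γ'.snd q.1 :=
    (WithLp.sndL (p := 2) (𝕜 := ℝ) (α := ℂ) (β := ℝ)).hasFDerivAt.comp_hasDerivAt q.1 hγ
  let p : ℝ × Fibre n := (q.1, (q.2 : Fibre n))
  have hg1 : HasFDerivAt (fun w : ℝ × Fibre n => (γ w.1).fst) _ p :=
    HasFDerivAt.comp (f := Prod.fst) p hf1.hasFDerivAt hasFDerivAt_fst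
  have hg2 : HasFDerivAt (fun w : ℝ × Fibre n => (γ w.1).snd) _ p :=
    HasFDerivAt.comp (f := Prod.fst) p hf2.hasFDerivAt hasFDerivAt_fst
  have hg3 := (((WithLp.prodContinuousLinearEquiv 2 ℝ ℂ (Fibre n)).symm :
    ℂ × Fibre n →L[ℝ] Ambient n).hasFDerivAt).comp p (hg1.prodMk (hg2.smul hasFDerivAt_snd))
  have hg4 := hg3.hasMFDerivAt.comp q h12
  have hg5 : HasMFDerivAt (prodModel n) 𝓘(ℝ, Ambient n) (spiralProduct n γ) q _ := hg4
  rw [differential, hg5.mfderiv]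
  have key : ∀ a : ℝ × EuclideanSpace ℝ (Fin (n - 2)),
      WithLp.toLp 2 ((a.1 : ℝ) • γ'.fst, (γ q.1).snd • sphereDiff n q.2 a.2 +
        ((a.1 : ℝ) • γ'.snd) • (q.2 : Fibre n)) =
      (WithLp.toLp 2 ((a.1 : ℝ) • γ'.fst, ((a.1 : ℝ) * γ'.snd) • (q.2 : Fibre n) +
        (γ q.1).snd • sphereDiff n q.2 a.2) : Ambient n) := by
    intro a
    rw [add_comm, smul_eq_mul]
  exact key u

/-- The mixed terms vanish because tangent vectors of the sphere are orthogonal to the position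
vector. With `ν = γ` this is the induced metric, and with the normal field it is minus the second
fundamental form; both are block diagonal in the product splitting. -/
theorem inner_differential_spiralProduct (n : ℕ) (γ ν : ℝ → Space3) (γ' ν' : Space3)
    (q : ℝ × FibreSphere n) (hγ : HasDerivAt γ γ' q.1) (hν : HasDerivAt ν ν' q.1)
    (u v : TangentSpace (prodModel n) q) :
    ⟪differential n (spiralProduct n ν) q u, differential n (spiralProduct n γ) q v⟫ =
      (u.1 : ℝ) * (v.1 : ℝ) * ⟪ν', γ'⟫ +
        (ν q.1).snd * (γ q.1).snd * ⟪sphereDiff n q.2 u.2, sphereDiff n q.2 v.2⟫ := by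
  have hx : ⟪(q.2 : Fibre n), (q.2 : Fibre n)⟫ = (1 : ℝ) := by
    rw [real_inner_self_eq_norm_sq, norm_eq_of_mem_sphere]
    norm_num
  have h1 := inner_sphereDiff n q.2
  have h2 : ∀ u, ⟪sphereDiff n q.2 u, (q.2 : Fibre n)⟫ = (0 : ℝ) := fun u => by
    rw [real_inner_comm]; exact h1 u
  rw [differential_spiralProduct n γ γ' q hγ, differential_spiralProduct n ν ν' q hν]
  simp only [WithLp.prod_inner_apply, inner_add_left, inner_add_right, inner_smul_left,
    inner_smul_right, hx, h1, h2]
  simp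
  ring

/-- Parseval for a family that need not span the whole space: the frames in `trace_eq` span only the
image of the differential. -/
theorem Orthonormal.sum_inner_sq_of_mem_span {E ι : Type*} [NormedAddCommGroup E]
    [InnerProductSpace ℝ E] [Fintype ι] {e : ι → E} (he : Orthonormal ℝ e) {x : E}
    (hx : x ∈ Submodule.span ℝ (Set.range e)) : ∑ i, ⟪x, e i⟫ ^ 2 = ‖x‖ ^ 2 := by
  obtain ⟨c, rfl⟩ := (Submodule.mem_span_range_iff_exists_fun ℝ).1 hx
  have h : ∀ i, ⟪∑ j, c j • e j, e i⟫ = c i := fun i => by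
    rw [real_inner_comm]
    exact he.inner_right_fintype c i
  rw [← real_inner_self_eq_norm_sq, he.inner_sum]
  simp [h, pow_two]

theorem differential_spiralProduct_injective (n : ℕ) (γ : ℝ → Space3) (γ' : Space3)
    (q : ℝ × FibreSphere n) (hγ : HasDerivAt γ γ' q.1) (h0 : γ' ≠ 0) (hb : (γ q.1).snd ≠ 0) :
    Function.Injective (differential n (spiralProduct n γ) q) := by
  rw [injective_iff_map_eq_zero]
  intro u hu
  have h := inner_differential_spiralProduct n γ γ γ' γ' q hγ hγ u u
  rw [hu, inner_zero_left, real_inner_self_eq_norm_sq, real_inner_self_eq_norm_sq] at h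
  have h1 : (u.1 : ℝ) = 0 := by
    by_contra hne
    have : 0 < ‖γ'‖ := norm_pos_iff.2 h0
    have : 0 < (u.1 : ℝ) * u.1 := mul_self_pos.2 hne
    have : 0 ≤ (γ q.1).snd * (γ q.1).snd := mul_self_nonneg _
    have : 0 < (u.1 : ℝ) * (u.1 : ℝ) * ‖γ'‖ ^ 2 +
      (γ q.1).snd * (γ q.1).snd * ‖sphereDiff n q.2 u.2‖ ^ 2 := by positivity
    linarith
  have h2 : sphereDiff n q.2 u.2 = 0 := by
    by_contra hne
    have h3 : 0 < ‖sphereDiff n q.2 u.2‖ := norm_pos_iff.2 hne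
    have h4 : 0 < (γ q.1).snd * (γ q.1).snd := mul_self_pos.2 hb
    rw [h1] at h
    have := mul_pos h4 (pow_pos h3 2)
    linarith
  have h5 : u.2 = 0 := sphereDiff_injective n q.2 (by rw [h2]; exact (map_zero (sphereDiff n q.2)).symm)
  exact Prod.ext h1 h5

/-- The mean curvature of a spiral product in terms of the geodesic curvature of the curve. -/
theorem sum_secondFundamentalForm_spiralProduct (n : ℕ) (γ ν : ℝ → Space3) (γ' : Space3) (κ : ℝ)
    (q : ℝ × FibreSphere n) (hγ : HasDerivAt γ γ' q.1) (hν : HasDerivAt ν (-κ • γ') q.1)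
    (h0 : γ' ≠ 0) (hb : (γ q.1).snd ≠ 0)
    (e : Fin (n - 2 + 1) → TangentSpace (prodModel n) q)
    (he : Orthonormal ℝ fun i => differential n (spiralProduct n γ) q (e i)) :
    ∑ i, secondFundamentalForm n (spiralProduct n γ) (spiralProduct n ν) q (e i) (e i) =
      κ - (n - 2 : ℕ) * ((ν q.1).snd / (γ q.1).snd) := by
  set D := differential n (spiralProduct n γ) q with hD
  have hinj : Function.Injective D := differential_spiralProduct_injective n γ γ' q hγ h0 hb
  have hli : LinearIndependent ℝ e :=
    LinearIndependent.of_comp D.toLinearMap he.linearIndependent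
  have hfin : Module.finrank ℝ (TangentSpace (prodModel n) q) = n - 2 + 1 := by
    change Module.finrank ℝ (ℝ × EuclideanSpace ℝ (Fin (n - 2))) = n - 2 + 1
    rw [Module.finrank_prod, finrank_euclideanSpace_fin, Module.finrank_self, add_comm]
  have hspan : Submodule.span ℝ (Set.range e) = ⊤ := by
    have : FiniteDimensional ℝ (TangentSpace (prodModel n) q) :=
      inferInstanceAs (FiniteDimensional ℝ (ℝ × EuclideanSpace ℝ (Fin (n - 2))))
    exact hli.span_eq_top_of_card_eq_finrank' (by rw [hfin, Fintype.card_fin])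
  -- Parseval for the image of the unit vector in the direction of `ℝ` yields `∑ (e i).1² ‖γ'‖² =
  -- 1`, which is all that has to be known about the frame.
  let u : TangentSpace (prodModel n) q := ((1 : ℝ), (0 : EuclideanSpace ℝ (Fin (n - 2))))
  have hu1 : (u.1 : ℝ) = 1 := rfl
  have hu2 : sphereDiff n q.2 u.2 = 0 := map_zero (sphereDiff n q.2)
  have hmem : D u ∈ Submodule.span ℝ (Set.range fun i => D (e i)) := by
    have : (Set.range fun i => D (e i)) = D.toLinearMap '' Set.range e := by
      rw [← Set.range_comp]; rfl
    rw [this, ← Submodule.map_span, hspan]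
    exact ⟨u, trivial, rfl⟩
  have hpars := he.sum_inner_sq_of_mem_span hmem
  have hDu : ∀ i, ⟪D u, D (e i)⟫ = ((e i).1 : ℝ) * ‖γ'‖ ^ 2 := fun i => by
    rw [hD, inner_differential_spiralProduct n γ γ γ' γ' q hγ hγ, hu1, hu2, inner_zero_left,
      real_inner_self_eq_norm_sq]
    ring
  have hDuu : ‖D u‖ ^ 2 = ‖γ'‖ ^ 2 := by
    rw [← real_inner_self_eq_norm_sq, hD, inner_differential_spiralProduct n γ γ γ' γ' q hγ hγ,
      hu1, hu2, inner_zero_left, real_inner_self_eq_norm_sq]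
    ring
  have hpos : 0 < ‖γ'‖ ^ 2 := pow_pos (norm_pos_iff.2 h0) 2
  have hsum : ∑ i, ((e i).1 : ℝ) ^ 2 * ‖γ'‖ ^ 2 = 1 := by
    have : (∑ i, ((e i).1 : ℝ) ^ 2 * ‖γ'‖ ^ 2) * ‖γ'‖ ^ 2 = 1 * ‖γ'‖ ^ 2 := by
      rw [hDuu] at hpars
      rw [one_mul, Finset.sum_mul]
      refine Eq.trans ?_ hpars
      refine Finset.sum_congr rfl fun i _ => ?_
      rw [hDu]
      ring
    exact mul_right_cancel₀ hpos.ne' this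
  -- The condition that `D (e i)` is a unit vector eliminates the component along the sphere, so
  -- that each term depends only on `(e i).1`.
  have hterm : ∀ i, secondFundamentalForm n (spiralProduct n γ) (spiralProduct n ν) q (e i) (e i) =
      -((ν q.1).snd / (γ q.1).snd) +
        (κ + (ν q.1).snd / (γ q.1).snd) * (((e i).1 : ℝ) ^ 2 * ‖γ'‖ ^ 2) := fun i => by
    have h1 : ⟪D (e i), D (e i)⟫ = (1 : ℝ) := by
      rw [real_inner_self_eq_norm_sq, he.1 i]; norm_num
    rw [hD, inner_differential_spiralProduct n γ γ γ' γ' q hγ hγ, real_inner_self_eq_norm_sq] at h1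
    rw [secondFundamentalForm, inner_differential_spiralProduct n γ ν γ' _ q hγ hν,
      real_inner_smul_left, real_inner_self_eq_norm_sq]
    have h2 : (ν q.1).snd * (γ q.1).snd = (ν q.1).snd / (γ q.1).snd * ((γ q.1).snd * (γ q.1).snd) := by
      field_simp
    rw [h2]
    linear_combination (-((ν q.1).snd / (γ q.1).snd)) * h1
  rw [Finset.sum_congr rfl fun i _ => hterm i, Finset.sum_add_distrib, ← Finset.mul_sum, hsum]
  simp
  ring

theorem contMDiff_spiralProduct (n : ℕ) {m : ℕ∞ω} {γ : ℝ → Space3} (hγ : ContDiff ℝ m γ) :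
    ContMDiff (prodModel n) 𝓘(ℝ, Ambient n) m (spiralProduct n γ) := by
  have h1 : ContDiff ℝ m fun w : ℝ × Fibre n => (γ w.1).fst :=
    (WithLp.fstL (p := 2) (𝕜 := ℝ) (α := ℂ) (β := ℝ)).contDiff.comp (hγ.comp contDiff_fst)
  have h2 : ContDiff ℝ m fun w : ℝ × Fibre n => (γ w.1).snd :=
    (WithLp.sndL (p := 2) (𝕜 := ℝ) (α := ℂ) (β := ℝ)).contDiff.comp (hγ.comp contDiff_fst)
  have h3 : ContDiff ℝ m fun w : ℝ × Fibre n =>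
      (WithLp.toLp 2 ((γ w.1).fst, (γ w.1).snd • w.2) : Ambient n) :=
    ((WithLp.prodContinuousLinearEquiv 2 ℝ ℂ (Fibre n)).symm :
      ℂ × Fibre n →L[ℝ] Ambient n).contDiff.comp (h1.prodMk (h2.smul contDiff_snd))
  exact h3.contMDiff.comp (contMDiff_prodMap_coe_sphere n m)

/-- The condition `trace_eq` quantifies over orthonormal frames, so one such frame is needed to
extract information from it. It is pulled back from an orthonormal basis of the image of the
differential. -/
theorem exists_orthonormal_differential (n : ℕ) (γ : ℝ → Space3) (γ' : Space3)
    (q : ℝ × FibreSphere n) (hγ : HasDerivAt γ γ' q.1) (h0 : γ' ≠ 0) (hb : (γ q.1).snd ≠ 0) :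
    ∃ e : Fin (n - 2 + 1) → TangentSpace (prodModel n) q,
      Orthonormal ℝ fun i => differential n (spiralProduct n γ) q (e i) := by
  set D := differential n (spiralProduct n γ) q with hD
  have hinj : Function.Injective D := differential_spiralProduct_injective n γ γ' q hγ h0 hb
  have hfin : Module.finrank ℝ D.toLinearMap.range = n - 2 + 1 := by
    rw [LinearMap.finrank_range_of_inj hinj]
    change Module.finrank ℝ (ℝ × EuclideanSpace ℝ (Fin (n - 2))) = n - 2 + 1
    rw [Module.finrank_prod, finrank_euclideanSpace_fin, Module.finrank_self, add_comm]
  let B := (stdOrthonormalBasis ℝ D.toLinearMap.range).reindex (finCongr hfin)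
  choose e he using fun i => (B i).2
  refine ⟨e, ?_⟩
  have h := B.orthonormal.comp_linearIsometry D.toLinearMap.range.subtypeₗᵢ
  convert h using 2 with i
  exact he i

theorem inner_spiralProduct (n : ℕ) (γ ν : ℝ → Space3) (q : ℝ × FibreSphere n) :
    ⟪spiralProduct n ν q, spiralProduct n γ q⟫ = ⟪ν q.1, γ q.1⟫ := by
  have hx : ⟪(q.2 : Fibre n), (q.2 : Fibre n)⟫ = (1 : ℝ) := by
    rw [real_inner_self_eq_norm_sq, norm_eq_of_mem_sphere]
    norm_num
  simp only [spiralProduct, WithLp.prod_inner_apply, inner_smul_left, inner_smul_right, hx]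
  simp

theorem norm_spiralProduct (n : ℕ) (γ : ℝ → Space3) (q : ℝ × FibreSphere n) :
    ‖spiralProduct n γ q‖ = ‖γ q.1‖ := by
  rw [@norm_eq_sqrt_real_inner _ _ _ (spiralProduct n γ q), inner_spiralProduct,
    ← norm_eq_sqrt_real_inner]

theorem inner_spiralProduct_differential (n : ℕ) (γ ν : ℝ → Space3) (γ' : Space3)
    (q : ℝ × FibreSphere n) (hγ : HasDerivAt γ γ' q.1) (u : TangentSpace (prodModel n) q) :
    ⟪spiralProduct n ν q, differential n (spiralProduct n γ) q u⟫ = (u.1 : ℝ) * ⟪ν q.1, γ'⟫ := by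
  have hx : ⟪(q.2 : Fibre n), (q.2 : Fibre n)⟫ = (1 : ℝ) := by
    rw [real_inner_self_eq_norm_sq, norm_eq_of_mem_sphere]
    norm_num
  have h1 := inner_sphereDiff n q.2
  rw [differential_spiralProduct n γ γ' q hγ]
  simp only [spiralProduct, WithLp.prod_inner_apply, inner_add_right, inner_smul_left,
    inner_smul_right, hx, h1]
  simp
  ring

/-! ### Constant mean curvature as a differential equation for the curve -/

/-- The generating curves of hypersurfaces of constant mean curvature are characterized by an
ordinary differential equation. -/
theorem isCMCCurve_of_hasDerivAt (n : ℕ) (H : ℝ) (γ ν γ' : ℝ → Space3)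
    (hγ : ContDiff ℝ 2 γ) (hν : ContDiff ℝ 1 ν) (hγ' : ∀ t, HasDerivAt γ (γ' t) t)
    (h0 : ∀ t, γ' t ≠ 0) (hn : ∀ t, ‖γ t‖ = 1) (hb : ∀ t, 0 < (γ t).snd) (hνn : ∀ t, ‖ν t‖ = 1)
    (hνγ : ∀ t, ⟪ν t, γ t⟫ = 0) (hνγ' : ∀ t, ⟪ν t, γ' t⟫ = 0)
    (hν' : ∀ t, HasDerivAt ν (-(H + (n - 2 : ℕ) * ((ν t).snd / (γ t).snd)) • γ' t) t) :
    IsCMCCurve n H γ ν where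
  contDiff := hγ
  regular t := by rw [(hγ' t).deriv]; exact h0 t
  norm_eq_one := hn
  height_pos := hb
  cmc :=
    { contMDiff := contMDiff_spiralProduct n hγ
      norm_eq_one := fun q => by rw [norm_spiralProduct, hn]
      immersive := fun q =>
        differential_spiralProduct_injective n γ _ q (hγ' q.1) (h0 q.1) (hb q.1).ne'
      normal_contMDiff := contMDiff_spiralProduct n hν
      normal_norm_eq_one := fun q => by rw [norm_spiralProduct, hνn]
      normal_tangent_sphere := fun q => by rw [inner_spiralProduct, hνγ]
      normal_perp := fun q v => by
        rw [inner_spiralProduct_differential n γ ν _ q (hγ' q.1), hνγ', mul_zero]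
      trace_eq := fun q e he => by
        rw [sum_secondFundamentalForm_spiralProduct n γ ν _ _ q (hγ' q.1) (hν' q.1) (h0 q.1)
          (hb q.1).ne' e he]
        ring }

theorem finrank_space3 : Module.finrank ℝ Space3 = 3 := by
  rw [(WithLp.linearEquiv 2 ℝ (ℂ × ℝ)).finrank_eq, Module.finrank_prod, Complex.finrank_real_complex,
    Module.finrank_self]

theorem eq_sum_of_orthonormal {a b c : Space3} (ha : ‖a‖ = 1) (hb : ‖b‖ = 1) (hc : ‖c‖ = 1)
    (hab : ⟪a, b⟫ = 0) (hac : ⟪a, c⟫ = 0) (hbc : ⟪b, c⟫ = 0) (x : Space3) :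
    x = ⟪a, x⟫ • a + ⟪b, x⟫ • b + ⟪c, x⟫ • c := by
  have ho : Orthonormal ℝ ![a, b, c] := by
    constructor
    · intro i; fin_cases i <;> simp [ha, hb, hc]
    · have hba : ⟪b, a⟫ = 0 := by rw [real_inner_comm]; exact hab
      have hca : ⟪c, a⟫ = 0 := by rw [real_inner_comm]; exact hac
      have hcb : ⟪c, b⟫ = 0 := by rw [real_inner_comm]; exact hbc
      intro i j hij
      fin_cases i <;> fin_cases j <;> first | exact absurd rfl hij | assumption
  have : Nonempty (Fin 3) := ⟨0⟩
  let B := basisOfOrthonormalOfCardEqFinrank ho (by rw [finrank_space3, Fintype.card_fin])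
  have hB : ⇑B = ![a, b, c] := coe_basisOfOrthonormalOfCardEqFinrank _ _
  let OB := B.toOrthonormalBasis (by rw [hB]; exact ho)
  have hOB : ⇑OB = ![a, b, c] := by rw [← hB]; exact B.coe_toOrthonormalBasis _
  have h := OB.sum_repr' x
  rw [hOB, Fin.sum_univ_three] at h
  exact h.symm

theorem FibreSphere.nonempty (n : ℕ) : Nonempty (FibreSphere n) :=
  ⟨⟨EuclideanSpace.single 0 1, by simp⟩⟩

/-- Regularity is assumed only for the normal of the hypersurface. Restriction to a slice `ℝ × {x}`
gives it for `ν`, the height being recovered as the inner product with the unit vector `x`. -/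
theorem IsCMCCurve.contDiff_normal {n : ℕ} {H : ℝ} {γ ν : ℝ → Space3} (h : IsCMCCurve n H γ ν) :
    ContDiff ℝ 1 ν := by
  obtain ⟨x⟩ := FibreSphere.nonempty n
  have h1 : ContDiff ℝ 1 fun t : ℝ => spiralProduct n ν (t, x) := by
    rw [← contMDiff_iff_contDiff]
    exact h.cmc.normal_contMDiff.comp (contMDiff_id.prodMk contMDiff_const)
  have h2 : ContDiff ℝ 1 fun t : ℝ => (ν t).fst :=
    (WithLp.fstL (p := 2) (𝕜 := ℝ) (α := ℂ) (β := Fibre n)).contDiff.comp h1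
  have h3 : ContDiff ℝ 1 fun t : ℝ => (ν t).snd • (x : Fibre n) :=
    (WithLp.sndL (p := 2) (𝕜 := ℝ) (α := ℂ) (β := Fibre n)).contDiff.comp h1
  have h4 : ContDiff ℝ 1 fun t : ℝ => (ν t).snd := by
    have h5 := (contDiff_const (c := (x : Fibre n))).inner ℝ h3
    have h6 : (fun t => (ν t).snd) = fun t => ⟪(x : Fibre n), (ν t).snd • (x : Fibre n)⟫ := by
      funext t
      rw [inner_smul_right, real_inner_self_eq_norm_sq, norm_eq_of_mem_sphere]
      norm_num
    rw [h6]
    exact h5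
  exact ((WithLp.prodContinuousLinearEquiv 2 ℝ ℂ ℝ).symm : ℂ × ℝ →L[ℝ] Space3).contDiff.comp
    (h2.prodMk h4)

theorem IsCMCCurve.norm_normal {n : ℕ} {H : ℝ} {γ ν : ℝ → Space3} (h : IsCMCCurve n H γ ν) (t : ℝ) :
    ‖ν t‖ = 1 := by
  obtain ⟨x⟩ := FibreSphere.nonempty n
  rw [← h.cmc.normal_norm_eq_one (t, x), norm_spiralProduct]

theorem IsCMCCurve.inner_normal {n : ℕ} {H : ℝ} {γ ν : ℝ → Space3} (h : IsCMCCurve n H γ ν)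
    (t : ℝ) : ⟪ν t, γ t⟫ = 0 := by
  obtain ⟨x⟩ := FibreSphere.nonempty n
  rw [← h.cmc.normal_tangent_sphere (t, x), inner_spiralProduct]

theorem IsCMCCurve.hasDerivAt {n : ℕ} {H : ℝ} {γ ν : ℝ → Space3} (h : IsCMCCurve n H γ ν)
    (t : ℝ) : HasDerivAt γ (deriv γ t) t :=
  (h.contDiff.differentiable (by norm_num) t).hasDerivAt

theorem IsCMCCurve.inner_normal_deriv {n : ℕ} {H : ℝ} {γ ν : ℝ → Space3}
    (h : IsCMCCurve n H γ ν) (t : ℝ) : ⟪ν t, deriv γ t⟫ = 0 := by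
  obtain ⟨x⟩ := FibreSphere.nonempty n
  have h1 := h.cmc.normal_perp (t, x) ((1 : ℝ), (0 : EuclideanSpace ℝ (Fin (n - 2))))
  have h2 := (inner_spiralProduct_differential n γ ν _ (t, x) (h.hasDerivAt t) _).symm.trans h1
  simpa using h2

theorem inner_deriv_eq_zero_of_norm_eq_one {E : Type*} [NormedAddCommGroup E]
    [InnerProductSpace ℝ E] {f : ℝ → E} {f' : E} {t : ℝ} (hf : ∀ t, ‖f t‖ = 1)
    (h : HasDerivAt f f' t) : ⟪f t, f'⟫ = 0 := by
  have h1 := h.inner ℝ h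
  have h2 : (fun t => ⟪f t, f t⟫) = fun _ => (1 : ℝ) := by
    ext t; rw [real_inner_self_eq_norm_sq, hf]; norm_num
  rw [h2] at h1
  have h3 := h1.unique (hasDerivAt_const t (1 : ℝ))
  rw [real_inner_comm (f t) f'] at h3
  linarith

theorem inner_deriv_add_eq_zero {E : Type*} [NormedAddCommGroup E]
    [InnerProductSpace ℝ E] {f g : ℝ → E} {f' g' : E} {t : ℝ} (hfg : ∀ t, ⟪f t, g t⟫ = 0)
    (hf : HasDerivAt f f' t) (hg : HasDerivAt g g' t) : ⟪f t, g'⟫ + ⟪f', g t⟫ = 0 := by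
  have h1 := hf.inner ℝ hg
  have h2 : (fun t => ⟪f t, g t⟫) = fun _ => (0 : ℝ) := by
    ext t; exact hfg t
  rw [h2] at h1
  exact h1.unique (hasDerivAt_const t (0 : ℝ))

/-- The converse of `isCMCCurve_of_hasDerivAt`. Since `ν'` is orthogonal to both `ν` and `γ`, it is
a multiple `-κ γ'` of the tangent; the trace over a single orthonormal frame then determines `κ`. -/
theorem IsCMCCurve.hasDerivAt_normal {n : ℕ} {H : ℝ} {γ ν : ℝ → Space3}
    (h : IsCMCCurve n H γ ν) (t : ℝ) :
    HasDerivAt ν (-(H + (n - 2 : ℕ) * ((ν t).snd / (γ t).snd)) • deriv γ t) t := by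
  have hν : HasDerivAt ν (deriv ν t) t := (h.contDiff_normal.differentiable (by norm_num) t).hasDerivAt
  have hγ := h.hasDerivAt t
  have hv : 0 < ‖deriv γ t‖ := norm_pos_iff.2 (h.regular t)
  have h1 : ⟪γ t, deriv γ t⟫ = 0 := inner_deriv_eq_zero_of_norm_eq_one h.norm_eq_one hγ
  have h2 : ⟪ν t, deriv ν t⟫ = 0 := inner_deriv_eq_zero_of_norm_eq_one h.norm_normal hν
  have h3 : ⟪γ t, deriv ν t⟫ = 0 := by
    have := inner_deriv_add_eq_zero h.inner_normal hν hγ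
    rw [h.inner_normal_deriv, zero_add, real_inner_comm] at this
    exact this
  obtain ⟨κ, hκ⟩ : ∃ κ : ℝ, deriv ν t = -κ • deriv γ t := by
    have h4 := eq_sum_of_orthonormal (h.norm_eq_one t)
      (b := ‖deriv γ t‖⁻¹ • deriv γ t) (by rw [norm_smul, norm_inv, norm_norm, inv_mul_cancel₀ hv.ne'])
      (h.norm_normal t) (by rw [real_inner_smul_right, h1, mul_zero])
      (by rw [real_inner_comm]; exact h.inner_normal t)
      (by rw [real_inner_smul_left, real_inner_comm, h.inner_normal_deriv, mul_zero]) (deriv ν t)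
    rw [h2, h3, zero_smul, zero_smul, zero_add, add_zero, smul_smul] at h4
    exact ⟨-(⟪‖deriv γ t‖⁻¹ • deriv γ t, deriv ν t⟫ * ‖deriv γ t‖⁻¹), by rw [neg_neg]; exact h4⟩
  rw [hκ] at hν
  obtain ⟨x⟩ := FibreSphere.nonempty n
  have hb := (h.height_pos t).ne'
  obtain ⟨e, he⟩ := exists_orthonormal_differential n γ _ (t, x) hγ (h.regular t) hb
  have h5 := h.cmc.trace_eq (t, x) e he
  rw [sum_secondFundamentalForm_spiralProduct n γ ν _ κ (t, x) hγ hν (h.regular t) hb e he] at h5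
  have h6 : H + (n - 2 : ℕ) * ((ν t).snd / (γ t).snd) = κ := by
    rw [← h5]; ring
  rw [h6]
  exact hν

/-! ### Global solutions for Lipschitz vector fields -/

open scoped NNReal in
/-- A bounded Lipschitz vector field is complete. -/
theorem exists_forall_hasDerivAt_of_lipschitzWith {E : Type*} [NormedAddCommGroup E]
    [NormedSpace ℝ E] [CompleteSpace E] {V : E → E} {K L : ℝ≥0} (hK : LipschitzWith K V)
    (hL : ∀ x, ‖V x‖ ≤ L) (x : E) : ∃ f : ℝ → E, f 0 = x ∧ ∀ t, HasDerivAt f (V (f t)) t := by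
  have h1 : ∀ N : ℕ, ∃ f : ℝ → E, f 0 = x ∧
      ∀ t ∈ Ioo (-(N + 1 : ℝ)) (N + 1), HasDerivAt f (V (f t)) t := by
    intro N
    have hN : (0 : ℝ) ∈ Icc (-(N + 1 : ℝ)) (N + 1) := by constructor <;> linarith [N.cast_nonneg (α := ℝ)]
    -- The radius `L * (N + 1)` is the distance a solution of speed at most `L` can cover in the
    -- time available, so no shortening of the interval is required.
    have hP : IsPicardLindelof (fun _ => V) (⟨0, hN⟩ : Icc (-(N + 1 : ℝ)) (N + 1)) x
        (L * (N + 1)) 0 L K :=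
      IsPicardLindelof.of_time_independent (fun y _ => hL y) hK.lipschitzOnWith (by simp)
    obtain ⟨f, hf0, hf⟩ := hP.exists_eq_forall_mem_Icc_hasDerivWithinAt₀
    exact ⟨f, hf0, fun t ht => (hf t (Ioo_subset_Icc_self ht)).hasDerivAt (Icc_mem_nhds ht.1 ht.2)⟩
  choose f hf0 hf using h1
  have hagree : ∀ N M : ℕ, N ≤ M → EqOn (f N) (f M) (Ioo (-(N + 1 : ℝ)) (N + 1)) := by
    intro N M hNM
    have hc : (N : ℝ) ≤ M := by exact_mod_cast hNM
    have hN := N.cast_nonneg (α := ℝ)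
    refine ODE_solution_unique_of_mem_Ioo (v := fun _ => V) (s := fun _ => univ) (t₀ := 0)
      (fun t _ => hK.lipschitzOnWith) ⟨by linarith, by linarith⟩ (fun t ht => ⟨hf N t ht, trivial⟩)
      (fun t ht => ⟨hf M t ⟨by linarith [ht.1], by linarith [ht.2]⟩, trivial⟩)
      (by rw [hf0, hf0])
  -- The local solutions agree on common intervals. Near `t` the index `⌈|s|⌉₊` may jump, but it
  -- stays at most `⌈|t|⌉₊ + 1`, so the glued function coincides there with one fixed solution.
  refine ⟨fun t => f ⌈|t|⌉₊ t, by simpa using hf0 _, fun t => ?_⟩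
  set M := ⌈|t|⌉₊ + 1 with hM
  have hmem : ∀ s : ℝ, s ∈ Ioo (-(⌈|s|⌉₊ + 1 : ℝ)) (⌈|s|⌉₊ + 1) := fun s => by
    have := Nat.le_ceil |s|
    constructor <;> linarith [neg_abs_le s, le_abs_self s]
  have hev : (fun s => f ⌈|s|⌉₊ s) =ᶠ[𝓝 t] f M := by
    have h2 : ∀ᶠ s in 𝓝 t, |s| < |t| + 1 :=
      (continuous_abs.tendsto t).eventually (Iio_mem_nhds (by linarith))
    filter_upwards [h2] with s hs
    refine hagree _ _ ?_ (hmem s)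
    rw [hM, Nat.ceil_le]
    push_cast
    linarith [Nat.le_ceil |t|]
  have h3 : f ⌈|t|⌉₊ t = f M t := hev.eq_of_nhds
  change HasDerivAt _ (V (f ⌈|t|⌉₊ t)) t
  rw [h3]
  refine (hf M t ?_).congr_of_eventuallyEq hev
  have := hmem t
  rw [hM]; push_cast
  constructor <;> linarith [this.1, this.2]

-- Grönwall's inequality for positive times; for negative times it is applied to the field `-V`,
-- which has the same Lipschitz constant.
open scoped NNReal in
theorem dist_le_of_hasDerivAt_of_lipschitzWith {E : Type*} [NormedAddCommGroup E]
    [NormedSpace ℝ E] {V : E → E} {K : ℝ≥0} (hK : LipschitzWith K V) {f g : ℝ → E}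
    (hf : ∀ t, HasDerivAt f (V (f t)) t) (hg : ∀ t, HasDerivAt g (V (g t)) t) (t : ℝ) :
    dist (f t) (g t) ≤ dist (f 0) (g 0) * Real.exp (K * |t|) := by
  have key : ∀ {W : E → E} {f g : ℝ → E}, LipschitzWith K W → (∀ t, HasDerivAt f (W (f t)) t) →
      (∀ t, HasDerivAt g (W (g t)) t) → ∀ t, 0 ≤ t →
      dist (f t) (g t) ≤ dist (f 0) (g 0) * Real.exp (K * t) := by
    intro W f g hW hf hg t ht
    have := dist_le_of_trajectories_ODE (v := fun _ => W) (a := 0) (b := t) (fun _ => hW)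
      (HasDerivAt.continuousOn fun s _ => hf s) (fun s _ => (hf s).hasDerivWithinAt)
      (HasDerivAt.continuousOn fun s _ => hg s) (fun s _ => (hg s).hasDerivWithinAt) le_rfl t
      ⟨ht, le_rfl⟩
    simpa using this
  rcases le_total 0 t with ht | ht
  · rw [abs_of_nonneg ht]; exact key hK hf hg t ht
  · have h1 := key (W := fun x => -V x) (f := fun s => f (-s)) (g := fun s => g (-s))
      hK.neg
      (fun s => by simpa [Function.comp_def] using (hf (-s)).scomp s (hasDerivAt_neg s))
      (fun s => by simpa [Function.comp_def] using (hg (-s)).scomp s (hasDerivAt_neg s)) (-t) (by linarith)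
    rw [abs_of_nonpos ht]
    simpa using h1

-- The intermediate point `F c q.2` separates the two variables: the change of initial value is
-- controlled by Grönwall, the change of time by continuity of a single solution.
open scoped NNReal in
theorem continuousOn_of_hasDerivAt_of_lipschitzWith {E X : Type*} [NormedAddCommGroup E]
    [NormedSpace ℝ E] [TopologicalSpace X] {V : E → E} {K : ℝ≥0} (hK : LipschitzWith K V)
    {S : Set X} {F : X → ℝ → E} (hF : ∀ c ∈ S, ∀ t, HasDerivAt (F c) (V (F c t)) t)
    (h0 : ContinuousOn (fun c => F c 0) S) :
    ContinuousOn (fun q : X × ℝ => F q.1 q.2) (S ×ˢ univ) := by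
  rintro ⟨c, t⟩ ⟨hc, -⟩
  have hc' : c ∈ S := hc
  rw [ContinuousWithinAt, tendsto_iff_dist_tendsto_zero]
  have hfst : Tendsto (fun q : X × ℝ => q.1) (𝓝[S ×ˢ univ] (c, t)) (𝓝[S] c) :=
    (continuous_fst.continuousWithinAt).tendsto_nhdsWithin fun q hq => hq.1
  have hsnd : Tendsto (fun q : X × ℝ => q.2) (𝓝[S ×ˢ univ] (c, t)) (𝓝 t) :=
    continuous_snd.continuousWithinAt
  have h1 : Tendsto (fun q : X × ℝ => dist (F q.1 0) (F c 0) * Real.exp (K * |q.2|) +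
      dist (F c q.2) (F c t)) (𝓝[S ×ˢ univ] (c, t)) (𝓝 (0 * Real.exp (K * |t|) + 0)) := by
    refine Tendsto.add (Tendsto.mul ?_ ?_) ?_
    · exact tendsto_iff_dist_tendsto_zero.1 ((h0 c hc').tendsto.comp hfst)
    · exact ((by fun_prop : Continuous fun s : ℝ => Real.exp (K * |s|)).tendsto t).comp hsnd
    · exact tendsto_iff_dist_tendsto_zero.1 ((hF c hc' t).continuousAt.tendsto.comp hsnd)
  rw [zero_mul, zero_add] at h1
  refine squeeze_zero' (Eventually.of_forall fun _ => dist_nonneg) ?_ h1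
  filter_upwards [self_mem_nhdsWithin] with q hq
  exact (dist_triangle _ (F c q.2) _).trans (add_le_add
    (dist_le_of_hasDerivAt_of_lipschitzWith hK (hF q.1 hq.1) (hF c hc') q.2) le_rfl)

-- The factor `c` accommodates curves of arbitrary speed and direction. It is bounded on compact
-- intervals, so the time-dependent field is Lipschitz uniformly there.
open scoped NNReal in
theorem eq_of_hasDerivAt_smul_of_lipschitzWith {E : Type*} [NormedAddCommGroup E]
    [NormedSpace ℝ E] {V : E → E} {K : ℝ≥0} (hK : LipschitzWith K V) {c : ℝ → ℝ}
    (hc : Continuous c) {f g : ℝ → E} (hf : ∀ t, HasDerivAt f (c t • V (f t)) t)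
    (hg : ∀ t, HasDerivAt g (c t • V (g t)) t) {t₀ : ℝ} (h0 : f t₀ = g t₀) : f = g := by
  ext t
  obtain ⟨R, hR⟩ : ∃ R, |t| < R ∧ |t₀| < R := ⟨max |t| |t₀| + 1, by
    constructor <;> linarith [le_max_left |t| |t₀|, le_max_right |t| |t₀|]⟩
  obtain ⟨M, hM⟩ := (isCompact_Icc (a := -R) (b := R)).exists_bound_of_continuousOn hc.continuousOn
  have hM0 : 0 ≤ M := (norm_nonneg _).trans (hM t (abs_le.1 hR.1.le))
  refine ODE_solution_unique_of_mem_Ioo (v := fun t x => c t • V x) (s := fun _ => univ)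
    (K := NNReal.mk M hM0 * K) (a := -R) (b := R) (fun s hs => ?_) (abs_lt.1 hR.2)
    (fun s _ => ⟨hf s, trivial⟩) (fun s _ => ⟨hg s, trivial⟩) h0 (abs_lt.1 hR.1)
  refine LipschitzWith.lipschitzOnWith (LipschitzWith.of_dist_le_mul fun x y => ?_)
  rw [dist_smul₀, NNReal.coe_mul, mul_assoc]
  exact mul_le_mul (hM s (Ioo_subset_Icc_self hs)) (hK.dist_le_mul x y) dist_nonneg hM0

/-- Solutions of an autonomous smooth differential equation are smooth. -/
theorem contDiff_of_hasDerivAt {E : Type*} [NormedAddCommGroup E] [NormedSpace ℝ E] {V : E → E}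
    (hV : ContDiff ℝ ∞ V) {f : ℝ → E} (hf : ∀ t, HasDerivAt f (V (f t)) t) : ContDiff ℝ ∞ f := by
  have hd : deriv f = fun t => V (f t) := funext fun t => (hf t).deriv
  rw [contDiff_infty]
  intro k
  induction k with
  | zero => exact contDiff_zero.2 (continuous_iff_continuousAt.2 fun t => (hf t).continuousAt)
  | succ k ih =>
    have : ((k + 1 : ℕ) : ℕ∞ω) = (k : ℕ∞ω) + 1 := by push_cast; rfl
    rw [this, contDiff_succ_iff_deriv]
    refine ⟨fun t => (hf t).differentiableAt, by simp, ?_⟩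
    rw [hd]
    exact (hV.of_le (by exact_mod_cast le_top)).comp ih

/-! ### The Frenet field and its cutoff -/

/-- The space of triples consisting of a point, a tangent and a normal vector. -/
abbrev FrameSpace : Type := Space3 × Space3 × Space3

/-- The geodesic curvature prescribed at a point `γ` with normal vector `ν`. -/
def curvature (n : ℕ) (h : ℝ) (γ ν : Space3) : ℝ :=
  -h + (n - 2 : ℕ) * (ν.snd / γ.snd)

/-- The right-hand side of the Frenet equations for the generating curves. -/
def frameField (n : ℕ) (h : ℝ) (F : FrameSpace) : FrameSpace :=
  (F.2.1, -F.1 + curvature n h F.1 F.2.2 • F.2.2, -curvature n h F.1 F.2.2 • F.2.1)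

/-- The set of triples of vectors in the unit ball, the first of which has height at least `δ`. -/
def frameRegion (δ : ℝ) : Set FrameSpace :=
  {F | ‖F.1‖ ≤ 1 ∧ ‖F.2.1‖ ≤ 1 ∧ ‖F.2.2‖ ≤ 1 ∧ δ ≤ F.1.snd}

/-- A smooth function which vanishes for heights at most `δ/2` and is one for heights at least
`δ`. -/
def heightCutoff (δ b : ℝ) : ℝ := Real.smoothTransition (2 / δ * b - 1)

/-- A smooth cutoff function for `frameRegion δ`. -/
def frameCutoff (δ : ℝ) (F : FrameSpace) : ℝ :=
  heightCutoff δ F.1.snd *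
    Real.smoothTransition (5 - (‖F.1‖ ^ 2 + ‖F.2.1‖ ^ 2 + ‖F.2.2‖ ^ 2))

theorem heightCutoff_of_le {δ b : ℝ} (hδ : 0 < δ) (hb : b ≤ δ / 2) : heightCutoff δ b = 0 := by
  apply Real.smoothTransition.zero_of_nonpos
  have : 2 / δ * b ≤ 2 / δ * (δ / 2) := by gcongr
  have h2 : 2 / δ * (δ / 2) = 1 := by field_simp
  linarith

theorem contDiff_heightCutoff (δ : ℝ) : ContDiff ℝ ∞ (heightCutoff δ) :=
  Real.smoothTransition.contDiff.comp (by fun_prop)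

/-- The cutoff vanishes near `b = 0`, which removes the singularity of the term `ν_b / b` in
`curvature`. -/
theorem contDiff_heightCutoff_div {δ : ℝ} (hδ : 0 < δ) :
    ContDiff ℝ ∞ fun b => heightCutoff δ b / b := by
  rw [contDiff_iff_contDiffAt]
  intro b
  rcases eq_or_ne b 0 with rfl | hb
  · have : (fun b => heightCutoff δ b / b) =ᶠ[𝓝 0] fun _ => 0 := by
      filter_upwards [Iio_mem_nhds (show (0 : ℝ) < δ / 2 by linarith)] with b hb
      rw [heightCutoff_of_le hδ (le_of_lt hb), zero_div]
    exact contDiffAt_const.congr_of_eventuallyEq this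
  · exact (contDiff_heightCutoff δ).contDiffAt.div contDiffAt_id hb

theorem frameCutoff_eq_one {δ : ℝ} (hδ : 0 < δ) {F : FrameSpace} (hF : F ∈ frameRegion δ) :
    frameCutoff δ F = 1 := by
  obtain ⟨h1, h2, h3, h4⟩ := hF
  have k1 : 1 ≤ 2 / δ * F.1.snd - 1 := by
    have : 2 / δ * δ ≤ 2 / δ * F.1.snd := by gcongr
    have h2 : 2 / δ * δ = 2 := by field_simp
    linarith
  -- On the region the three squares add up to at most `3`, so the argument is at least `2`. The
  -- constant `5` also makes the cutoff vanish outside the ball of radius `3`.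
  have k2 : 1 ≤ 5 - (‖F.1‖ ^ 2 + ‖F.2.1‖ ^ 2 + ‖F.2.2‖ ^ 2) := by
    have := pow_le_one₀ (n := 2) (norm_nonneg _) h1
    have := pow_le_one₀ (n := 2) (norm_nonneg _) h2
    have := pow_le_one₀ (n := 2) (norm_nonneg _) h3
    linarith
  rw [frameCutoff, heightCutoff, Real.smoothTransition.one_of_one_le k1,
    Real.smoothTransition.one_of_one_le k2, one_mul]

theorem frameCutoff_eq_zero {δ : ℝ} (hδ : 0 < δ) {F : FrameSpace} (hF : F.1.snd = 0) :
    frameCutoff δ F = 0 := by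
  rw [frameCutoff, heightCutoff_of_le hδ (by rw [hF]; linarith), zero_mul]

theorem contDiff_space3_snd : ContDiff ℝ ∞ fun w : Space3 => w.snd :=
  (WithLp.sndL (p := 2) (𝕜 := ℝ) (α := ℂ) (β := ℝ)).contDiff

theorem contDiff_frameCutoff_smul_frameField (n : ℕ) (h : ℝ) {δ : ℝ} (hδ : 0 < δ) :
    ContDiff ℝ ∞ fun F => frameCutoff δ F • frameField n h F := by
  have c1 : ContDiff ℝ ∞ fun F : FrameSpace => F.1 := contDiff_fst
  have c2 : ContDiff ℝ ∞ fun F : FrameSpace => F.2.1 := contDiff_fst.comp contDiff_snd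
  have c3 : ContDiff ℝ ∞ fun F : FrameSpace => F.2.2 := contDiff_snd.comp contDiff_snd
  have c4 : ContDiff ℝ ∞ fun F : FrameSpace => F.1.snd := contDiff_space3_snd.comp c1
  have c5 : ContDiff ℝ ∞ fun F : FrameSpace => F.2.2.snd := contDiff_space3_snd.comp c3
  have c6 : ContDiff ℝ ∞ fun F : FrameSpace =>
      Real.smoothTransition (5 - (‖F.1‖ ^ 2 + ‖F.2.1‖ ^ 2 + ‖F.2.2‖ ^ 2)) :=
    Real.smoothTransition.contDiff.comp (contDiff_const.sub
      (((c1.norm_sq ℝ).add (c2.norm_sq ℝ)).add (c3.norm_sq ℝ)))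
  have c7 : ContDiff ℝ ∞ (frameCutoff δ) := ((contDiff_heightCutoff δ).comp c4).mul c6
  have c8 : ContDiff ℝ ∞ fun F : FrameSpace => frameCutoff δ F * curvature n h F.1 F.2.2 := by
    have : (fun F : FrameSpace => frameCutoff δ F * curvature n h F.1 F.2.2) = fun F =>
        frameCutoff δ F * (-h) + (n - 2 : ℕ) * (F.2.2.snd * ((heightCutoff δ F.1.snd / F.1.snd) *
          Real.smoothTransition (5 - (‖F.1‖ ^ 2 + ‖F.2.1‖ ^ 2 + ‖F.2.2‖ ^ 2)))) := by
      funext F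
      simp only [frameCutoff, curvature]
      ring
    rw [this]
    exact (c7.mul contDiff_const).add (contDiff_const.mul
      (c5.mul (((contDiff_heightCutoff_div hδ).comp c4).mul c6)))
  have : (fun F => frameCutoff δ F • frameField n h F) = fun F =>
      (frameCutoff δ F • F.2.1, -(frameCutoff δ F • F.1) +
        (frameCutoff δ F * curvature n h F.1 F.2.2) • F.2.2,
        -((frameCutoff δ F * curvature n h F.1 F.2.2) • F.2.1)) := by
    funext F
    simp only [frameField, Prod.smul_mk, smul_add, smul_neg, neg_smul, smul_smul]
  rw [this]
  exact (c7.smul c2).prodMk (((c7.smul c1).neg.add (c8.smul c3)).prodMk (c8.smul c2).neg)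

theorem hasCompactSupport_frameCutoff_smul_frameField (n : ℕ) (h δ : ℝ) :
    HasCompactSupport fun F => frameCutoff δ F • frameField n h F := by
  refine HasCompactSupport.of_support_subset_isCompact
    (isCompact_closedBall (0 : FrameSpace) 3) fun F hF => ?_
  by_contra hF'
  apply hF
  have : frameCutoff δ F = 0 := by
    rw [frameCutoff]
    apply mul_eq_zero_of_right
    apply Real.smoothTransition.zero_of_nonpos
    by_contra hlt
    push Not at hlt
    apply hF'
    rw [mem_closedBall_zero_iff, Prod.norm_def, Prod.norm_def]
    refine max_le ?_ (max_le ?_ ?_) <;> nlinarith [norm_nonneg F.1, norm_nonneg F.2.1,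
      norm_nonneg F.2.2, sq_nonneg ‖F.1‖, sq_nonneg ‖F.2.1‖, sq_nonneg ‖F.2.2‖]
  simp [this]

open scoped NNReal in
theorem exists_lipschitzWith_frameCutoff_smul_frameField (n : ℕ) (h : ℝ) {δ : ℝ} (hδ : 0 < δ) :
    ∃ K : ℝ≥0, LipschitzWith K fun F => frameCutoff δ F • frameField n h F :=
  ContDiff.lipschitzWith_of_hasCompactSupport (hasCompactSupport_frameCutoff_smul_frameField n h δ)
    (contDiff_frameCutoff_smul_frameField n h hδ) (by simp)

theorem exists_forall_hasDerivAt_frameCutoff (n : ℕ) (h : ℝ) {δ : ℝ} (hδ : 0 < δ)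
    (F₀ : FrameSpace) : ∃ F : ℝ → FrameSpace, F 0 = F₀ ∧
      ∀ t, HasDerivAt F (frameCutoff δ (F t) • frameField n h (F t)) t := by
  obtain ⟨K, hK⟩ := exists_lipschitzWith_frameCutoff_smul_frameField n h hδ
  obtain ⟨L, hL⟩ := (hasCompactSupport_frameCutoff_smul_frameField n h δ).exists_bound_of_continuous
    (contDiff_frameCutoff_smul_frameField n h hδ).continuous
  exact exists_forall_hasDerivAt_of_lipschitzWith hK
    (L := NNReal.mk (max L 0) (le_max_right _ _)) (fun x => (hL x).trans (le_max_left _ _)) F₀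

/-- Inside the region the cutoff is invisible. Solutions that remain there therefore inherit
uniqueness, smoothness and continuous dependence from a globally Lipschitz smooth field. -/
theorem hasDerivAt_frameCutoff {n : ℕ} {h δ : ℝ} (hδ : 0 < δ) {c : ℝ} {F : ℝ → FrameSpace} {t : ℝ}
    (hF : HasDerivAt F (c • frameField n h (F t)) t) (hm : F t ∈ frameRegion δ) :
    HasDerivAt F (c • (fun F => frameCutoff δ F • frameField n h F) (F t)) t := by
  simp only [frameCutoff_eq_one hδ hm, one_smul]
  exact hF

theorem eq_of_hasDerivAt_frameField {n : ℕ} {h δ : ℝ} (hδ : 0 < δ) {c : ℝ → ℝ}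
    (hc : Continuous c) {F G : ℝ → FrameSpace}
    (hF : ∀ t, HasDerivAt F (c t • frameField n h (F t)) t) (hFm : ∀ t, F t ∈ frameRegion δ)
    (hG : ∀ t, HasDerivAt G (c t • frameField n h (G t)) t) (hGm : ∀ t, G t ∈ frameRegion δ)
    {t₀ : ℝ} (h0 : F t₀ = G t₀) : F = G := by
  obtain ⟨K, hK⟩ := exists_lipschitzWith_frameCutoff_smul_frameField n h hδ
  exact eq_of_hasDerivAt_smul_of_lipschitzWith hK hc (fun t => hasDerivAt_frameCutoff hδ (hF t) (hFm t))
    (fun t => hasDerivAt_frameCutoff hδ (hG t) (hGm t)) h0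

/-! ### Frenet systems: first integral, frames and symmetries -/

/-- The Frenet equations of the generating curves, for a parametrization of speed `|c|`. -/
structure IsFrenetSystem (n : ℕ) (h : ℝ) (c : ℝ → ℝ) (γ T ν : ℝ → Space3) : Prop where
  point : ∀ t, HasDerivAt γ (c t • T t) t
  tangent : ∀ t, HasDerivAt T (c t • (-γ t + curvature n h (γ t) (ν t) • ν t)) t
  normal : ∀ t, HasDerivAt ν (c t • (-curvature n h (γ t) (ν t) • T t)) t

theorem isFrenetSystem_iff {n : ℕ} {h : ℝ} {c : ℝ → ℝ} {γ T ν : ℝ → Space3} :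
    IsFrenetSystem n h c γ T ν ↔
      ∀ t, HasDerivAt (fun t => (γ t, T t, ν t)) (c t • frameField n h (γ t, T t, ν t)) t := by
  refine ⟨fun H t => (H.point t).prodMk ((H.tangent t).prodMk (H.normal t)), fun H => ⟨?_, ?_, ?_⟩⟩
  · exact fun t => (ContinuousLinearMap.fst ℝ Space3 (Space3 × Space3)).hasFDerivAt.comp_hasDerivAt t
      (H t)
  · exact fun t => ((ContinuousLinearMap.fst ℝ Space3 Space3).comp
      (ContinuousLinearMap.snd ℝ Space3 (Space3 × Space3))).hasFDerivAt.comp_hasDerivAt t (H t)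
  · exact fun t => ((ContinuousLinearMap.snd ℝ Space3 Space3).comp
      (ContinuousLinearMap.snd ℝ Space3 (Space3 × Space3))).hasFDerivAt.comp_hasDerivAt t (H t)

/-- The third component of the cross product. -/
def crossHeight (a b : Space3) : ℝ :=
  a.fst.re * b.fst.im - a.fst.im * b.fst.re

/-- An orthonormal basis of `ℂ ⊕ ℝ` of negative orientation. -/
structure IsFrame (a b c : Space3) : Prop where
  norm₁ : ‖a‖ = 1
  norm₂ : ‖b‖ = 1
  norm₃ : ‖c‖ = 1
  inner₁₂ : ⟪a, b⟫ = 0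
  inner₁₃ : ⟪a, c⟫ = 0
  inner₂₃ : ⟪b, c⟫ = 0
  cross₁₂ : crossHeight a b = -c.snd
  cross₁₃ : crossHeight a c = b.snd
  cross₂₃ : crossHeight b c = -a.snd

/-- The first integral of the mean curvature equation. -/
def energy (n : ℕ) (h : ℝ) (γ ν : Space3) : ℝ :=
  h / ((n : ℝ) - 1) * γ.snd ^ (n - 1) - γ.snd ^ (n - 2) * ν.snd

theorem HasDerivAt.space3_snd {f : ℝ → Space3} {f' : Space3} {t : ℝ} (hf : HasDerivAt f f' t) :
    HasDerivAt (fun t => (f t).snd) f'.snd t :=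
  (WithLp.sndL (p := 2) (𝕜 := ℝ) (α := ℂ) (β := ℝ)).hasFDerivAt.comp_hasDerivAt t hf

theorem HasDerivAt.space3_fst {f : ℝ → Space3} {f' : Space3} {t : ℝ} (hf : HasDerivAt f f' t) :
    HasDerivAt (fun t => (f t).fst) f'.fst t :=
  (WithLp.fstL (p := 2) (𝕜 := ℝ) (α := ℂ) (β := ℝ)).hasFDerivAt.comp_hasDerivAt t hf

theorem HasDerivAt.complex_re {f : ℝ → ℂ} {f' : ℂ} {t : ℝ} (hf : HasDerivAt f f' t) :
    HasDerivAt (fun t => (f t).re) f'.re t :=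
  Complex.reCLM.hasFDerivAt.comp_hasDerivAt t hf

theorem HasDerivAt.complex_im {f : ℝ → ℂ} {f' : ℂ} {t : ℝ} (hf : HasDerivAt f f' t) :
    HasDerivAt (fun t => (f t).im) f'.im t :=
  Complex.imCLM.hasFDerivAt.comp_hasDerivAt t hf

theorem HasDerivAt.crossHeight {f g : ℝ → Space3} {f' g' : Space3} {t : ℝ} (hf : HasDerivAt f f' t)
    (hg : HasDerivAt g g' t) :
    HasDerivAt (fun t => crossHeight (f t) (g t)) (crossHeight f' (g t) + crossHeight (f t) g') t := by
  have := (hf.space3_fst.complex_re.mul hg.space3_fst.complex_im).sub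
    (hf.space3_fst.complex_im.mul hg.space3_fst.complex_re)
  refine this.congr_deriv ?_
  simp only [_root_.crossHeight]
  ring

theorem eq_of_hasDerivAt_zero {f : ℝ → ℝ} (hf : ∀ t, HasDerivAt f 0 t) (s t : ℝ) : f s = f t :=
  is_const_of_deriv_eq_zero (fun t => (hf t).differentiableAt) (fun t => (hf t).deriv) s t

namespace IsFrenetSystem

variable {n : ℕ} {h : ℝ} {c : ℝ → ℝ} {γ T ν : ℝ → Space3}

theorem height (H : IsFrenetSystem n h c γ T ν) (t : ℝ) :
    HasDerivAt (fun t => (γ t).snd) (c t * (T t).snd) t := by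
  simpa using (H.point t).space3_snd

theorem tangent_height (H : IsFrenetSystem n h c γ T ν) (t : ℝ) :
    HasDerivAt (fun t => (T t).snd)
      (c t * (-(γ t).snd + curvature n h (γ t) (ν t) * (ν t).snd)) t := by
  exact (H.tangent t).space3_snd.congr_deriv (by simp; ring)

theorem normal_height (H : IsFrenetSystem n h c γ T ν) (t : ℝ) :
    HasDerivAt (fun t => (ν t).snd) (c t * (-(curvature n h (γ t) (ν t) * (T t).snd))) t := by
  simpa using (H.normal t).space3_snd

/-- Differentiation cancels everything except the ambiguity of `ν_b / b` at `b = 0`, where the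
hypothesis on `c` takes over. This form covers the cut-off system before its solutions are known to
have positive height. -/
theorem energy_eq (H : IsFrenetSystem n h c γ T ν) (hn : 3 ≤ n)
    (hc : ∀ t, (γ t).snd = 0 → c t = 0) (s t : ℝ) :
    energy n h (γ s) (ν s) = energy n h (γ t) (ν t) := by
  refine eq_of_hasDerivAt_zero (f := fun t => energy n h (γ t) (ν t)) (fun t => ?_) s t
  obtain ⟨m, rfl⟩ : ∃ m, n = m + 3 := ⟨n - 3, by omega⟩
  have h1 := ((H.height t).pow (m + 2)).const_mul (h / (((m + 3 : ℕ) : ℝ) - 1))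
  have h2 := ((H.height t).pow (m + 1)).mul (H.normal_height t)
  refine (h1.sub h2).congr_deriv ?_
  by_cases hb : (γ t).snd = 0
  · rw [hc t hb]; ring
  · have hm : ((m : ℝ) + 2) ≠ 0 := by positivity
    have e : m + 3 - 2 = m + 1 := by omega
    simp only [curvature, e, Nat.add_sub_cancel, Pi.pow_apply]
    push_cast
    have e2 : (m : ℝ) + 3 - 1 = m + 2 := by ring
    rw [e2]
    field_simp
    ring

/-- The system is `F' = A F` with `A` skew-symmetric. Hence the squared distance of the Gram matrix
from the identity is constant, and so is the squared length of the defect in the three cross product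
identities. Both are zero at `t₀`; no uniqueness theorem is needed. -/
theorem isFrame (H : IsFrenetSystem n h c γ T ν) {t₀ : ℝ}
    (h0 : IsFrame (γ t₀) (T t₀) (ν t₀)) (t : ℝ) : IsFrame (γ t) (T t) (ν t) := by
  have q1 : (⟪γ t, γ t⟫ - 1) ^ 2 + (⟪T t, T t⟫ - 1) ^ 2 + (⟪ν t, ν t⟫ - 1) ^ 2 + 2 * ⟪γ t, T t⟫ ^ 2 +
      2 * ⟪γ t, ν t⟫ ^ 2 + 2 * ⟪T t, ν t⟫ ^ 2 = 0 := by
    rw [eq_of_hasDerivAt_zero (f := fun t => (⟪γ t, γ t⟫ - 1) ^ 2 + (⟪T t, T t⟫ - 1) ^ 2 +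
      (⟪ν t, ν t⟫ - 1) ^ 2 + 2 * ⟪γ t, T t⟫ ^ 2 + 2 * ⟪γ t, ν t⟫ ^ 2 + 2 * ⟪T t, ν t⟫ ^ 2) ?_ t t₀]
    · simp only [real_inner_self_eq_norm_sq, h0.norm₁, h0.norm₂, h0.norm₃, h0.inner₁₂, h0.inner₁₃,
        h0.inner₂₃]
      norm_num
    · intro t
      have hγ := H.point t
      have hT := H.tangent t
      have hν := H.normal t
      have d := ((((((((hγ.inner ℝ hγ).sub_const 1).pow 2).add
        (((hT.inner ℝ hT).sub_const 1).pow 2)).add (((hν.inner ℝ hν).sub_const 1).pow 2)).add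
        (((hγ.inner ℝ hT).pow 2).const_mul 2)).add (((hγ.inner ℝ hν).pow 2).const_mul 2)).add
        (((hT.inner ℝ hν).pow 2).const_mul 2))
      refine d.congr_deriv ?_
      simp only [inner_add_left, inner_add_right, inner_neg_left, inner_neg_right,
        real_inner_smul_left, real_inner_smul_right, real_inner_comm (T t) (γ t),
        real_inner_comm (ν t) (γ t), real_inner_comm (ν t) (T t), neg_smul]
      push_cast
      ring
  have q2 : (crossHeight (γ t) (T t) + (ν t).snd) ^ 2 + (crossHeight (γ t) (ν t) - (T t).snd) ^ 2 +
      (crossHeight (T t) (ν t) + (γ t).snd) ^ 2 = 0 := by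
    rw [eq_of_hasDerivAt_zero (f := fun t => (crossHeight (γ t) (T t) + (ν t).snd) ^ 2 +
      (crossHeight (γ t) (ν t) - (T t).snd) ^ 2 + (crossHeight (T t) (ν t) + (γ t).snd) ^ 2) ?_ t t₀]
    · simp only [h0.cross₁₂, h0.cross₁₃, h0.cross₂₃]
      norm_num
    · intro t
      have hγ := H.point t
      have hT := H.tangent t
      have hν := H.normal t
      have d := ((((hγ.crossHeight hT).add hν.space3_snd).pow 2).add
        (((hγ.crossHeight hν).sub hT.space3_snd).pow 2)).add
        (((hT.crossHeight hν).add hγ.space3_snd).pow 2)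
      refine d.congr_deriv ?_
      simp only [crossHeight, WithLp.smul_fst, WithLp.smul_snd, WithLp.add_fst, WithLp.add_snd,
        WithLp.neg_fst, WithLp.neg_snd, Complex.real_smul, smul_eq_mul, neg_smul]
      simp
      ring
  have n1 := sq_nonneg (⟪γ t, γ t⟫ - 1)
  have n2 := sq_nonneg (⟪T t, T t⟫ - 1)
  have n3 := sq_nonneg (⟪ν t, ν t⟫ - 1)
  have n4 := sq_nonneg ⟪γ t, T t⟫
  have n5 := sq_nonneg ⟪γ t, ν t⟫
  have n6 := sq_nonneg ⟪T t, ν t⟫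
  have m1 := sq_nonneg (crossHeight (γ t) (T t) + (ν t).snd)
  have m2 := sq_nonneg (crossHeight (γ t) (ν t) - (T t).snd)
  have m3 := sq_nonneg (crossHeight (T t) (ν t) + (γ t).snd)
  have norm_of : ∀ x : Space3, (⟪x, x⟫ - 1) ^ 2 = (0 : ℝ) → ‖x‖ = 1 := fun x hx => by
    rw [norm_eq_sqrt_real_inner, Real.sqrt_eq_one]
    have := pow_eq_zero_iff (two_ne_zero) |>.1 hx
    linarith
  have zero_of : ∀ x : ℝ, x ^ 2 = 0 → x = 0 := fun x => (pow_eq_zero_iff two_ne_zero).1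
  exact
    { norm₁ := norm_of _ (by linarith)
      norm₂ := norm_of _ (by linarith)
      norm₃ := norm_of _ (by linarith)
      inner₁₂ := zero_of _ (by linarith)
      inner₁₃ := zero_of _ (by linarith)
      inner₂₃ := zero_of _ (by linarith)
      cross₁₂ := by linarith [zero_of _ (by linarith : (crossHeight (γ t) (T t) + (ν t).snd) ^ 2 = 0)]
      cross₁₃ := by linarith [zero_of _ (by linarith : (crossHeight (γ t) (ν t) - (T t).snd) ^ 2 = 0)]
      cross₂₃ := by linarith [zero_of _ (by linarith : (crossHeight (T t) (ν t) + (γ t).snd) ^ 2 = 0)] }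

/-- The image of a solution under a linear map which preserves heights. -/
theorem map (H : IsFrenetSystem n h c γ T ν) (R : Space3 →L[ℝ] Space3) (hR : ∀ w, (R w).snd = w.snd) :
    IsFrenetSystem n h c (fun t => R (γ t)) (fun t => R (T t)) (fun t => R (ν t)) where
  point t := (R.hasFDerivAt.comp_hasDerivAt t (H.point t)).congr_deriv (by simp)
  tangent t := (R.hasFDerivAt.comp_hasDerivAt t (H.tangent t)).congr_deriv
    (by simp only [map_smul, map_add, map_neg, curvature, hR])
  normal t := (R.hasFDerivAt.comp_hasDerivAt t (H.normal t)).congr_deriv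
    (by simp only [map_smul, curvature, hR])

/-- Reparametrization of a solution. -/
theorem comp (H : IsFrenetSystem n h c γ T ν) {φ φ' : ℝ → ℝ} (hφ : ∀ t, HasDerivAt φ (φ' t) t) :
    IsFrenetSystem n h (fun t => φ' t * c (φ t)) (fun t => γ (φ t)) (fun t => T (φ t))
      (fun t => ν (φ t)) where
  point t := by simpa [mul_smul, Function.comp_def] using (H.point (φ t)).scomp t (hφ t)
  tangent t := by
    simpa only [mul_smul, Function.comp_def] using (H.tangent (φ t)).scomp t (hφ t)
  normal t := by
    simpa only [mul_smul, Function.comp_def] using (H.normal (φ t)).scomp t (hφ t)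

/-- Reversing the direction of a curve while keeping its normal. -/
theorem neg_tangent (H : IsFrenetSystem n h c γ T ν) :
    IsFrenetSystem n h (fun t => -c t) γ (fun t => -T t) ν where
  point t := by simpa using H.point t
  tangent t := (H.tangent t).neg.congr_deriv (by simp only [neg_smul])
  normal t := by simpa only [neg_smul, smul_neg, neg_neg] using H.normal t

end IsFrenetSystem

/-! ### The lower height bound and global existence -/

/-- The three heights are the coordinates of the unit vector `pole` in the frame. -/
theorem IsFrame.height_sq {a b c : Space3} (H : IsFrame a b c) :
    a.snd ^ 2 + b.snd ^ 2 + c.snd ^ 2 = 1 := by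
  have h1 := eq_sum_of_orthonormal H.norm₁ H.norm₂ H.norm₃ H.inner₁₂ H.inner₁₃ H.inner₂₃ pole
  have h2 : ∀ x : Space3, ⟪x, pole⟫ = x.snd := fun x => by
    simp [pole, WithLp.prod_inner_apply]
  have h3 := congrArg (fun w : Space3 => w.snd) h1
  simp only [h2, WithLp.add_snd, WithLp.smul_snd, smul_eq_mul] at h3
  have h4 : pole.snd = 1 := rfl
  rw [h4] at h3
  linarith

theorem IsFrame.norm_fst_sq {a b c : Space3} (H : IsFrame a b c) : ‖a.fst‖ ^ 2 = 1 - a.snd ^ 2 := by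
  have h := WithLp.prod_norm_sq_eq_of_L2 a
  rw [H.norm₁, Real.norm_eq_abs, sq_abs] at h
  linarith

/-- The lower bound for the height of a curve with first integral `C`. -/
def minHeight (n : ℕ) (h C : ℝ) : ℝ := C / (h / ((n : ℝ) - 1) + 1)

theorem minHeight_pos {n : ℕ} {h C : ℝ} (hn : 3 ≤ n) (hh : 0 < h) (hC : 0 < C) :
    0 < minHeight n h C := by
  have : (3 : ℝ) ≤ n := by exact_mod_cast hn
  have : 0 < (n : ℝ) - 1 := by linarith
  unfold minHeight
  positivity

/-- Both powers of `b` in `energy` have positive exponent, so the energy is at most `(h/(n-1) + 1)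
|b|`. The absolute value is there because the sign of `b` is not yet known when this is applied to
the cut-off system. -/
theorem minHeight_le_abs_height {n : ℕ} {h : ℝ} {γ ν : Space3} (hn : 3 ≤ n) (hh : 0 < h)
    (hγ : |γ.snd| ≤ 1) (hν : |ν.snd| ≤ 1) : minHeight n h (energy n h γ ν) ≤ |γ.snd| := by
  have hn' : (3 : ℝ) ≤ n := by exact_mod_cast hn
  have hpos : 0 < h / ((n : ℝ) - 1) := by apply div_pos hh; linarith
  have h0 := abs_nonneg γ.snd
  rw [minHeight, div_le_iff₀ (by linarith)]
  have h1 : γ.snd ^ (n - 1) ≤ |γ.snd| := by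
    calc γ.snd ^ (n - 1) ≤ |γ.snd ^ (n - 1)| := le_abs_self _
      _ = |γ.snd| ^ (n - 1) := abs_pow _ _
      _ ≤ |γ.snd| ^ 1 := pow_le_pow_of_le_one h0 hγ (by omega)
      _ = |γ.snd| := pow_one _
  have h2 : -(γ.snd ^ (n - 2) * ν.snd) ≤ |γ.snd| := by
    calc -(γ.snd ^ (n - 2) * ν.snd) ≤ |γ.snd ^ (n - 2) * ν.snd| := neg_le_abs _
      _ = |γ.snd| ^ (n - 2) * |ν.snd| := by rw [abs_mul, abs_pow]
      _ ≤ |γ.snd| ^ 1 * 1 := mul_le_mul (pow_le_pow_of_le_one h0 hγ (by omega)) hν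
          (abs_nonneg _) (by positivity)
      _ = |γ.snd| := by ring
  rw [energy]
  nlinarith [mul_le_mul_of_nonneg_left h1 hpos.le]

/-- A curve in the upper hemisphere with its Frenet frame which solves the mean curvature equation
with first integral `C`. -/
structure IsSolution (n : ℕ) (h C : ℝ) (c : ℝ → ℝ) (γ T ν : ℝ → Space3) : Prop where
  system : IsFrenetSystem n h c γ T ν
  frame : ∀ t, IsFrame (γ t) (T t) (ν t)
  height_pos : ∀ t, 0 < (γ t).snd
  energy_eq : ∀ t, energy n h (γ t) (ν t) = C

theorem abs_space3_snd_le_norm (w : Space3) : |w.snd| ≤ ‖w‖ := by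
  have := WithLp.norm_snd_le (p := 2) (x := w)
  rwa [Real.norm_eq_abs] at this

theorem IsSolution.mem_frameRegion {n : ℕ} {h C : ℝ} {c : ℝ → ℝ} {γ T ν : ℝ → Space3}
    (H : IsSolution n h C c γ T ν) (hn : 3 ≤ n) (hh : 0 < h) (t : ℝ) :
    (γ t, T t, ν t) ∈ frameRegion (minHeight n h C) := by
  refine ⟨(H.frame t).norm₁.le, (H.frame t).norm₂.le, (H.frame t).norm₃.le, ?_⟩
  have := minHeight_le_abs_height (n := n) (γ := γ t) (ν := ν t) hn hh
    ((abs_space3_snd_le_norm _).trans (H.frame t).norm₁.le)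
    ((abs_space3_snd_le_norm _).trans (H.frame t).norm₃.le)
  rwa [H.energy_eq, abs_of_pos (H.height_pos t)] at this

/-- The cut-off equation, which has global solutions, still preserves frames and energy. So `|b|`
stays above `minHeight`, and by continuity `b` stays positive. The solution thus never leaves the
region where the cutoff is one, and it solves the original equation. -/
theorem exists_isSolution {n : ℕ} {h : ℝ} (hn : 3 ≤ n) (hh : 0 < h) {γ₀ T₀ ν₀ : Space3}
    (hF : IsFrame γ₀ T₀ ν₀) (hb : 0 < γ₀.snd) (hC : 0 < energy n h γ₀ ν₀) :
    ∃ γ T ν : ℝ → Space3, γ 0 = γ₀ ∧ T 0 = T₀ ∧ ν 0 = ν₀ ∧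
      IsSolution n h (energy n h γ₀ ν₀) (fun _ => 1) γ T ν := by
  set C := energy n h γ₀ ν₀ with hCdef
  have hδ := minHeight_pos hn hh hC
  obtain ⟨F, hF0, hFd⟩ := exists_forall_hasDerivAt_frameCutoff n h hδ (γ₀, T₀, ν₀)
  have hsys : IsFrenetSystem n h (fun t => frameCutoff (minHeight n h C) (F t)) (fun t => (F t).1)
      (fun t => (F t).2.1) (fun t => (F t).2.2) := isFrenetSystem_iff.2 hFd
  have hfr : ∀ t, IsFrame (F t).1 (F t).2.1 (F t).2.2 := hsys.isFrame (t₀ := 0) (by rw [hF0]; exact hF)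
  have hen : ∀ t, energy n h (F t).1 (F t).2.2 = C := fun t => by
    rw [hsys.energy_eq hn (fun t ht => frameCutoff_eq_zero hδ ht) t 0, hF0]
  have habs : ∀ t, minHeight n h C ≤ |(F t).1.snd| := fun t => by
    rw [← hen t]
    exact minHeight_le_abs_height hn hh ((abs_space3_snd_le_norm _).trans (hfr t).norm₁.le)
      ((abs_space3_snd_le_norm _).trans (hfr t).norm₃.le)
  have hcont : Continuous fun t => (F t).1.snd :=
    continuous_iff_continuousAt.2 fun t => (hsys.height t).continuousAt
  have hpos : ∀ t, 0 < (F t).1.snd := by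
    intro t
    by_contra hle
    push Not at hle
    have h0 : 0 < (F 0).1.snd := by rw [hF0]; exact hb
    obtain ⟨s, hs⟩ := mem_range_of_exists_le_of_exists_ge hcont ⟨t, hle⟩ ⟨0, h0.le⟩
    have := habs s
    have hs' : (F s).1.snd = 0 := hs
    rw [hs', abs_zero] at this
    linarith
  have hone : (fun t => frameCutoff (minHeight n h C) (F t)) = fun _ => 1 := by
    funext t
    refine frameCutoff_eq_one hδ ⟨(hfr t).norm₁.le, (hfr t).norm₂.le, (hfr t).norm₃.le, ?_⟩
    have := habs t
    rwa [abs_of_pos (hpos t)] at this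
  rw [hone] at hsys
  exact ⟨_, _, _, by rw [hF0], by rw [hF0], by rw [hF0], hsys, hfr, hpos, hen⟩

namespace IsSolution

variable {n : ℕ} {h C : ℝ} {c : ℝ → ℝ} {γ T ν γ' T' ν' : ℝ → Space3}

theorem unique (H : IsSolution n h C c γ T ν) (H' : IsSolution n h C c γ' T' ν') (hn : 3 ≤ n)
    (hh : 0 < h) (hC : 0 < C) (hc : Continuous c) {t₀ : ℝ} (h1 : γ t₀ = γ' t₀) (h2 : T t₀ = T' t₀)
    (h3 : ν t₀ = ν' t₀) (t : ℝ) : γ t = γ' t ∧ T t = T' t ∧ ν t = ν' t := by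
  have := eq_of_hasDerivAt_frameField (minHeight_pos hn hh hC) hc (isFrenetSystem_iff.1 H.system)
    (H.mem_frameRegion hn hh) (isFrenetSystem_iff.1 H'.system) (H'.mem_frameRegion hn hh)
    (t₀ := t₀) (by rw [h1, h2, h3])
  have ht := congrFun this t
  simpa using ht

theorem contDiff (H : IsSolution n h C (fun _ => 1) γ T ν) (hn : 3 ≤ n) (hh : 0 < h) (hC : 0 < C) :
    ContDiff ℝ ∞ γ ∧ ContDiff ℝ ∞ T ∧ ContDiff ℝ ∞ ν := by
  have hδ := minHeight_pos hn hh hC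
  have h1 := contDiff_of_hasDerivAt (contDiff_frameCutoff_smul_frameField n h hδ)
    (f := fun t => (γ t, T t, ν t)) fun t => by
      simpa using hasDerivAt_frameCutoff hδ (isFrenetSystem_iff.1 H.system t)
        (H.mem_frameRegion hn hh t)
  exact ⟨contDiff_fst.comp h1, (contDiff_fst.comp contDiff_snd).comp h1,
    (contDiff_snd.comp contDiff_snd).comp h1⟩

theorem comp (H : IsSolution n h C c γ T ν) {φ φ' : ℝ → ℝ} (hφ : ∀ t, HasDerivAt φ (φ' t) t) :
    IsSolution n h C (fun t => φ' t * c (φ t)) (fun t => γ (φ t)) (fun t => T (φ t))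
      (fun t => ν (φ t)) :=
  ⟨H.system.comp hφ, fun _ => H.frame _, fun _ => H.height_pos _, fun _ => H.energy_eq _⟩

end IsSolution

/-- The height bound degenerates as the constant tends to `0`, so the argument is local: all
constants above `C / 2` share the bound for `C / 2`, hence one cut-off field. -/
theorem continuousOn_isSolution {n : ℕ} {h : ℝ} (hn : 3 ≤ n) (hh : 0 < h) {S : Set ℝ}
    (hS : ∀ C ∈ S, 0 < C) {Γ T N : ℝ → ℝ → Space3}
    (hsol : ∀ C ∈ S, IsSolution n h C (fun _ => 1) (Γ C) (T C) (N C))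
    (h0 : ContinuousOn (fun C => (Γ C 0, T C 0, N C 0)) S) :
    ContinuousOn (fun q : ℝ × ℝ => (Γ q.1 q.2, T q.1 q.2, N q.1 q.2)) (S ×ˢ univ) := by
  rintro ⟨C, t⟩ ⟨hC, -⟩
  have hC0 := hS C hC
  have hδ := minHeight_pos hn hh (half_pos hC0)
  obtain ⟨K, hK⟩ := exists_lipschitzWith_frameCutoff_smul_frameField n h hδ
  have hn' : (3 : ℝ) ≤ n := by exact_mod_cast hn
  have hpos : 0 < h / ((n : ℝ) - 1) := by apply div_pos hh; linarith
  have key := continuousOn_of_hasDerivAt_of_lipschitzWith hK (S := S ∩ Ioi (C / 2))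
    (F := fun C t => (Γ C t, T C t, N C t)) (fun D hD t => by
      have hm := (hsol D hD.1).mem_frameRegion hn hh t
      have hle : minHeight n h (C / 2) ≤ minHeight n h D :=
        div_le_div_of_nonneg_right (le_of_lt hD.2) (by linarith)
      simpa using hasDerivAt_frameCutoff hδ (isFrenetSystem_iff.1 (hsol D hD.1).system t)
        ⟨hm.1, hm.2.1, hm.2.2.1, hle.trans hm.2.2.2⟩) (h0.mono inter_subset_left)
  refine (key (C, t) ⟨⟨hC, ?_⟩, trivial⟩).mono_of_mem_nhdsWithin ?_
  · change C / 2 < C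
    linarith
  · have : Ioi (C / 2) ×ˢ (univ : Set ℝ) ∈ 𝓝 ((C, t) : ℝ × ℝ) :=
      prod_mem_nhds (Ioi_mem_nhds (by linarith)) univ_mem
    filter_upwards [self_mem_nhdsWithin, mem_nhdsWithin_of_mem_nhds this] with q hq1 hq2
    exact ⟨⟨hq1.1, hq2.1⟩, trivial⟩

/-! ### Two facts from real analysis -/

/-- The inverse order isomorphism, extended by constants to the line. It serves twice: for the
lowest angle as a function of `C`, and for time as a function of the angle along an arc. -/
theorem exists_continuous_inverse {f : ℝ → ℝ} {a b : ℝ} (hab : a ≤ b)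
    (hf : ContinuousOn f (Icc a b)) (hm : StrictMonoOn f (Icc a b)) :
    ∃ g : ℝ → ℝ, Continuous g ∧ (∀ t ∈ Icc a b, g (f t) = t) ∧
      ∀ y ∈ Icc (f a) (f b), g y ∈ Icc a b ∧ f (g y) = y := by
  have ha : a ∈ Icc a b := left_mem_Icc.2 hab
  have hb : b ∈ Icc a b := right_mem_Icc.2 hab
  have hmem : ∀ t : Icc a b, f t ∈ Icc (f a) (f b) := fun t =>
    ⟨hm.monotoneOn ha t.2 t.2.1, hm.monotoneOn t.2 hb t.2.2⟩
  let F : Icc a b → Icc (f a) (f b) := fun t => ⟨f t, hmem t⟩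
  have hF : StrictMono F := fun s t hst => hm s.2 t.2 hst
  have hsurj : Function.Surjective F := fun y => by
    obtain ⟨t, ht, hty⟩ := intermediate_value_Icc hab hf y.2
    exact ⟨⟨t, ht⟩, Subtype.ext hty⟩
  let e := hF.orderIsoOfSurjective F hsurj
  have hfab : f a ≤ f b := hm.monotoneOn ha hb hab
  refine ⟨IccExtend hfab fun y => (e.symm y : ℝ), ?_, fun t ht => ?_, fun y hy => ?_⟩
  · exact (continuous_subtype_val.comp e.symm.continuous).Icc_extend'
  · rw [IccExtend_of_mem hfab _ (hmem ⟨t, ht⟩)]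
    exact congrArg Subtype.val (e.symm_apply_apply ⟨t, ht⟩)
  · rw [IccExtend_of_mem hfab _ hy]
    exact ⟨(e.symm ⟨y, hy⟩).2, congrArg Subtype.val (e.apply_symm_apply ⟨y, hy⟩)⟩

/-- By the mean value theorem `f (t + 1) - f t`, which tends to `0`, is a value of `f'` at a point
beyond `t`. -/
theorem eq_zero_of_tendsto_of_hasDerivAt {f f' : ℝ → ℝ} {l L : ℝ} (hf : ∀ t, HasDerivAt f (f' t) t)
    (hl : Tendsto f atTop (𝓝 l)) (hL : Tendsto f' atTop (𝓝 L)) : L = 0 := by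
  have h1 : ∀ t, ∃ ξ, t ≤ ξ ∧ f' ξ = f (t + 1) - f t := fun t => by
    obtain ⟨ξ, hξ, h⟩ := exists_hasDerivAt_eq_slope f f' (show t < t + 1 by linarith)
      (HasDerivAt.continuousOn fun s _ => hf s) fun s _ => hf s
    exact ⟨ξ, hξ.1.le, by rw [h]; ring⟩
  choose ξ hξ1 hξ2 using h1
  have h2 : Tendsto (fun t => f' (ξ t)) atTop (𝓝 L) :=
    hL.comp (tendsto_atTop_mono hξ1 tendsto_id)
  have h3 : Tendsto (fun t => f' (ξ t)) atTop (𝓝 (l - l)) := by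
    simp only [hξ2]
    exact (hl.comp (tendsto_atTop_add_const_right _ 1 tendsto_id)).sub hl
  rw [sub_self] at h3
  exact tendsto_nhds_unique h2 h3

/-! ### The level function of turning points -/

/-- The constant `C` for which the solution has a turning point at the height `sin s`. -/
def level (n : ℕ) (h s : ℝ) : ℝ :=
  h / ((n : ℝ) - 1) * Real.sin s ^ (n - 1) + Real.cos s * Real.sin s ^ (n - 2)

/-- The derivative of `level` is `sin^{n-3} s` times this function. -/
def levelSlope (n : ℕ) (h s : ℝ) : ℝ :=
  (n - 2 : ℕ) * Real.cos s ^ 2 + h * (Real.sin s * Real.cos s) - Real.sin s ^ 2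

theorem hasDerivAt_level {n : ℕ} (hn : 3 ≤ n) (h s : ℝ) :
    HasDerivAt (level n h) (Real.sin s ^ (n - 3) * levelSlope n h s) s := by
  obtain ⟨m, rfl⟩ : ∃ m, n = m + 3 := ⟨n - 3, by omega⟩
  have h1 := (((Real.hasDerivAt_sin s).pow (m + 2)).const_mul (h / (((m + 3 : ℕ) : ℝ) - 1))).add
    ((Real.hasDerivAt_cos s).mul ((Real.hasDerivAt_sin s).pow (m + 1)))
  refine h1.congr_deriv ?_
  have hm : ((m : ℝ) + 2) ≠ 0 := by positivity
  have e : m + 3 - 2 = m + 1 := by omega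
  have e2 : (m : ℝ) + 3 - 1 = m + 2 := by ring
  simp only [levelSlope, e, Nat.add_sub_cancel, Pi.pow_apply]
  push_cast
  rw [e2]
  field_simp
  ring

theorem continuous_level (n : ℕ) (h : ℝ) : Continuous (level n h) := by
  unfold level; fun_prop

theorem level_zero {n : ℕ} (hn : 3 ≤ n) (h : ℝ) : level n h 0 = 0 := by
  simp [level, show n - 1 ≠ 0 by omega, show n - 2 ≠ 0 by omega]

theorem level_pi_div_two (n : ℕ) (h : ℝ) : level n h (Real.pi / 2) = h / ((n : ℝ) - 1) := by
  simp [level]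

theorem lt_level_iff {n : ℕ} {h C s : ℝ} :
    rhsFun n (-h) C s < lhsFun n s ↔ C < level n h s := by
  rw [rhsFun, lhsFun, level, neg_div]
  constructor <;> intro H <;> linarith

/-- This is the strict decrease of `levelSlope / sin² = (n-2) cot² + h cot - 1`, with denominators
cleared. Therefore `levelSlope` changes sign exactly once on `(0, π/2]`. -/
theorem levelSlope_mul_sub_neg {n : ℕ} {h s t : ℝ} (hh : 0 < h) (hs : 0 < s) (hst : s < t)
    (ht : t ≤ Real.pi / 2) :
    levelSlope n h t * Real.sin s ^ 2 - levelSlope n h s * Real.sin t ^ 2 < 0 := by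
  have h1 : levelSlope n h t * Real.sin s ^ 2 - levelSlope n h s * Real.sin t ^ 2 =
      -(Real.sin (t - s) * ((n - 2 : ℕ) * Real.sin (t + s) + h * (Real.sin s * Real.sin t))) := by
    rw [Real.sin_sub, Real.sin_add, levelSlope, levelSlope]
    ring
  have hpi := Real.pi_pos
  have p1 : 0 < Real.sin (t - s) := Real.sin_pos_of_pos_of_lt_pi (by linarith) (by linarith)
  have p2 : 0 < Real.sin (t + s) := Real.sin_pos_of_pos_of_lt_pi (by linarith) (by linarith)
  have p3 : 0 < Real.sin s := Real.sin_pos_of_pos_of_lt_pi (by linarith) (by linarith)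
  have p4 : 0 < Real.sin t := Real.sin_pos_of_pos_of_lt_pi (by linarith) (by linarith)
  rw [h1]
  have : 0 < Real.sin (t - s) * ((n - 2 : ℕ) * Real.sin (t + s) + h * (Real.sin s * Real.sin t)) := by
    positivity
  linarith

/-- `s` is the point of `(0, π/2)` where `level n h` has its maximum. -/
structure IsPeak (n : ℕ) (h s : ℝ) : Prop where
  mem : s ∈ Ioo 0 (Real.pi / 2)
  slope_pos : ∀ t ∈ Ico 0 s, 0 < levelSlope n h t
  slope_neg : ∀ t ∈ Ioc s (Real.pi / 2), levelSlope n h t < 0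

theorem exists_isPeak {n : ℕ} {h : ℝ} (hn : 3 ≤ n) (hh : 0 < h) : ∃ s, IsPeak n h s := by
  have hpi := Real.pi_pos
  have h0 : 0 < levelSlope n h 0 := by
    simp only [levelSlope, Real.cos_zero, Real.sin_zero]
    have : (0 : ℝ) < (n - 2 : ℕ) := by exact_mod_cast (by omega : 0 < n - 2)
    norm_num
    omega
  have h1 : levelSlope n h (Real.pi / 2) < 0 := by simp [levelSlope]
  have hc : Continuous (levelSlope n h) := by unfold levelSlope; fun_prop
  obtain ⟨s, hs, hs0⟩ := intermediate_value_Icc' (by linarith : (0 : ℝ) ≤ Real.pi / 2)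
    hc.continuousOn ⟨h1.le, h0.le⟩
  have hs1 : 0 < s := lt_of_le_of_ne hs.1 (by rintro rfl; linarith)
  have hs2 : s < Real.pi / 2 := lt_of_le_of_ne hs.2 (by rintro rfl; linarith)
  refine ⟨s, ⟨hs1, hs2⟩, fun t ht => ?_, fun t ht => ?_⟩
  · rcases eq_or_lt_of_le ht.1 with rfl | ht0
    · exact h0
    have := levelSlope_mul_sub_neg (n := n) hh ht0 ht.2 hs2.le
    rw [hs0, zero_mul, zero_sub] at this
    exact pos_of_mul_pos_left (by linarith) (sq_nonneg (Real.sin s))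
  · have := levelSlope_mul_sub_neg (n := n) hh hs1 ht.1 ht.2
    rw [hs0, zero_mul, sub_zero] at this
    by_contra hcon
    push Not at hcon
    have := mul_nonneg hcon (sq_nonneg (Real.sin s))
    linarith

namespace IsPeak

variable {n : ℕ} {h s : ℝ}

theorem strictMonoOn (H : IsPeak n h s) (hn : 3 ≤ n) : StrictMonoOn (level n h) (Icc 0 s) := by
  refine strictMonoOn_of_deriv_pos (convex_Icc _ _) (continuous_level n h).continuousOn fun t ht => ?_
  rw [interior_Icc] at ht
  rw [(hasDerivAt_level hn h t).deriv]
  have := H.mem.2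
  have := Real.pi_pos
  exact mul_pos (pow_pos (Real.sin_pos_of_pos_of_lt_pi ht.1 (by linarith [ht.2])) _)
    (H.slope_pos t ⟨ht.1.le, ht.2⟩)

theorem strictAntiOn (H : IsPeak n h s) (hn : 3 ≤ n) :
    StrictAntiOn (level n h) (Icc s (Real.pi / 2)) := by
  refine strictAntiOn_of_deriv_neg (convex_Icc _ _) (continuous_level n h).continuousOn fun t ht => ?_
  rw [interior_Icc] at ht
  rw [(hasDerivAt_level hn h t).deriv]
  have := H.mem.1
  have := Real.pi_pos
  exact mul_neg_of_pos_of_neg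
    (pow_pos (Real.sin_pos_of_pos_of_lt_pi (by linarith [ht.1]) (by linarith [ht.2])) _)
    (H.slope_neg t ⟨ht.1, ht.2.le⟩)

theorem level_le (H : IsPeak n h s) (hn : 3 ≤ n) {t : ℝ} (ht : t ∈ Icc 0 (Real.pi / 2)) :
    level n h t ≤ level n h s := by
  rcases le_total t s with hts | hts
  · exact (H.strictMonoOn hn).monotoneOn ⟨ht.1, hts⟩ ⟨H.mem.1.le, le_rfl⟩ hts
  · exact (H.strictAntiOn hn).antitoneOn ⟨le_rfl, H.mem.2.le⟩ ⟨hts, ht.2⟩ hts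

theorem level_pole_lt (H : IsPeak n h s) (hn : 3 ≤ n) : h / ((n : ℝ) - 1) < level n h s := by
  rw [← level_pi_div_two]
  exact H.strictAntiOn hn ⟨le_rfl, H.mem.2.le⟩ ⟨H.mem.2.le, le_rfl⟩ H.mem.2

theorem mem_belowContact_iff (H : IsPeak n h s) (hn : 3 ≤ n) {C : ℝ} :
    C ∈ belowContact n (-h) ↔ C < level n h s := by
  constructor
  · rintro ⟨t, ht, htC⟩
    exact (lt_level_iff.1 htC).trans_le (H.level_le hn ⟨ht.1.le, ht.2.le⟩)
  · exact fun hC => ⟨s, H.mem, lt_level_iff.2 hC⟩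

/-- Excludes equilibria of the height away from the peak. Up to `π/2` the sign of the slope is
known. Beyond, `cos t < 0`, and a positive level forces `h sin t + (n-1) cos t > 0`, hence `h sin t
+ (n-2) cos t > 0`; the slope is `cos t` times the latter minus `sin² t`, so it is negative. -/
theorem levelSlope_ne_zero (H : IsPeak n h s) (hn : 3 ≤ n) {t : ℝ}
    (ht : t ∈ Ioo 0 Real.pi) (h0 : 0 < level n h t) (h1 : level n h t ≠ level n h s) :
    levelSlope n h t ≠ 0 := by
  rcases le_or_gt t (Real.pi / 2) with hle | hlt
  · rcases lt_trichotomy t s with hts | rfl | hts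
    · exact (H.slope_pos t ⟨ht.1.le, hts⟩).ne'
    · exact absurd rfl h1
    · exact (H.slope_neg t ⟨hts, hle⟩).ne
  · have hcos : Real.cos t < 0 := Real.cos_neg_of_pi_div_two_lt_of_lt hlt (by linarith [ht.2])
    have hsin : 0 < Real.sin t := Real.sin_pos_of_pos_of_lt_pi ht.1 ht.2
    have hn' : (3 : ℝ) ≤ n := by exact_mod_cast hn
    have hn1 : (0 : ℝ) < (n : ℝ) - 1 := by linarith
    have hcast : ((n - 2 : ℕ) : ℝ) = (n : ℝ) - 2 := by
      rw [Nat.cast_sub (by omega)]; norm_num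
    have e : Real.sin t ^ (n - 1) = Real.sin t ^ (n - 2) * Real.sin t := by
      rw [← pow_succ]; congr 1; omega
    have h2 : level n h t =
        Real.sin t ^ (n - 2) / ((n : ℝ) - 1) * (h * Real.sin t + ((n : ℝ) - 1) * Real.cos t) := by
      rw [level, e]; field_simp
    rw [h2] at h0
    have h3 : 0 < h * Real.sin t + ((n : ℝ) - 1) * Real.cos t :=
      pos_of_mul_pos_right h0 (by positivity)
    have h4 : levelSlope n h t < 0 := by
      rw [levelSlope, hcast]
      have h5 : 0 < h * Real.sin t + ((n : ℝ) - 2) * Real.cos t := by linarith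
      nlinarith [mul_neg_of_neg_of_pos hcos h5, sq_nonneg (Real.sin t)]
    exact h4.ne

end IsPeak

/-! ### Turning points, reflections and the integration constant -/

theorem inner_pole (w : Space3) : ⟪w, pole⟫ = w.snd := by
  simp [pole, WithLp.prod_inner_apply]

/-- When the tangent is horizontal, the pole has no component along it. -/
theorem IsFrame.pole_mem {a b c : Space3} (H : IsFrame a b c) (hb : b.snd = 0)
    {K : Submodule ℝ Space3} (ha : a ∈ K) (hc : c ∈ K) : pole ∈ K := by
  rw [eq_sum_of_orthonormal H.norm₁ H.norm₂ H.norm₃ H.inner₁₂ H.inner₁₃ H.inner₂₃ pole,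
    inner_pole b, hb, zero_smul, add_zero]
  exact K.add_mem (K.smul_mem _ ha) (K.smul_mem _ hc)

/-- The height is the inner product with the pole, which the reflection fixes; so the reflection is
a symmetry of the Frenet system. -/
theorem reflection_snd {K : Submodule ℝ Space3} (hK : pole ∈ K) (w : Space3) :
    (K.reflection w).snd = w.snd := by
  rw [← inner_pole, ← inner_pole w, ← K.reflection.inner_map_map w pole,
    Submodule.reflection_mem_subspace_eq_self hK]

namespace IsSolution

variable {n : ℕ} {h C : ℝ} {γ T ν : ℝ → Space3}

theorem deriv_eq (H : IsSolution n h C (fun _ => 1) γ T ν) (t : ℝ) : deriv γ t = T t := by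
  simpa using (H.system.point t).deriv

theorem norm_deriv (H : IsSolution n h C (fun _ => 1) γ T ν) (t : ℝ) : ‖deriv γ t‖ = 1 := by
  rw [H.deriv_eq, (H.frame t).norm₂]

theorem isCMCCurve (H : IsSolution n h C (fun _ => 1) γ T ν) (hn : 3 ≤ n) (hh : 0 < h)
    (hC : 0 < C) : IsCMCCurve n (-h) γ ν := by
  obtain ⟨h1, -, h3⟩ := H.contDiff hn hh hC
  refine isCMCCurve_of_hasDerivAt n (-h) γ ν T (by exact_mod_cast contDiff_infty.1 h1 2)
    (by exact_mod_cast contDiff_infty.1 h3 1) (fun t => by simpa using H.system.point t)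
    (fun t h0 => ?_) (fun t => (H.frame t).norm₁) H.height_pos (fun t => (H.frame t).norm₃)
    (fun t => by rw [real_inner_comm]; exact (H.frame t).inner₁₃)
    (fun t => by rw [real_inner_comm]; exact (H.frame t).inner₂₃)
    (fun t => by simpa only [one_smul, curvature] using H.system.normal t)
  have := (H.frame t).norm₂
  rw [h0, norm_zero] at this
  exact zero_ne_one this

theorem isCompleteCurve (H : IsSolution n h C (fun _ => 1) γ T ν) : IsCompleteCurve γ := by
  have : (fun t => ∫ τ in (0 : ℝ)..t, ‖deriv γ τ‖) = id := by
    funext t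
    simp [H.norm_deriv]
  rw [IsCompleteCurve, this]
  exact ⟨tendsto_id, tendsto_id⟩

theorem continuous_height (H : IsSolution n h C (fun _ => 1) γ T ν) :
    Continuous fun t => (γ t).snd :=
  continuous_iff_continuousAt.2 fun t => (H.system.height t).continuousAt

theorem continuous_tangent_height (H : IsSolution n h C (fun _ => 1) γ T ν) :
    Continuous fun t => (T t).snd :=
  continuous_iff_continuousAt.2 fun t => (H.system.tangent_height t).continuousAt

theorem hasDerivAt_height (H : IsSolution n h C (fun _ => 1) γ T ν) (t : ℝ) :
    HasDerivAt (fun t => (γ t).snd) (T t).snd t := by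
  simpa using H.system.height t

theorem pow_mul_normal_height (H : IsSolution n h C (fun _ => 1) γ T ν) (t : ℝ) :
    (γ t).snd ^ (n - 2) * (ν t).snd = h / ((n : ℝ) - 1) * (γ t).snd ^ (n - 1) - C := by
  have := H.energy_eq t
  rw [energy] at this
  linarith

theorem normal_height_eq (H : IsSolution n h C (fun _ => 1) γ T ν) (t : ℝ) :
    (ν t).snd = (h / ((n : ℝ) - 1) * (γ t).snd ^ (n - 1) - C) / (γ t).snd ^ (n - 2) := by
  rw [← H.pow_mul_normal_height, mul_div_cancel_left₀ _ (pow_pos (H.height_pos t) _).ne']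

theorem height_le_one (H : IsSolution n h C (fun _ => 1) γ T ν) (t : ℝ) : (γ t).snd ≤ 1 :=
  (le_abs_self _).trans ((abs_space3_snd_le_norm _).trans (H.frame t).norm₁.le)

/-- At a turning point of the height the solution is given by an angle. -/
theorem exists_angle (H : IsSolution n h C (fun _ => 1) γ T ν) {t : ℝ} (ht : (T t).snd = 0) :
    ∃ s ∈ Ioo 0 Real.pi, (γ t).snd = Real.sin s ∧ (ν t).snd = -Real.cos s ∧ level n h s = C := by
  have h1 := (H.frame t).height_sq
  rw [ht] at h1
  have hb := H.height_pos t
  have h2 : -1 ≤ -(ν t).snd := by nlinarith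
  have h3 : -(ν t).snd ≤ 1 := by nlinarith
  have hcos : Real.cos (Real.arccos (-(ν t).snd)) = -(ν t).snd := Real.cos_arccos h2 h3
  have hsin : Real.sin (Real.arccos (-(ν t).snd)) = (γ t).snd := by
    rw [Real.sin_arccos, Real.sqrt_eq_iff_mul_self_eq_of_pos hb]
    linarith
  refine ⟨Real.arccos (-(ν t).snd), ⟨?_, ?_⟩, hsin.symm, by rw [hcos, neg_neg], ?_⟩
  · refine lt_of_le_of_ne (Real.arccos_nonneg _) fun h0 => ?_
    rw [← h0, Real.sin_zero] at hsin
    linarith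
  · refine lt_of_le_of_ne (Real.arccos_le_pi _) fun h0 => ?_
    rw [h0, Real.sin_pi] at hsin
    linarith
  · rw [← H.energy_eq t, level, energy, hsin, hcos]
    ring

/-- The left side is the second derivative of the height along a unit speed solution. At a turning
point its sign is thus that of `levelSlope`. -/
theorem curvature_at_angle {a b : Space3} {s : ℝ} (hs : s ∈ Ioo 0 Real.pi) (ha : a.snd = Real.sin s)
    (hb : b.snd = -Real.cos s) :
    -a.snd + curvature n h a b * b.snd = levelSlope n h s / Real.sin s := by
  have hsin : Real.sin s ≠ 0 := (Real.sin_pos_of_pos_of_lt_pi hs.1 hs.2).ne'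
  rw [curvature, ha, hb, levelSlope]
  field_simp
  ring

/-- In the coordinates `(s, φ)` the height of `T` is `cos s · s'`, and unit speed means `s'² + cos²
s · φ'² = 1`. The first integral turns `rhsFun` into `-sin^(n-2) s · ν_b`, and `IsFrame.height_sq`
turns the discriminant into the square of `sin^(n-2) s · cos s · s'`. This fixes `(φ'/s')²`, whence
the sign ambiguity. -/
theorem hasIntegrationConstant (H : IsSolution n h C (fun _ => 1) γ T ν) :
    HasIntegrationConstant n (-h) C γ := by
  intro t s φ hs hφ hev hst hds
  have hs' := hs.hasDerivAt
  have hφ' := hφ.hasDerivAt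
  set s' := deriv s t
  set φ' := deriv φ t
  have hγ : HasDerivAt (fun τ => spherePoint (s τ) (φ τ)) (T t) t := by
    have := H.system.point t
    rw [one_smul] at this
    exact this.congr_of_eventuallyEq (hev.mono fun τ h => h.symm)
  have hb : (γ t).snd = Real.sin (s t) := by rw [hev.self_of_nhds]; rfl
  have hT2 : (T t).snd = Real.cos (s t) * s' := by
    have h1 : HasDerivAt (fun τ => Real.sin (s τ)) (T t).snd t := hγ.space3_snd
    exact h1.unique hs'.sin
  have hT1 : (T t).fst = (((-Real.sin (s t) * s' : ℝ) : ℂ) +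
      ((Real.cos (s t) * φ' : ℝ) : ℂ) * Complex.I) * Complex.exp (φ t * Complex.I) := by
    have h1 : HasDerivAt (fun τ => ((Real.cos (s τ) : ℝ) : ℂ) * Complex.exp (φ τ * Complex.I))
      (T t).fst t := hγ.space3_fst
    have h2 := (hs'.cos.ofReal_comp).mul ((hφ'.ofReal_comp.mul_const Complex.I).cexp)
    rw [h1.unique h2]
    push_cast
    ring
  have hn1 := WithLp.prod_norm_sq_eq_of_L2 (T t)
  rw [(H.frame t).norm₂, hT1, norm_mul, Complex.norm_exp_ofReal_mul_I, mul_one, ← Complex.normSq_eq_norm_sq,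
    Complex.normSq_add_mul_I, hT2, Real.norm_eq_abs, sq_abs] at hn1
  have hsc := Real.sin_sq_add_cos_sq (s t)
  have hpi := Real.pi_pos
  have hcos : 0 < Real.cos (s t) := Real.cos_pos_of_mem_Ioo ⟨by linarith [hst.1], hst.2⟩
  have hsin : 0 < Real.sin (s t) := Real.sin_pos_of_pos_of_lt_pi hst.1 (by linarith [hst.2])
  have hunit : s' ^ 2 + Real.cos (s t) ^ 2 * φ' ^ 2 = 1 := by
    linear_combination -hn1 - s' ^ 2 * hsc
  have hrhs : rhsFun n (-h) C (s t) = -(Real.sin (s t) ^ (n - 2) * (ν t).snd) := by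
    have := H.pow_mul_normal_height t
    rw [hb] at this
    rw [this, rhsFun]
    ring
  have hhs := (H.frame t).height_sq
  rw [hb, hT2] at hhs
  have hdisc : discriminant n (-h) C (s t) =
      (Real.sin (s t) ^ (n - 2) * (Real.cos (s t) * |s'|)) ^ 2 := by
    rw [discriminant, hrhs, lhsFun, mul_pow _ (Real.cos (s t) * |s'|), mul_pow _ |s'|, sq_abs]
    linear_combination (Real.sin (s t) ^ (n - 2)) ^ 2 * (hsc - hhs)
  have habs : 0 < |s'| := abs_pos.2 hds
  have hpos : 0 < Real.sin (s t) ^ (n - 2) * (Real.cos (s t) * |s'|) := by positivity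
  refine ⟨by rw [hdisc]; positivity, ?_⟩
  have hslope : phaseSlope n (-h) C (s t) = -(ν t).snd / (Real.cos (s t) ^ 2 * |s'|) := by
    rw [phaseSlope, hdisc, Real.sqrt_sq hpos.le, hrhs]
    have := (pow_pos hsin (n - 2)).ne'
    field_simp
  apply sq_eq_sq_iff_eq_or_eq_neg.1
  rw [hslope, div_pow, div_pow, mul_pow, sq_abs, neg_sq, div_eq_div_iff (by positivity) (by positivity)]
  linear_combination s' ^ 2 * (Real.cos (s t) ^ 2 * hunit - hhs + hsc)

/-- For a solution of the Frenet equations it suffices to check the frame at one point. -/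
theorem of_isFrenetSystem {c : ℝ → ℝ} {γ' T' ν' : ℝ → Space3} (H : IsFrenetSystem n h c γ' T' ν')
    {t₀ : ℝ} (h0 : IsFrame (γ' t₀) (T' t₀) (ν' t₀)) (h1 : ∀ t, 0 < (γ' t).snd)
    (h2 : ∀ t, energy n h (γ' t) (ν' t) = C) : IsSolution n h C c γ' T' ν' :=
  ⟨H, H.isFrame h0, h1, h2⟩

/-- At a turning point of its height, a solution is symmetric with respect to the plane spanned by
the point and the normal vector. -/
theorem reflection_eq (H : IsSolution n h C (fun _ => 1) γ T ν) (hn : 3 ≤ n) (hh : 0 < h)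
    (hC : 0 < C) {t₀ : ℝ} (h0 : (T t₀).snd = 0) {K : Submodule ℝ Space3} (hγ : γ t₀ ∈ K)
    (hν : ν t₀ ∈ K) (hT : T t₀ ∈ Kᗮ) (τ : ℝ) :
    γ (t₀ + τ) = K.reflection (γ (t₀ - τ)) ∧ T (t₀ + τ) = -K.reflection (T (t₀ - τ)) ∧
      ν (t₀ + τ) = K.reflection (ν (t₀ - τ)) := by
  have hR := reflection_snd ((H.frame t₀).pole_mem h0 hγ hν)
  have hA := H.comp (φ := fun τ => t₀ + τ) (φ' := fun _ => 1)
    fun τ => (hasDerivAt_id τ).const_add t₀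
  simp only [mul_one] at hA
  -- Time reversal makes the speed `-1`, and changing the sign of the tangent restores `1`. That
  -- sign change also compensates the change of orientation caused by the reflection, so the image
  -- has the same initial frame as the original.
  have hB0 := ((H.system.comp (φ := fun τ => t₀ - τ) (φ' := fun _ => -1)
    fun τ => (hasDerivAt_id τ).const_sub t₀).neg_tangent).map
      (K.reflection : Space3 →L[ℝ] Space3) hR
  simp only [mul_one, neg_neg] at hB0
  have e1 : K.reflection (γ (t₀ - 0)) = γ (t₀ + 0) := by
    rw [sub_zero, add_zero, Submodule.reflection_mem_subspace_eq_self hγ]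
  have e2 : K.reflection (-T (t₀ - 0)) = T (t₀ + 0) := by
    rw [sub_zero, add_zero, map_neg, Submodule.reflection_mem_subspace_orthogonalComplement_eq_neg hT, neg_neg]
  have e3 : K.reflection (ν (t₀ - 0)) = ν (t₀ + 0) := by
    rw [sub_zero, add_zero, Submodule.reflection_mem_subspace_eq_self hν]
  have hB : IsSolution n h C (fun _ => 1) (fun τ => K.reflection (γ (t₀ - τ)))
      (fun τ => K.reflection (-T (t₀ - τ))) (fun τ => K.reflection (ν (t₀ - τ))) := by
    refine of_isFrenetSystem hB0 (t₀ := 0) ?_ (fun τ => ?_) (fun τ => ?_)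
    · rw [e1, e2, e3]
      exact H.frame _
    · rw [hR]; exact H.height_pos _
    · rw [energy, hR, hR]; exact H.energy_eq _
  have := hA.unique hB hn hh hC continuous_const (t₀ := 0) e1.symm e2.symm e3.symm τ
  rw [map_neg] at this
  exact this

theorem height_symm (H : IsSolution n h C (fun _ => 1) γ T ν) (hn : 3 ≤ n) (hh : 0 < h)
    (hC : 0 < C) {t₀ : ℝ} (h0 : (T t₀).snd = 0) (τ : ℝ) :
    (γ (t₀ + τ)).snd = (γ (t₀ - τ)).snd ∧ (T (t₀ + τ)).snd = -(T (t₀ - τ)).snd := by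
  have hf := H.frame t₀
  have hb : ∀ t, (γ (t₀ + t)).snd = (γ (t₀ - t)).snd := by
    intro t
    set K := Submodule.span ℝ {γ t₀, ν t₀} with hK
    have hγ : γ t₀ ∈ K := Submodule.subset_span (by simp)
    have hν : ν t₀ ∈ K := Submodule.subset_span (by simp)
    have hT : T t₀ ∈ Kᗮ := by
      rw [Submodule.mem_orthogonal]
      intro u hu
      obtain ⟨a, b, rfl⟩ := Submodule.mem_span_pair.1 hu
      rw [inner_add_left, real_inner_smul_left, real_inner_smul_left, hf.inner₁₂,
        real_inner_comm, hf.inner₂₃]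
      ring
    rw [(H.reflection_eq hn hh hC h0 hγ hν hT t).1, reflection_snd (hf.pole_mem h0 hγ hν)]
  refine ⟨hb τ, ?_⟩
  have h1 : HasDerivAt (fun τ => (γ (t₀ + τ)).snd) (T (t₀ + τ)).snd τ := by
    simpa [Function.comp_def] using
      (H.hasDerivAt_height (t₀ + τ)).comp τ ((hasDerivAt_id τ).const_add t₀)
  have h2 : HasDerivAt (fun τ => (γ (t₀ - τ)).snd) (-(T (t₀ - τ)).snd) τ := by
    simpa [Function.comp_def] using
      (H.hasDerivAt_height (t₀ - τ)).comp τ ((hasDerivAt_id τ).const_sub t₀)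
  rw [funext hb] at h1
  exact h1.unique h2

end IsSolution

/-! ### Solutions starting at a lowest point and their first turning point -/

/-- The lowest point of a generating curve. -/
def lowestPoint (z : ℝ) : Space3 := WithLp.toLp 2 ((Real.cos z : ℂ), Real.sin z)

/-- The tangent vector at the lowest point of a generating curve. -/
def lowestTangent : Space3 := WithLp.toLp 2 (Complex.I, 0)

/-- The normal vector at the lowest point of a generating curve. -/
def lowestNormal (z : ℝ) : Space3 := WithLp.toLp 2 ((Real.sin z : ℂ), -Real.cos z)

theorem isFrame_lowest (z : ℝ) : IsFrame (lowestPoint z) lowestTangent (lowestNormal z) := by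
  have hsc := Real.sin_sq_add_cos_sq z
  have norm_of : ∀ x : Space3, ⟪x, x⟫ = (1 : ℝ) → ‖x‖ = 1 := fun x hx => by
    rw [norm_eq_sqrt_real_inner, hx, Real.sqrt_one]
  constructor
  · apply norm_of
    simp only [lowestPoint, WithLp.prod_inner_apply, Complex.inner]
    simp [-Complex.ofReal_cos]
    linear_combination hsc
  · apply norm_of
    simp [lowestTangent]
  · apply norm_of
    simp only [lowestNormal, WithLp.prod_inner_apply, Complex.inner]
    simp [-Complex.ofReal_sin]
    linear_combination hsc
  · simp [lowestPoint, lowestTangent, WithLp.prod_inner_apply, Complex.inner, -Complex.ofReal_cos]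
  · simp [lowestPoint, lowestNormal, WithLp.prod_inner_apply, Complex.inner, -Complex.ofReal_cos,
      -Complex.ofReal_sin]
    ring
  · simp [lowestTangent, lowestNormal, WithLp.prod_inner_apply, Complex.inner, -Complex.ofReal_sin]
  · simp [crossHeight, lowestPoint, lowestTangent, lowestNormal, -Complex.ofReal_cos]
  · simp [crossHeight, lowestPoint, lowestTangent, lowestNormal, -Complex.ofReal_cos,
      -Complex.ofReal_sin]
  · simp [crossHeight, lowestPoint, lowestTangent, lowestNormal, -Complex.ofReal_sin]

theorem energy_lowest (n : ℕ) (h z : ℝ) : energy n h (lowestPoint z) (lowestNormal z) = level n h z := by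
  simp [energy, lowestPoint, lowestNormal, level]
  ring

/-- A solution parametrized by arc length which starts at a lowest point of height `sin z`. -/
structure IsStandardSolution (n : ℕ) (h z : ℝ) (γ T ν : ℝ → Space3) : Prop where
  sol : IsSolution n h (level n h z) (fun _ => 1) γ T ν
  point_zero : γ 0 = lowestPoint z
  tangent_zero : T 0 = lowestTangent
  normal_zero : ν 0 = lowestNormal z

theorem IsPeak.level_pos {n : ℕ} {h s z : ℝ} (H : IsPeak n h s) (hn : 3 ≤ n) (hz : z ∈ Ioo 0 s) :
    0 < level n h z := by
  rw [← level_zero hn h]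
  exact H.strictMonoOn hn ⟨le_rfl, H.mem.1.le⟩ ⟨hz.1.le, hz.2.le⟩ hz.1

theorem IsPeak.levelSlope_ne_zero_of_eq {n : ℕ} {h s z : ℝ} (H : IsPeak n h s) (hn : 3 ≤ n)
    (hz : z ∈ Ioo 0 s) {t : ℝ} (ht : t ∈ Ioo 0 Real.pi)
    (hC : level n h t = level n h z) : levelSlope n h t ≠ 0 := by
  refine H.levelSlope_ne_zero hn ht (by rw [hC]; exact H.level_pos hn hz) ?_
  rw [hC]
  exact (H.strictMonoOn hn ⟨hz.1.le, hz.2.le⟩ ⟨H.mem.1.le, le_rfl⟩ hz.2).ne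

theorem exists_isStandardSolution {n : ℕ} {h s z : ℝ} (H : IsPeak n h s) (hn : 3 ≤ n) (hh : 0 < h)
    (hz : z ∈ Ioo 0 s) : ∃ γ T ν, IsStandardSolution n h z γ T ν := by
  have hpi := Real.pi_pos
  have hC := H.level_pos hn hz
  rw [← energy_lowest] at hC
  obtain ⟨γ, T, ν, h1, h2, h3, hsol⟩ := exists_isSolution hn hh (isFrame_lowest z)
    (Real.sin_pos_of_pos_of_lt_pi hz.1 (by linarith [hz.2, H.mem.2])) hC
  rw [energy_lowest] at hsol
  exact ⟨γ, T, ν, hsol, h1, h2, h3⟩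

namespace IsStandardSolution

variable {n : ℕ} {h s z : ℝ} {γ T ν : ℝ → Space3}

theorem height_zero (S : IsStandardSolution n h z γ T ν) : (γ 0).snd = Real.sin z := by
  rw [S.point_zero]; rfl

theorem tangent_height_zero (S : IsStandardSolution n h z γ T ν) : (T 0).snd = 0 := by
  rw [S.tangent_zero]; rfl

theorem normal_height_zero (S : IsStandardSolution n h z γ T ν) : (ν 0).snd = -Real.cos z := by
  rw [S.normal_zero]; rfl

theorem hasDerivAt_tangent_height (S : IsStandardSolution n h z γ T ν) (t : ℝ) :
    HasDerivAt (fun t => (T t).snd) (-(γ t).snd + curvature n h (γ t) (ν t) * (ν t).snd) t := by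
  simpa using S.sol.system.tangent_height t

/-- `T_b` vanishes at `0` and has there the derivative `levelSlope n h z / sin z`, positive because
`z` lies before the peak. -/
theorem eventually_tangent_height_pos (S : IsStandardSolution n h z γ T ν) (H : IsPeak n h s)
    (hz : z ∈ Ioo 0 s) : ∃ ε > 0, ∀ t ∈ Ioo 0 ε, 0 < (T t).snd := by
  have hpi := Real.pi_pos
  have hzpi : z ∈ Ioo 0 Real.pi := ⟨hz.1, by linarith [hz.2, H.mem.2]⟩
  have h1 := S.hasDerivAt_tangent_height 0
  rw [IsSolution.curvature_at_angle hzpi S.height_zero S.normal_height_zero] at h1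
  have hpos : 0 < levelSlope n h z / Real.sin z :=
    div_pos (H.slope_pos z ⟨hz.1.le, hz.2⟩) (Real.sin_pos_of_pos_of_lt_pi hzpi.1 hzpi.2)
  have h2 := (hasDerivAt_iff_tendsto_slope.1 h1).eventually (lt_mem_nhds hpos)
  have h3 : ∀ᶠ t in 𝓝[>] (0 : ℝ), 0 < slope (fun t => (T t).snd) 0 t :=
    h2.filter_mono (nhdsWithin_mono _ fun t (ht : 0 < t) => ht.ne')
  obtain ⟨ε, hε, hmem⟩ := mem_nhdsGT_iff_exists_Ioo_subset.1 h3
  refine ⟨ε, hε, fun t ht => ?_⟩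
  have h4 : 0 < slope (fun t => (T t).snd) 0 t := hmem ht
  rw [slope_def_field, S.tangent_height_zero, sub_zero, sub_zero] at h4
  exact (div_pos_iff_of_pos_right ht.1).1 h4

/-- Without a turning point the height increases to a limit, and the first integral and the frame
make `ν_b` and `T_b` converge too. Then `T_b` and its derivative tend to `0`, so the limit is an
equilibrium at the same level, which `levelSlope_ne_zero_of_eq` excludes. -/
theorem exists_turning (S : IsStandardSolution n h z γ T ν) (H : IsPeak n h s) (hn : 3 ≤ n)
    (hz : z ∈ Ioo 0 s) : ∃ t > 0, (T t).snd = 0 := by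
  by_contra hcon
  push Not at hcon
  have hTc := S.sol.continuous_tangent_height
  have hTpos : ∀ t, 0 < t → 0 < (T t).snd := by
    intro t ht
    obtain ⟨ε, hε, hpos⟩ := S.eventually_tangent_height_pos H hz
    by_contra hle
    push Not at hle
    have h1 : ε / 2 ∈ Ioi (0 : ℝ) := half_pos hε
    have h2 := hpos (ε / 2) ⟨h1, by linarith⟩
    obtain ⟨u, hu, hu0⟩ := isPreconnected_Ioi.intermediate_value (s := Ioi (0 : ℝ)) (a := t)
      (b := ε / 2) ht h1 hTc.continuousOn ⟨hle, h2.le⟩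
    exact hcon u hu hu0
  set b : ℝ → ℝ := fun t => (γ t).snd with hbdef
  have hbd : ∀ t, HasDerivAt b (T t).snd t := S.sol.hasDerivAt_height
  have hmono : StrictMonoOn b (Ici 0) := by
    refine strictMonoOn_of_deriv_pos (convex_Ici _) S.sol.continuous_height.continuousOn fun t ht => ?_
    rw [interior_Ici] at ht
    rw [(hbd t).deriv]
    exact hTpos t ht
  obtain ⟨l, hl⟩ : ∃ l, Tendsto b atTop (𝓝 l) := by
    have hm : Monotone fun t => b (max t 0) := fun x y hxy =>
      hmono.monotoneOn (mem_Ici.2 (le_max_right _ _)) (mem_Ici.2 (le_max_right _ _))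
        (max_le_max_right 0 hxy)
    have := tendsto_atTop_ciSup hm ⟨1, by rintro _ ⟨t, rfl⟩; exact S.sol.height_le_one _⟩
    refine ⟨_, this.congr' ?_⟩
    filter_upwards [eventually_ge_atTop 0] with t ht
    rw [max_eq_left ht]
  have hl0 : 0 < l := by
    refine (S.sol.height_pos 0).trans_le (ge_of_tendsto hl ?_)
    filter_upwards [eventually_ge_atTop 0] with t ht
    exact hmono.monotoneOn (le_refl (0 : ℝ)) ht ht
  have hβ : Tendsto (fun t => (ν t).snd) atTop
      (𝓝 ((h / ((n : ℝ) - 1) * l ^ (n - 1) - level n h z) / l ^ (n - 2))) := by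
    simp only [S.sol.normal_height_eq]
    exact (((hl.pow _).const_mul _).sub_const _).div (hl.pow _) (pow_pos hl0 _).ne'
  set β := (h / ((n : ℝ) - 1) * l ^ (n - 1) - level n h z) / l ^ (n - 2) with hβdef
  have hT : Tendsto (fun t => (T t).snd) atTop (𝓝 (Real.sqrt (1 - l ^ 2 - β ^ 2))) := by
    have h1 : Tendsto (fun t => Real.sqrt (1 - (γ t).snd ^ 2 - (ν t).snd ^ 2)) atTop
        (𝓝 (Real.sqrt (1 - l ^ 2 - β ^ 2))) :=
      ((tendsto_const_nhds.sub (hl.pow 2)).sub (hβ.pow 2)).sqrt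
    refine h1.congr' ?_
    filter_upwards [eventually_gt_atTop 0] with t ht
    rw [Real.sqrt_eq_iff_mul_self_eq_of_pos (hTpos t ht)]
    linarith [(S.sol.frame t).height_sq]
  have hT0 := eq_zero_of_tendsto_of_hasDerivAt hbd hl hT
  have ha := eq_zero_of_tendsto_of_hasDerivAt S.hasDerivAt_tangent_height hT
    (hl.neg.add (((hβ.div hl hl0.ne').const_mul ((n - 2 : ℕ) : ℝ)).const_add (-h) |>.mul hβ))
  have hsq : l ^ 2 + β ^ 2 = 1 := by
    have h1 : Tendsto (fun t => (γ t).snd ^ 2 + (T t).snd ^ 2 + (ν t).snd ^ 2) atTop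
        (𝓝 (l ^ 2 + (Real.sqrt (1 - l ^ 2 - β ^ 2)) ^ 2 + β ^ 2)) :=
      ((hl.pow 2).add (hT.pow 2)).add (hβ.pow 2)
    simp only [fun t => (S.sol.frame t).height_sq] at h1
    have := tendsto_nhds_unique h1 tendsto_const_nhds
    rw [hT0] at this
    linarith
  -- The limit values satisfy `l² + β² = 1` and so come from an angle `u`, just as at an actual
  -- turning point.
  have hcos : Real.cos (Real.arccos (-β)) = -β := Real.cos_arccos (by nlinarith) (by nlinarith)
  have hsin : Real.sin (Real.arccos (-β)) = l := by
    rw [Real.sin_arccos, Real.sqrt_eq_iff_mul_self_eq_of_pos hl0]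
    linarith
  set u := Real.arccos (-β) with hu
  have humem : u ∈ Ioo 0 Real.pi := by
    constructor
    · refine lt_of_le_of_ne (Real.arccos_nonneg _) fun h0 => ?_
      rw [← h0, Real.sin_zero] at hsin
      linarith
    · refine lt_of_le_of_ne (Real.arccos_le_pi _) fun h0 => ?_
      rw [h0, Real.sin_pi] at hsin
      linarith
  have hlev : level n h u = level n h z := by
    rw [level, hsin, hcos, hβdef]
    have := (pow_pos hl0 (n - 2)).ne'
    field_simp
    ring
  apply H.levelSlope_ne_zero_of_eq hn hz humem hlev
  have h3 := IsSolution.curvature_at_angle (n := n) (h := h) (a := lowestPoint u)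
    (b := lowestNormal u) humem rfl rfl
  have h4 : -Real.sin u + (-h + (n - 2 : ℕ) * (-Real.cos u / Real.sin u)) * -Real.cos u =
    levelSlope n h u / Real.sin u := h3
  rw [hsin, hcos, neg_neg, ha] at h4
  exact (div_eq_zero_iff.1 h4.symm).resolve_right hl0.ne'

theorem exists_first_turning (S : IsStandardSolution n h z γ T ν) (H : IsPeak n h s) (hn : 3 ≤ n)
    (hz : z ∈ Ioo 0 s) : ∃ ℓ > 0, (T ℓ).snd = 0 ∧ ∀ t ∈ Ioo 0 ℓ, 0 < (T t).snd := by
  obtain ⟨ε, hε, hpos⟩ := S.eventually_tangent_height_pos H hz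
  obtain ⟨t, ht, ht0⟩ := S.exists_turning H hn hz
  have hTc := S.sol.continuous_tangent_height
  -- The bound `ε ≤ t` keeps the zero at the start out of the set, and closedness then gives a first
  -- zero after it.
  set A := {t | ε ≤ t ∧ (T t).snd = 0} with hA
  have htA : t ∈ A := by
    refine ⟨?_, ht0⟩
    by_contra hlt
    push Not at hlt
    exact (hpos t ⟨ht, hlt⟩).ne' ht0
  have hcl : IsClosed A := isClosed_Ici.inter (isClosed_eq hTc continuous_const)
  have hbdd : BddBelow A := ⟨ε, fun t ht => ht.1⟩
  have hmem := hcl.csInf_mem ⟨t, htA⟩ hbdd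
  refine ⟨sInf A, hε.trans_le hmem.1, hmem.2, fun u hu => ?_⟩
  by_contra hle
  push Not at hle
  have h1 : min (ε / 2) u ∈ Ioo (0 : ℝ) ε :=
    ⟨lt_min (half_pos hε) hu.1, (min_le_left _ _).trans_lt (by linarith)⟩
  obtain ⟨v, hv, hv0⟩ := intermediate_value_Icc' (min_le_right (ε / 2) u) hTc.continuousOn
    ⟨hle, (hpos _ h1).le⟩
  have hv1 : 0 < v := h1.1.trans_le hv.1
  have hvA : v ∈ A := by
    refine ⟨?_, hv0⟩
    by_contra hlt
    push Not at hlt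
    exact (hpos v ⟨hv1, hlt⟩).ne' hv0
  linarith [csInf_le hbdd hvA, hv.2, hu.2]

end IsStandardSolution

/-! ### The phase and the behaviour near the pole -/

theorem eq_pole_iff {w : Space3} (hw : ‖w‖ = 1) : w = pole ↔ w.snd = 1 := by
  constructor
  · rintro rfl; rfl
  · intro h1
    have h := WithLp.prod_norm_sq_eq_of_L2 w
    rw [hw, h1] at h
    have h2 : w.fst = 0 := by
      rw [← norm_eq_zero, ← sq_eq_zero_iff]
      simp at h
      simp [h]
    exact WithLp.ofLp_injective 2 (Prod.ext h2 h1)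

theorem one_sub_sq_pos {b : ℝ} (h0 : 0 < b) (h1 : b < 1) : 0 < 1 - b ^ 2 := by nlinarith

namespace IsSolution

variable {n : ℕ} {h C : ℝ} {γ T ν : ℝ → Space3}

/-- The phase of a solution is the integral of the angular velocity `Ω`. -/
theorem fst_eq_of_hasDerivAt_phase (H : IsSolution n h C (fun _ => 1) γ T ν) {J : Set ℝ}
    (hJ : IsOpen J) (hJ' : IsPreconnected J) (h0J : 0 ∈ J) (hb : ∀ t ∈ J, (γ t).snd < 1) {φ Ω : ℝ → ℝ}
    (hφ : ∀ t ∈ J, HasDerivAt φ (Ω t) t) (hω : ∀ t ∈ J, -(ν t).snd = Ω t * (1 - (γ t).snd ^ 2))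
    (hφ0 : φ 0 = 0) (hγ0 : (γ 0).fst = (Real.sqrt (1 - (γ 0).snd ^ 2) : ℝ)) {t : ℝ} (ht : t ∈ J) :
    (γ t).fst = (Real.sqrt (1 - (γ t).snd ^ 2) : ℝ) * Complex.exp (φ t * Complex.I) := by
  set w : ℝ → ℝ := fun t => Real.sqrt (1 - (γ t).snd ^ 2) with hw
  have hpos : ∀ t ∈ J, 0 < 1 - (γ t).snd ^ 2 := fun t ht => one_sub_sq_pos (H.height_pos t) (hb t ht)
  have hwpos : ∀ t ∈ J, 0 < w t := fun t ht => Real.sqrt_pos.2 (hpos t ht)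
  have hwsq : ∀ t ∈ J, w t ^ 2 = 1 - (γ t).snd ^ 2 := fun t ht => Real.sq_sqrt (hpos t ht).le
  have hwd : ∀ t ∈ J, HasDerivAt w (-((γ t).snd * (T t).snd) / w t) t := fun t ht => by
    refine ((((H.hasDerivAt_height t).pow 2).const_sub 1).sqrt (hpos t ht).ne').congr_deriv ?_
    simp only [hw, Pi.pow_apply]
    field_simp
    ring
  -- This is the logarithmic derivative of `γ_z` with denominators cleared: its real part comes from
  -- `⟪γ, T⟫ = 0` and its imaginary part from the cross product identity for `γ` and `T`.
  have htan : ∀ t, ((1 - (γ t).snd ^ 2 : ℝ) : ℂ) * (T t).fst =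
      (((-((γ t).snd * (T t).snd) : ℝ) : ℂ) + ((-(ν t).snd : ℝ) : ℂ) * Complex.I) * (γ t).fst := by
    intro t
    have e1 := (H.frame t).norm_fst_sq
    rw [← Complex.normSq_eq_norm_sq, Complex.normSq_apply] at e1
    have e2 := (H.frame t).inner₁₂
    have e3 := (H.frame t).cross₁₂
    rw [crossHeight] at e3
    simp only [WithLp.prod_inner_apply, Complex.inner] at e2
    simp at e2
    apply Complex.ext
    · simp only [Complex.mul_re, Complex.mul_im, Complex.add_re, Complex.add_im, Complex.ofReal_re,
        Complex.ofReal_im, Complex.I_re, Complex.I_im]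
      linear_combination -(T t).fst.re * e1 + (γ t).fst.re * e2 - (γ t).fst.im * e3
    · simp only [Complex.mul_re, Complex.mul_im, Complex.add_re, Complex.add_im, Complex.ofReal_re,
        Complex.ofReal_im, Complex.I_re, Complex.I_im]
      linear_combination -(T t).fst.im * e1 + (γ t).fst.im * e2 + (γ t).fst.re * e3
  -- The quotient of `γ_z` by its expected polar form; it is constant on `J` and equals `1` at `0`.
  set u : ℝ → ℂ := fun t => (γ t).fst * Complex.exp (-(φ t * Complex.I)) / (w t : ℂ) with hu
  have hud : ∀ t ∈ J, HasDerivAt u 0 t := by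
    intro t ht
    have hwne : (w t : ℂ) ≠ 0 := by exact_mod_cast (hwpos t ht).ne'
    have hγ : HasDerivAt (fun t => (γ t).fst) (T t).fst t := by
      have := H.system.point t
      rw [one_smul] at this
      exact this.space3_fst
    have hd := (hγ.mul (((hφ t ht).ofReal_comp.mul_const Complex.I).neg.cexp)).div
      ((hwd t ht).ofReal_comp) hwne
    refine hd.congr_deriv ?_
    rw [div_eq_zero_iff]
    left
    have h1 := htan t
    rw [← hwsq t ht] at h1
    have h2 : ((-(ν t).snd : ℝ) : ℂ) = Ω t * (w t : ℂ) ^ 2 := by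
      rw [hω t ht, ← hwsq t ht]; push_cast; ring
    rw [h2] at h1
    push_cast at h1 ⊢
    have h3 : (w t : ℂ) * (((γ t).fst : ℂ) * (Complex.exp (-(φ t * Complex.I))) *
        (-((γ t).snd * (T t).snd) / w t)) = ((γ t).fst : ℂ) * (Complex.exp (-(φ t * Complex.I))) *
        (-((γ t).snd * (T t).snd)) := by
      field_simp
    apply mul_left_cancel₀ hwne
    simp only [Pi.mul_apply, Pi.neg_apply, mul_zero]
    linear_combination (Complex.exp (-(φ t * Complex.I))) * h1 - h3
  have hconst := hJ.is_const_of_deriv_eq_zero hJ'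
    (fun t ht => (hud t ht).differentiableAt.differentiableWithinAt) (fun t ht => (hud t ht).deriv)
    ht h0J
  have hu0 : u 0 = 1 := by
    have hwne : (w 0 : ℂ) ≠ 0 := by exact_mod_cast (hwpos 0 h0J).ne'
    simp only [hu, hφ0, hγ0]
    simp only [Complex.ofReal_zero, zero_mul, neg_zero, Complex.exp_zero, mul_one]
    exact div_self hwne
  rw [hu0] at hconst
  have hwne : (w t : ℂ) ≠ 0 := by exact_mod_cast (hwpos t ht).ne'
  have h4 : (γ t).fst * Complex.exp (-(φ t * Complex.I)) = w t := by
    rwa [hu, div_eq_one_iff_eq hwne] at hconst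
  change (γ t).fst = (w t : ℂ) * _
  rw [← h4, mul_assoc, ← Complex.exp_add, neg_add_cancel, Complex.exp_zero, mul_one]

/-- At height `1` the frame forces `ν_b = 0`, and the first integral then equals `h/(n-1)`. -/
theorem height_ne_one (H : IsSolution n h C (fun _ => 1) γ T ν) (hC : C ≠ h / ((n : ℝ) - 1)) (t : ℝ) :
    (γ t).snd < 1 := by
  refine lt_of_le_of_ne (H.height_le_one t) fun h1 => hC ?_
  have h2 := (H.frame t).height_sq
  rw [h1] at h2
  have h3 : (ν t).snd = 0 := by nlinarith [sq_nonneg (T t).snd, sq_nonneg (ν t).snd]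
  have h4 := H.energy_eq t
  rw [energy, h1, h3] at h4
  simpa using h4.symm

theorem normal_height_neg_of_lt (H : IsSolution n h C (fun _ => 1) γ T ν) (hn : 3 ≤ n) (hh : 0 < h)
    (hC : h / ((n : ℝ) - 1) < C) (t : ℝ) : (ν t).snd < 0 := by
  have hn' : (3 : ℝ) ≤ n := by exact_mod_cast hn
  have hpos : 0 < h / ((n : ℝ) - 1) := div_pos hh (by linarith)
  rw [H.normal_height_eq]
  refine div_neg_of_neg_of_pos ?_ (pow_pos (H.height_pos t) _)
  have := pow_le_one₀ (n := n - 1) (H.height_pos t).le (H.height_le_one t)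
  nlinarith

theorem pointsAwayFromPole (H : IsSolution n h C (fun _ => 1) γ T ν) (hn : 3 ≤ n) (hh : 0 < h)
    (hC : h / ((n : ℝ) - 1) ≤ C) : PointsAwayFromPole γ ν := by
  intro t ht
  rcases eq_or_lt_of_le hC with rfl | hC
  · have hn' : (3 : ℝ) ≤ n := by exact_mod_cast hn
    have hpos : 0 < h / ((n : ℝ) - 1) := div_pos hh (by linarith)
    have hb : (γ t).snd < 1 := lt_of_le_of_ne (H.height_le_one t) fun h1 =>
      ht ((eq_pole_iff (H.frame t).norm₁).2 h1)
    rw [H.normal_height_eq]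
    refine div_neg_of_neg_of_pos ?_ (pow_pos (H.height_pos t) _)
    have := pow_lt_one₀ (H.height_pos t).le hb (by omega : n - 1 ≠ 0)
    nlinarith
  · exact H.normal_height_neg_of_lt hn hh hC t

/-- A continuous phase of a solution which avoids the pole. -/
theorem exists_isPhase (H : IsSolution n h C (fun _ => 1) γ T ν) (hC : C ≠ h / ((n : ℝ) - 1))
    (hγ0 : (γ 0).fst = (Real.sqrt (1 - (γ 0).snd ^ 2) : ℝ)) :
    ∃ φ : ℝ → ℝ, IsPhase γ φ ∧ ∀ t, HasDerivAt φ (-(ν t).snd / (1 - (γ t).snd ^ 2)) t := by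
  have hpos : ∀ t, 0 < 1 - (γ t).snd ^ 2 := fun t =>
    one_sub_sq_pos (H.height_pos t) (H.height_ne_one hC t)
  have hνc : Continuous fun t => (ν t).snd :=
    continuous_iff_continuousAt.2 fun t => (H.system.normal_height t).continuousAt
  have hωc : Continuous fun t => -(ν t).snd / (1 - (γ t).snd ^ 2) :=
    hνc.neg.div (continuous_const.sub (H.continuous_height.pow 2)) fun t => (hpos t).ne'
  have hφ : ∀ t, HasDerivAt (fun t => ∫ τ in (0 : ℝ)..t, -(ν τ).snd / (1 - (γ τ).snd ^ 2))
      (-(ν t).snd / (1 - (γ t).snd ^ 2)) t := fun t =>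
    intervalIntegral.integral_hasDerivAt_right (hωc.intervalIntegrable _ _)
      (hωc.stronglyMeasurableAtFilter _ _) hωc.continuousAt
  refine ⟨_, ⟨continuous_iff_continuousAt.2 fun t => (hφ t).continuousAt, fun t => ?_⟩, hφ⟩
  have hsqrt : 0 < Real.sqrt (1 - (γ t).snd ^ 2) := Real.sqrt_pos.2 (hpos t)
  have hnorm : ‖(γ t).fst‖ = Real.sqrt (1 - (γ t).snd ^ 2) := by
    rw [← (H.frame t).norm_fst_sq, Real.sqrt_sq (norm_nonneg _)]
  refine ⟨fun h0 => ?_, ?_⟩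
  · rw [h0, norm_zero] at hnorm
    linarith
  · rw [hnorm]
    exact H.fst_eq_of_hasDerivAt_phase isOpen_univ isPreconnected_univ trivial
      (fun t _ => H.height_ne_one hC t) (fun t _ => hφ t)
      (fun t _ => by rw [div_mul_cancel₀ _ (hpos t).ne']) intervalIntegral.integral_same hγ0 trivial

/-- The composition of the two symmetries about `0` and about `ℓ` is the translation by `2 * ℓ`. -/
theorem height_periodic (H : IsSolution n h C (fun _ => 1) γ T ν) (hn : 3 ≤ n) (hh : 0 < h)
    (hC : 0 < C) {ℓ : ℝ} (h0 : (T 0).snd = 0) (hℓ : (T ℓ).snd = 0) :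
    Function.Periodic (fun t => (γ t).snd) (2 * ℓ) ∧
      Function.Periodic (fun t => (T t).snd) (2 * ℓ) := by
  have key : ∀ t, (γ (t + 2 * ℓ)).snd = (γ t).snd ∧ (T (t + 2 * ℓ)).snd = (T t).snd := by
    intro t
    have h1 := H.height_symm hn hh hC hℓ (t + ℓ)
    have h2 := H.height_symm hn hh hC h0 (-t)
    rw [show ℓ + (t + ℓ) = t + 2 * ℓ by ring, show ℓ - (t + ℓ) = 0 + -t by ring, h2.1, h2.2,
      show (0 : ℝ) - -t = t by ring, neg_neg] at h1
    exact h1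
  exact ⟨fun t => (key t).1, fun t => (key t).2⟩

end IsSolution

/-! ### Unduloid and nodoid types -/

namespace IsStandardSolution

variable {n : ℕ} {h s z ℓ : ℝ} {γ T ν : ℝ → Space3}

theorem fst_zero (S : IsStandardSolution n h z γ T ν) (H : IsPeak n h s) (hz : z ∈ Ioo 0 s) :
    (γ 0).fst = (Real.sqrt (1 - (γ 0).snd ^ 2) : ℝ) := by
  have h1 : 1 - Real.sin z ^ 2 = Real.cos z ^ 2 := by linarith [Real.sin_sq_add_cos_sq z]
  rw [S.height_zero, h1, Real.sqrt_sq, S.point_zero]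
  · rfl
  · exact Real.cos_nonneg_of_mem_Icc ⟨by linarith [hz.1, Real.pi_pos], by linarith [hz.2, H.mem.2]⟩

theorem strictMonoOn_height (S : IsStandardSolution n h z γ T ν)
    (hpos : ∀ t ∈ Ioo 0 ℓ, 0 < (T t).snd) : StrictMonoOn (fun t => (γ t).snd) (Icc 0 ℓ) := by
  refine strictMonoOn_of_deriv_pos (convex_Icc _ _) S.sol.continuous_height.continuousOn fun t ht => ?_
  rw [interior_Icc] at ht
  rw [(S.sol.hasDerivAt_height t).deriv]
  exact hpos t ht

theorem oscillatesInHeight (S : IsStandardSolution n h z γ T ν) (H : IsPeak n h s) (hn : 3 ≤ n)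
    (hh : 0 < h) (hz : z ∈ Ioo 0 s) : OscillatesInHeight γ := by
  obtain ⟨ℓ, hℓ, hT, hpos⟩ := S.exists_first_turning H hn hz
  refine ⟨⟨2 * ℓ, by linarith,
    (S.sol.height_periodic hn hh (H.level_pos hn hz) S.tangent_height_zero hT).1⟩, 0, ℓ, ?_⟩
  exact (S.strictMonoOn_height hpos ⟨le_rfl, hℓ.le⟩ ⟨hℓ.le, le_rfl⟩ hℓ).ne

/-- The turning angle `u` has the same level as `z` and a larger sine. If `u > π/2`, then `ν_b =
-cos u > 0`. Otherwise `u` lies on the falling branch, where the level exceeds `h/(n-1)` except at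
`π/2`, so `u = π/2`. -/
theorem normal_height_pos_or (S : IsStandardSolution n h z γ T ν) (H : IsPeak n h s) (hn : 3 ≤ n)
    (hz : z ∈ Ioo 0 s) (hC : level n h z ≤ h / ((n : ℝ) - 1)) (hℓ : 0 < ℓ) (hT : (T ℓ).snd = 0)
    (hpos : ∀ t ∈ Ioo 0 ℓ, 0 < (T t).snd) :
    0 < (ν ℓ).snd ∨ (γ ℓ).snd = 1 ∧ level n h z = h / ((n : ℝ) - 1) := by
  have hpi := Real.pi_pos
  obtain ⟨u, hu, hbu, hνu, hlev⟩ := S.sol.exists_angle hT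
  have hlt : Real.sin z < Real.sin u := by
    rw [← hbu, ← S.height_zero]
    exact S.strictMonoOn_height hpos ⟨le_rfl, hℓ.le⟩ ⟨hℓ.le, le_rfl⟩ hℓ
  rcases lt_or_ge (Real.pi / 2) u with hu2 | hu2
  · left
    rw [hνu]
    linarith [Real.cos_neg_of_pi_div_two_lt_of_lt hu2 (by linarith [hu.2])]
  · right
    have hzu : z < u := by
      by_contra hle
      push Not at hle
      have := Real.strictMonoOn_sin.monotoneOn ⟨by linarith [hu.1], hu2⟩
        ⟨by linarith [hz.1], by linarith [hz.2, H.mem.2]⟩ hle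
      linarith
    have hsu : s < u := by
      by_contra hle
      push Not at hle
      have := H.strictMonoOn hn ⟨hz.1.le, hz.2.le⟩ ⟨hu.1.le, hle⟩ hzu
      linarith
    have hu3 : u = Real.pi / 2 := by
      by_contra hne
      have := H.strictAntiOn hn ⟨hsu.le, hu2⟩ ⟨H.mem.2.le, le_rfl⟩ (lt_of_le_of_ne hu2 hne)
      rw [level_pi_div_two] at this
      linarith
    rw [hbu, ← hlev, hu3, level_pi_div_two]
    exact ⟨Real.sin_pi_div_two, rfl⟩

theorem isUnduloidType (S : IsStandardSolution n h z γ T ν) (H : IsPeak n h s) (hn : 3 ≤ n)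
    (hh : 0 < h) (hz : z ∈ Ioo 0 s) (hC : h / ((n : ℝ) - 1) < level n h z) : IsUnduloidType γ := by
  obtain ⟨φ, hφ, hφd⟩ := S.sol.exists_isPhase hC.ne' (S.fst_zero H hz)
  refine ⟨S.oscillatesInHeight H hn hh hz, φ, hφ, Or.inl (strictMono_of_deriv_pos fun t => ?_)⟩
  rw [(hφd t).deriv]
  exact div_pos (neg_pos.2 (S.sol.normal_height_neg_of_lt hn hh hC t))
    (one_sub_sq_pos (S.sol.height_pos t) (S.sol.height_ne_one hC.ne' t))

/-- The derivative of the phase has the sign of `-ν_b`: positive at the lowest point, negative at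
the first turning point. -/
theorem isNodoidType (S : IsStandardSolution n h z γ T ν) (H : IsPeak n h s) (hn : 3 ≤ n)
    (hh : 0 < h) (hz : z ∈ Ioo 0 s) (hC : level n h z < h / ((n : ℝ) - 1)) : IsNodoidType γ := by
  obtain ⟨φ, hφ, hφd⟩ := S.sol.exists_isPhase hC.ne (S.fst_zero H hz)
  have hpos : ∀ t, 0 < 1 - (γ t).snd ^ 2 := fun t =>
    one_sub_sq_pos (S.sol.height_pos t) (S.sol.height_ne_one hC.ne t)
  refine ⟨S.oscillatesInHeight H hn hh hz, φ, hφ, fun hm => ?_, fun hm => ?_⟩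
  · obtain ⟨ℓ, hℓ, hT, hTpos⟩ := S.exists_first_turning H hn hz
    have h1 : 0 < (ν ℓ).snd := (S.normal_height_pos_or H hn hz hC.le hℓ hT hTpos).resolve_right
      fun h => hC.ne h.2
    have h3 : 0 ≤ -(ν ℓ).snd / (1 - (γ ℓ).snd ^ 2) := by
      rw [← (hφd ℓ).deriv]; exact hm.deriv_nonneg
    have h4 := div_neg_of_neg_of_pos (neg_lt_zero.2 h1) (hpos ℓ)
    linarith
  · have h1 : (ν 0).snd < 0 := by
      rw [S.normal_height_zero]
      linarith [Real.cos_pos_of_mem_Ioo (x := z)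
        ⟨by linarith [hz.1, Real.pi_pos], by linarith [hz.2, H.mem.2]⟩]
    have h3 : -(ν 0).snd / (1 - (γ 0).snd ^ 2) ≤ 0 := by
      rw [← (hφd 0).deriv]; exact hm.deriv_nonpos
    have h4 := div_pos (neg_pos.2 h1) (hpos 0)
    linarith

end IsStandardSolution

/-- Here `rhsFun` is nonnegative, so the squares in the discriminant compare like their bases, and
the condition becomes `level > h/(n-1)`. The level takes this value on the rising branch at `z` and
on the falling branch at `π/2`. -/
theorem IsPeak.setOf_discriminant_pos {n : ℕ} {h s z : ℝ} (H : IsPeak n h s) (hn : 3 ≤ n)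
    (hh : 0 < h) (hz : z ∈ Ioo 0 s) (hC : level n h z = h / ((n : ℝ) - 1)) :
    {x | x ∈ Ioo 0 (Real.pi / 2) ∧ 0 < discriminant n (-h) (h / ((n : ℝ) - 1)) x} =
      Ioo z (Real.pi / 2) := by
  have hpi := Real.pi_pos
  have hn' : (3 : ℝ) ≤ n := by exact_mod_cast hn
  have hpos : 0 < h / ((n : ℝ) - 1) := div_pos hh (by linarith)
  have hiff : ∀ x ∈ Ioo 0 (Real.pi / 2), 0 < discriminant n (-h) (h / ((n : ℝ) - 1)) x ↔
      h / ((n : ℝ) - 1) < level n h x := by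
    intro x hx
    have hsin : 0 < Real.sin x := Real.sin_pos_of_pos_of_lt_pi hx.1 (by linarith [hx.2])
    have hcos : 0 < Real.cos x := Real.cos_pos_of_mem_Ioo ⟨by linarith [hx.1], hx.2⟩
    have h1 : 0 ≤ rhsFun n (-h) (h / ((n : ℝ) - 1)) x := by
      rw [rhsFun, neg_div]
      have := pow_le_one₀ (n := n - 1) hsin.le (Real.sin_le_one x)
      nlinarith
    have h2 : 0 ≤ lhsFun n x := by rw [lhsFun]; positivity
    rw [← lt_level_iff, discriminant, sub_pos, sq_lt_sq₀ h1 h2]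
  ext x
  constructor
  · rintro ⟨hx, hd⟩
    refine ⟨?_, hx.2⟩
    by_contra hle
    push Not at hle
    have h1 := (hiff x hx).1 hd
    have h2 := (H.strictMonoOn hn).monotoneOn ⟨hx.1.le, hle.trans hz.2.le⟩ ⟨hz.1.le, hz.2.le⟩ hle
    linarith
  · intro hx
    have hx' : x ∈ Ioo 0 (Real.pi / 2) := ⟨hz.1.trans hx.1, hx.2⟩
    refine ⟨hx', (hiff x hx').2 ?_⟩
    rcases le_total x s with hxs | hxs
    · rw [← hC]
      exact H.strictMonoOn hn ⟨hz.1.le, hz.2.le⟩ ⟨hx'.1.le, hxs⟩ hx.1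
    · rw [← level_pi_div_two]
      exact H.strictAntiOn hn ⟨hxs, hx.2.le⟩ ⟨H.mem.2.le, le_rfl⟩ hx.2

/-! ### The curve through the pole and its assembly by reflections -/

/-- The angular velocity of the solution through the pole as a function of its height. -/
def poleAngularVelocity (n : ℕ) (C b : ℝ) : ℝ :=
  C * (∑ k ∈ Finset.range (n - 1), b ^ k) / ((1 + b) * b ^ (n - 2))

/-- For this constant `-b^(n-2) ν_b` is `C (1 - b^(n-1))`, and the factor `1 - b` splits off as a
geometric sum. The quotient of `-ν_b` by `1 - b²` thus stays continuous at the pole. -/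
theorem IsSolution.neg_normal_height_eq {n : ℕ} {h : ℝ} {γ T ν : ℝ → Space3}
    (H : IsSolution n h (h / ((n : ℝ) - 1)) (fun _ => 1) γ T ν) (t : ℝ) :
    -(ν t).snd = poleAngularVelocity n (h / ((n : ℝ) - 1)) (γ t).snd * (1 - (γ t).snd ^ 2) := by
  have hb := H.height_pos t
  have hb1 : (γ t).snd ^ (n - 2) ≠ 0 := (pow_pos hb _).ne'
  have hb2 : 1 + (γ t).snd ≠ 0 := by linarith
  have h1 := mul_neg_geom_sum (γ t).snd (n - 1)
  have h2 := H.pow_mul_normal_height t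
  rw [poleAngularVelocity, div_mul_eq_mul_div, eq_div_iff (mul_ne_zero hb2 hb1)]
  linear_combination (-(1 + (γ t).snd)) * h2 - h / ((n : ℝ) - 1) * (1 + (γ t).snd) * h1

namespace IsStandardSolution

variable {n : ℕ} {h s z ℓ : ℝ} {γ T ν : ℝ → Space3}

/-- For this constant the first integral gives `ν_b ≤ 0`, which leaves only the second alternative
of `normal_height_pos_or`. -/
theorem height_turning (S : IsStandardSolution n h z γ T ν) (H : IsPeak n h s) (hn : 3 ≤ n)
    (hh : 0 < h) (hz : z ∈ Ioo 0 s) (hC : level n h z = h / ((n : ℝ) - 1)) (hℓ : 0 < ℓ)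
    (hT : (T ℓ).snd = 0) (hpos : ∀ t ∈ Ioo 0 ℓ, 0 < (T t).snd) : (γ ℓ).snd = 1 := by
  rcases S.normal_height_pos_or H hn hz hC.le hℓ hT hpos with h1 | h1
  · have hn' : (3 : ℝ) ≤ n := by exact_mod_cast hn
    have hpos' : 0 < h / ((n : ℝ) - 1) := div_pos hh (by linarith)
    have h2 := S.sol.pow_mul_normal_height ℓ
    rw [hC] at h2
    have h3 := mul_pos (pow_pos (S.sol.height_pos ℓ) (n - 2)) h1
    have h4 := pow_le_one₀ (n := n - 1) (S.sol.height_pos ℓ).le (S.sol.height_le_one ℓ)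
    nlinarith
  · exact h1.1

theorem height_lt_one (S : IsStandardSolution n h z γ T ν) (H : IsPeak n h s) (hn : 3 ≤ n)
    (hh : 0 < h) (hz : z ∈ Ioo 0 s) (h1 : (γ ℓ).snd = 1)
    (hpos : ∀ t ∈ Ioo 0 ℓ, 0 < (T t).snd) {t : ℝ} (ht : t ∈ Ioo (-ℓ) ℓ) : (γ t).snd < 1 := by
  have hℓ : 0 < ℓ := by linarith [ht.1, ht.2]
  have h2 : (γ t).snd = (γ |t|).snd := by
    rcases le_total 0 t with h0 | h0
    · rw [abs_of_nonneg h0]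
    · have := (S.sol.height_symm hn hh (H.level_pos hn hz) S.tangent_height_zero t).1
      rw [zero_add, zero_sub] at this
      rw [abs_of_nonpos h0, this]
  rw [h2, ← h1]
  exact S.strictMonoOn_height hpos ⟨abs_nonneg t, (abs_lt.2 ht).le⟩ ⟨hℓ.le, le_rfl⟩ (abs_lt.2 ht)

theorem eq_pole_iff_exists (S : IsStandardSolution n h z γ T ν) (H : IsPeak n h s) (hn : 3 ≤ n)
    (hh : 0 < h) (hz : z ∈ Ioo 0 s) (hℓ : 0 < ℓ) (hT : (T ℓ).snd = 0) (h1 : (γ ℓ).snd = 1)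
    (hpos : ∀ t ∈ Ioo 0 ℓ, 0 < (T t).snd) (t : ℝ) :
    γ t = pole ↔ ∃ m : ℤ, t = (2 * m + 1) * ℓ := by
  have hper := (S.sol.height_periodic hn hh (H.level_pos hn hz) S.tangent_height_zero hT).1
  rw [eq_pole_iff (S.sol.frame t).norm₁]
  constructor
  · intro hb
    set m := ⌊(t + ℓ) / (2 * ℓ)⌋ with hm
    have h2 : (m : ℝ) * (2 * ℓ) ≤ t + ℓ := by
      rw [← le_div_iff₀ (by linarith)]; exact Int.floor_le _
    have h3 : t + ℓ < (m + 1) * (2 * ℓ) := by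
      rw [← div_lt_iff₀ (by linarith)]; exact Int.lt_floor_add_one _
    have h4 : (γ (t - m * (2 * ℓ))).snd = 1 := by
      have := hper.sub_int_mul_eq m (x := t)
      rw [this, hb]
    -- After a shift by `m` periods `t` lies in `[-ℓ, ℓ)`, where height `1` is attained only at
    -- `-ℓ`. So `t = (2 * m - 1) * ℓ`, which explains the index `m - 1`.
    refine ⟨m - 1, ?_⟩
    by_contra hne
    push_cast at hne
    have h5 : t - m * (2 * ℓ) ∈ Ioo (-ℓ) ℓ := by
      refine ⟨lt_of_le_of_ne (by linarith) fun h => hne (by linarith), by linarith⟩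
    linarith [S.height_lt_one H hn hh hz h1 hpos h5]
  · rintro ⟨m, rfl⟩
    have e : (2 * m + 1) * ℓ = ℓ + m * (2 * ℓ) := by ring
    have h2 : (γ (ℓ + m * (2 * ℓ))).snd = (γ ℓ).snd := hper.int_mul m ℓ
    rw [e, h2, h1]

theorem isAssembledByReflections (S : IsStandardSolution n h z γ T ν) (H : IsPeak n h s)
    (hn : 3 ≤ n) (hh : 0 < h) (hz : z ∈ Ioo 0 s) (hC : level n h z = h / ((n : ℝ) - 1)) (hℓ : 0 < ℓ)
    (hT : (T ℓ).snd = 0) (hpos : ∀ t ∈ Ioo 0 ℓ, 0 < (T t).snd) :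
    IsAssembledByReflections n (-h) (h / ((n : ℝ) - 1)) γ ν := by
  have hpi := Real.pi_pos
  have hlev := H.level_pos hn hz
  have h1 := S.height_turning H hn hh hz hC hℓ hT hpos
  have hsol := S.sol
  rw [hC] at hsol
  have hbc := S.sol.continuous_height
  have hmono := S.strictMonoOn_height hpos
  have hz2 : z ∈ Ioo 0 (Real.pi / 2) := ⟨hz.1, hz.2.trans H.mem.2⟩
  have hbmem : ∀ t, (γ t).snd ∈ Icc (-1 : ℝ) 1 := fun t =>
    ⟨by linarith [S.sol.height_pos t], S.sol.height_le_one t⟩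
  -- On the rising arc the angle `arcsin b` is a parameter. Its inverse `g` turns the phase `φ` in
  -- time into `s₁ = φ ∘ g`; both are continuous up to the end at the pole.
  set σ : ℝ → ℝ := fun t => Real.arcsin (γ t).snd with hσ
  have hσc : Continuous σ := Real.continuous_arcsin.comp hbc
  have hσm : StrictMonoOn σ (Icc 0 ℓ) := fun x hx y hy hxy =>
    Real.strictMonoOn_arcsin (hbmem x) (hbmem y) (hmono hx hy hxy)
  have hσ0 : σ 0 = z := by
    rw [hσ]; simp only [S.height_zero]
    exact Real.arcsin_sin (by linarith [hz2.1]) hz2.2.le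
  have hσℓ : σ ℓ = Real.pi / 2 := by
    rw [hσ]; simp only [h1, Real.arcsin_one]
  obtain ⟨g, hgc, hgl, hgr⟩ := exists_continuous_inverse hℓ.le hσc.continuousOn hσm
  rw [hσ0, hσℓ] at hgr
  set Ω : ℝ → ℝ := fun t => poleAngularVelocity n (h / ((n : ℝ) - 1)) (γ t).snd with hΩ
  have hΩc : Continuous Ω := by
    have : ∀ t, (1 + (γ t).snd) * (γ t).snd ^ (n - 2) ≠ 0 := fun t => by
      have := S.sol.height_pos t
      positivity
    simp only [hΩ, poleAngularVelocity]
    exact (continuous_const.mul (continuous_finsetSum _ fun k _ => hbc.pow k)).div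
      ((continuous_const.add hbc).mul (hbc.pow _)) this
  set φ : ℝ → ℝ := fun t => ∫ τ in (0 : ℝ)..t, Ω τ with hφdef
  have hφ : ∀ t, HasDerivAt φ (Ω t) t := fun t =>
    intervalIntegral.integral_hasDerivAt_right (hΩc.intervalIntegrable _ _)
      (hΩc.stronglyMeasurableAtFilter _ _) hΩc.continuousAt
  have hφc : Continuous φ := continuous_iff_continuousAt.2 fun t => (hφ t).continuousAt
  refine ⟨z, ℓ, φ ∘ g, σ, hz2, hℓ, H.setOf_discriminant_pos hn hh hz hC,
    (hφc.comp hgc).continuousOn, ?_, hσc.continuousOn, hσm, hσ0, hσℓ, ?_,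
    S.eq_pole_iff_exists H hn hh hz hℓ hT h1 hpos, ?_, ?_⟩
  · intro x hx
    obtain ⟨hgx, hσg⟩ := hgr x ⟨hx.1.le, hx.2.le⟩
    have hgx' : g x ∈ Ioo 0 ℓ := by
      refine ⟨lt_of_le_of_ne hgx.1 fun h0 => ?_, lt_of_le_of_ne hgx.2 fun h0 => ?_⟩
      · rw [← h0, hσ0] at hσg; linarith [hx.1]
      · rw [h0, hσℓ] at hσg; linarith [hx.2]
    have hb1 : (γ (g x)).snd < 1 :=
      S.height_lt_one H hn hh hz h1 hpos ⟨by linarith [hgx'.1], hgx'.2⟩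
    have hb0 := S.sol.height_pos (g x)
    have hTp := hpos _ hgx'
    have hsin : Real.sin x = (γ (g x)).snd := by
      conv_lhs => rw [← hσg]
      exact Real.sin_arcsin (hbmem _).1 (hbmem _).2
    have hcos : 0 < Real.cos x := Real.cos_pos_of_mem_Ioo ⟨by linarith [hz2.1, hx.1], hx.2⟩
    have hcos2 : Real.cos x ^ 2 = 1 - (γ (g x)).snd ^ 2 := by
      rw [← hsin]; linarith [Real.sin_sq_add_cos_sq x]
    have hsqrt : Real.sqrt (1 - (γ (g x)).snd ^ 2) = Real.cos x := by
      rw [← hcos2, Real.sqrt_sq hcos.le]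
    have hσd : HasDerivAt σ ((Real.cos x)⁻¹ * (T (g x)).snd) (g x) := by
      have := (Real.hasDerivAt_arcsin (x := (γ (g x)).snd) (by linarith) (by linarith)).comp (g x)
        (S.sol.hasDerivAt_height (g x))
      rw [hsqrt, one_div] at this
      exact this
    have hgd : HasDerivAt g ((Real.cos x)⁻¹ * (T (g x)).snd)⁻¹ x := by
      refine HasDerivAt.of_local_left_inverse hgc.continuousAt hσd (by positivity) ?_
      filter_upwards [Ioo_mem_nhds hx.1 hx.2] with y hy
      exact (hgr y ⟨hy.1.le, hy.2.le⟩).2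
    have hd := (hφ (g x)).comp x hgd
    refine hd.congr_deriv ?_
    have hpow := pow_pos hb0 (n - 2)
    have e1 : rhsFun n (-h) (h / ((n : ℝ) - 1)) x = -((γ (g x)).snd ^ (n - 2) * (ν (g x)).snd) := by
      rw [hsol.pow_mul_normal_height, rhsFun, hsin]; ring
    -- On the rising arc `T_b > 0`, so the root of the discriminant is `b^(n-2) T_b`, and (1) holds
    -- with the plus sign.
    have e2 : discriminant n (-h) (h / ((n : ℝ) - 1)) x =
        ((γ (g x)).snd ^ (n - 2) * (T (g x)).snd) ^ 2 := by
      rw [discriminant, e1, lhsFun, hsin, mul_pow, hcos2]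
      linear_combination -((γ (g x)).snd ^ (n - 2)) ^ 2 * (S.sol.frame (g x)).height_sq
    rw [phaseSlope, e2, Real.sqrt_sq (by positivity), e1]
    have e3 := hsol.neg_normal_height_eq (g x)
    rw [← hcos2] at e3
    have e4 : -((γ (g x)).snd ^ (n - 2) * (ν (g x)).snd) =
        (γ (g x)).snd ^ (n - 2) * (Ω (g x) * Real.cos x ^ 2) := by
      rw [← e3]; ring
    rw [e4]
    field_simp
  · intro t ht
    simp only [Function.comp_apply, hgl t ht]
    have hsin : Real.sin (σ t) = (γ t).snd := Real.sin_arcsin (hbmem _).1 (hbmem _).2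
    have hcos : Real.cos (σ t) = Real.sqrt (1 - (γ t).snd ^ 2) := Real.cos_arcsin _
    rw [spherePoint, hsin, hcos]
    rcases eq_or_lt_of_le ht.2 with rfl | hlt
    · rw [(eq_pole_iff (S.sol.frame t).norm₁).2 h1]
      simp [pole]
    · refine WithLp.ofLp_injective 2 (Prod.ext ?_ rfl)
      exact S.sol.fst_eq_of_hasDerivAt_phase isOpen_Ioo isPreconnected_Ioo
        (⟨by linarith, hℓ⟩ : (0 : ℝ) ∈ Ioo (-ℓ) ℓ)
        (fun t ht => S.height_lt_one H hn hh hz h1 hpos ht) (fun t _ => hφ t)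
        (fun t _ => hsol.neg_normal_height_eq t) intervalIntegral.integral_same (S.fst_zero H hz)
        ⟨by linarith [ht.1], hlt⟩
  · intro t₀ ht₀ τ
    have hf := S.sol.frame t₀
    have hb : (γ t₀).snd = 1 := by rw [ht₀]; rfl
    have hT0 : (T t₀).snd = 0 := by
      have := hf.height_sq
      rw [hb] at this
      nlinarith [sq_nonneg (T t₀).snd, sq_nonneg (ν t₀).snd]
    refine (S.sol.reflection_eq hn hh hlev hT0 ?_ ?_ ?_ τ).1
    · rw [ht₀]; exact Submodule.subset_span (by simp)
    · exact Submodule.subset_span (by simp)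
    · rw [Submodule.mem_orthogonal]
      intro u hu
      obtain ⟨a, b, rfl⟩ := Submodule.mem_span_pair.1 hu
      rw [← ht₀, inner_add_left, real_inner_smul_left, real_inner_smul_left, hf.inner₁₂,
        real_inner_comm, hf.inner₂₃]
      ring
  · intro m τ
    have hper := S.sol.height_periodic hn hh hlev S.tangent_height_zero hT
    set t₀ := 2 * (m : ℝ) * ℓ with ht₀
    have hf := S.sol.frame t₀
    have e : t₀ = 0 + m * (2 * ℓ) := by rw [ht₀]; ring
    have hT0 : (T t₀).snd = 0 := by
      have := hper.2.int_mul m 0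
      rw [e, this, S.tangent_height_zero]
    have hb0 : (γ t₀).snd < 1 := by
      have := hper.1.int_mul m 0
      rw [e, this]
      exact S.height_lt_one H hn hh hz h1 hpos ⟨by linarith, hℓ⟩
    -- At a lowest point `T_b = 0` and `0 < b < 1`, so `ν_b ≠ 0`. The expansion of the pole in the
    -- frame can then be solved for `ν`, which shows that `ν` lies in the plane of the pole and the
    -- point.
    have hν : (ν t₀).snd ≠ 0 := fun h0 => by
      have := hf.height_sq
      rw [hT0, h0] at this
      nlinarith [S.sol.height_pos t₀]
    have hγmem : γ t₀ ∈ Submodule.span ℝ {pole, γ t₀} := Submodule.subset_span (by simp)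
    refine (S.sol.reflection_eq hn hh hlev hT0 hγmem ?_ ?_ τ).1
    · have h2 := eq_sum_of_orthonormal hf.norm₁ hf.norm₂ hf.norm₃ hf.inner₁₂ hf.inner₁₃ hf.inner₂₃ pole
      rw [inner_pole, inner_pole, inner_pole, hT0, zero_smul, add_zero] at h2
      have h3 : ν t₀ = (ν t₀).snd⁻¹ • (pole - (γ t₀).snd • γ t₀) := by
        conv_rhs => rw [h2, add_sub_cancel_left, smul_smul, inv_mul_cancel₀ hν, one_smul]
      rw [h3]
      exact Submodule.smul_mem _ _ (Submodule.sub_mem _ (Submodule.subset_span (by simp))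
        (Submodule.smul_mem _ _ hγmem))
    · rw [Submodule.mem_orthogonal]
      intro u hu
      obtain ⟨a, b, rfl⟩ := Submodule.mem_span_pair.1 hu
      rw [inner_add_left, real_inner_smul_left, real_inner_smul_left, hf.inner₁₂, real_inner_comm,
        inner_pole, hT0]
      ring

end IsStandardSolution

/-! ### Uniqueness of the curve through the pole -/

theorem space3_ext {a b : Space3} (h1 : a.fst = b.fst) (h2 : a.snd = b.snd) : a = b :=
  WithLp.ofLp_injective 2 (Prod.ext h1 h2)

/-- The phase rotation as a continuous linear map. -/
def phaseRotationL (θ : ℝ) : Space3 →L[ℝ] Space3 :=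
  LinearMap.toContinuousLinearMap
    { toFun := phaseRotation θ
      map_add' := fun a b => space3_ext (by simp [phaseRotation, mul_add]) (by simp [phaseRotation])
      map_smul' := fun r a => space3_ext (by simp [phaseRotation, mul_left_comm])
        (by simp [phaseRotation]) }

theorem phaseRotationL_apply (θ : ℝ) (w : Space3) : phaseRotationL θ w = phaseRotation θ w := rfl

theorem space3_inner_eq (a b : Space3) :
    ⟪a, b⟫ = a.fst.re * b.fst.re + a.fst.im * b.fst.im + a.snd * b.snd := by
  simp [WithLp.prod_inner_apply, Complex.inner]
  ring

theorem space3_norm_sq_eq (a : Space3) :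
    ‖a‖ ^ 2 = a.fst.re ^ 2 + a.fst.im ^ 2 + a.snd ^ 2 := by
  rw [← real_inner_self_eq_norm_sq, space3_inner_eq]
  ring

namespace IsCMCCurve

variable {n : ℕ} {h : ℝ} {γ ν : ℝ → Space3}

theorem contDiff_deriv (H : IsCMCCurve n h γ ν) : ContDiff ℝ 1 (deriv γ) :=
  ((contDiff_succ_iff_deriv (n := 1)).1 (by simpa [one_add_one_eq_two] using H.contDiff)).2.2

theorem contDiff_speed (H : IsCMCCurve n h γ ν) : ContDiff ℝ 1 fun t => ‖deriv γ t‖ :=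
  H.contDiff_deriv.norm ℝ H.regular

theorem speed_pos (H : IsCMCCurve n h γ ν) (t : ℝ) : 0 < ‖deriv γ t‖ :=
  norm_pos_iff.2 (H.regular t)

/-- Only the equation for `ν` uses the mean curvature. The one for `T` follows by differentiating
the orthonormality relations of the moving frame. -/
theorem isFrenetSystem (H : IsCMCCurve n (-h) γ ν) :
    IsFrenetSystem n h (fun t => ‖deriv γ t‖) γ (fun t => ‖deriv γ t‖⁻¹ • deriv γ t) ν := by
  set T : ℝ → Space3 := fun t => ‖deriv γ t‖⁻¹ • deriv γ t with hTdef
  have hγT : ∀ t, deriv γ t = ‖deriv γ t‖ • T t := fun t => by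
    rw [hTdef, smul_smul, mul_inv_cancel₀ (H.speed_pos t).ne', one_smul]
  have hTn : ∀ t, ‖T t‖ = 1 := fun t => by
    rw [hTdef, norm_smul, norm_inv, norm_norm, inv_mul_cancel₀ (H.speed_pos t).ne']
  have hTd : ContDiff ℝ 1 T :=
    (H.contDiff_speed.inv fun t => (H.speed_pos t).ne').smul H.contDiff_deriv
  have hγ1 : ∀ t, ⟪γ t, T t⟫ = 0 := fun t => by
    rw [hTdef, real_inner_smul_right, inner_deriv_eq_zero_of_norm_eq_one H.norm_eq_one (H.hasDerivAt t),
      mul_zero]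
  have hν1 : ∀ t, ⟪ν t, T t⟫ = 0 := fun t => by
    rw [hTdef, real_inner_smul_right, H.inner_normal_deriv, mul_zero]
  have hν' : ∀ t, HasDerivAt ν (‖deriv γ t‖ • (-curvature n h (γ t) (ν t) • T t)) t := fun t => by
    refine (H.hasDerivAt_normal t).congr_deriv ?_
    rw [smul_comm, ← hγT, curvature]
  refine ⟨fun t => by rw [← hγT]; exact H.hasDerivAt t, fun t => ?_, hν'⟩
  have hT' : HasDerivAt T (deriv T t) t := (hTd.differentiable (by norm_num) t).hasDerivAt
  refine hT'.congr_deriv ?_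
  have e1 : ⟪T t, deriv T t⟫ = 0 := inner_deriv_eq_zero_of_norm_eq_one hTn hT'
  have e2 : ⟪γ t, deriv T t⟫ = -‖deriv γ t‖ := by
    have := inner_deriv_add_eq_zero hγ1 (H.hasDerivAt t) hT'
    rw [hγT t, real_inner_smul_left, real_inner_self_eq_norm_sq, hTn] at this
    linarith
  have e3 : ⟪ν t, deriv T t⟫ = ‖deriv γ t‖ * curvature n h (γ t) (ν t) := by
    have := inner_deriv_add_eq_zero hν1 (hν' t) hT'
    rw [real_inner_smul_left, real_inner_smul_left, real_inner_self_eq_norm_sq, hTn] at this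
    linarith
  rw [eq_sum_of_orthonormal (H.norm_eq_one t) (hTn t) (H.norm_normal t) (hγ1 t)
    (by rw [real_inner_comm]; exact H.inner_normal t) (by rw [real_inner_comm]; exact hν1 t)
    (deriv T t), e1, e2, e3]
  module

end IsCMCCurve

/-- `b` and `c` form an orthonormal basis of the horizontal plane, whose orientation is corrected by
the sign of `b`. The normal `c` must not be changed, as its sign determines that of the mean
curvature. -/
theorem isFrame_pole_or {b c : Space3} (hb : ‖b‖ = 1) (hc : ‖c‖ = 1) (h1 : ⟪pole, b⟫ = 0)
    (h2 : ⟪pole, c⟫ = 0) (h3 : ⟪b, c⟫ = 0) : IsFrame pole b c ∨ IsFrame pole (-b) c := by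
  have hp1 : ‖pole‖ = 1 := by simp [pole]
  have hb2 : b.snd = 0 := by rw [← inner_pole, real_inner_comm]; exact h1
  have hc2 : c.snd = 0 := by rw [← inner_pole, real_inner_comm]; exact h2
  have hp : ∀ w : Space3, crossHeight pole w = 0 := fun w => by simp [crossHeight, pole]
  have hsq : crossHeight b c ^ 2 = 1 := by
    have e1 := space3_norm_sq_eq b
    have e2 := space3_norm_sq_eq c
    have e3 := space3_inner_eq b c
    rw [hb, hb2] at e1
    rw [hc, hc2] at e2
    rw [h3, hb2] at e3
    rw [crossHeight]
    linear_combination -(c.fst.re ^ 2 + c.fst.im ^ 2) * e1 - e2 +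
      (b.fst.re * c.fst.re + b.fst.im * c.fst.im) * e3
  rcases mul_self_eq_one_iff.1 ((sq _).symm.trans hsq) with h4 | h4
  · right
    refine ⟨hp1, by rw [norm_neg, hb], hc, by rw [inner_neg_right, h1, neg_zero], h2,
      by rw [inner_neg_left, h3, neg_zero], by rw [hp, hc2, neg_zero], ?_, ?_⟩
    · rw [hp, WithLp.neg_snd, hb2, neg_zero]
    · rw [crossHeight] at h4 ⊢
      simp only [WithLp.neg_fst, Complex.neg_re, Complex.neg_im]
      rw [show pole.snd = 1 from rfl]
      linarith
  · left
    exact ⟨hp1, hb, hc, h1, h2, h3, by rw [hp, hc2, neg_zero], by rw [hp, hb2], h4⟩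

theorem IsFrame.of_pole {b c : Space3} (H : IsFrame pole b c) :
    b.snd = 0 ∧ c.snd = 0 ∧ ‖c.fst‖ = 1 ∧ b.fst = Complex.I * c.fst := by
  have hb2 : b.snd = 0 := by rw [← inner_pole, real_inner_comm]; exact H.inner₁₂
  have hc2 : c.snd = 0 := by rw [← inner_pole, real_inner_comm]; exact H.inner₁₃
  have e2 := space3_norm_sq_eq c
  have e3 := space3_inner_eq b c
  have e4 : b.fst.re * c.fst.im - b.fst.im * c.fst.re = -1 := H.cross₂₃
  rw [H.norm₃, hc2] at e2
  rw [H.inner₂₃, hb2] at e3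
  refine ⟨hb2, hc2, ?_, ?_⟩
  · have := WithLp.prod_norm_sq_eq_of_L2 c
    rw [H.norm₃, hc2, norm_zero] at this
    nlinarith [norm_nonneg c.fst]
  · apply Complex.ext
    · simp only [Complex.mul_re, Complex.I_re, Complex.I_im]
      linear_combination b.fst.re * e2 - c.fst.re * e3 + c.fst.im * e4
    · simp only [Complex.mul_im, Complex.I_re, Complex.I_im]
      linear_combination b.fst.im * e2 - c.fst.im * e3 - c.fst.re * e4

/-- Two frames at the pole differ by a phase rotation. -/
theorem IsFrame.exists_phaseRotation {b c b' c' : Space3} (H : IsFrame pole b c)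
    (H' : IsFrame pole b' c') : ∃ θ : ℝ, pole = phaseRotation θ pole ∧ b' = phaseRotation θ b ∧
      c' = phaseRotation θ c := by
  obtain ⟨hb, hc, hcn, hbc⟩ := H.of_pole
  obtain ⟨hb', hc', hcn', hbc'⟩ := H'.of_pole
  have hc0 : c.fst ≠ 0 := fun h0 => by rw [h0, norm_zero] at hcn; exact zero_ne_one hcn
  have hexp : Complex.exp ((c'.fst / c.fst).arg * Complex.I) = c'.fst / c.fst := by
    have := Complex.norm_mul_exp_arg_mul_I (c'.fst / c.fst)
    rwa [norm_div, hcn, hcn', div_one, Complex.ofReal_one, one_mul] at this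
  refine ⟨(c'.fst / c.fst).arg, ?_, space3_ext ?_ ?_, space3_ext ?_ ?_⟩
  · simp [phaseRotation, pole]
  · change b'.fst = Complex.exp _ * b.fst
    rw [hexp, hbc, hbc']
    field_simp
  · exact hb'.trans hb.symm
  · change c'.fst = Complex.exp _ * c.fst
    rw [hexp]
    field_simp
  · exact hc'.trans hc.symm

/-- A curve of constant mean curvature through the pole, with a suitable direction. -/
theorem IsCMCCurve.exists_isFrenetSystem_of_eq_pole {n : ℕ} {h t₀ : ℝ} {γ ν : ℝ → Space3}
    (H : IsCMCCurve n (-h) γ ν) (h0 : γ t₀ = pole) :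
    ∃ (ε : ℝ) (T : ℝ → Space3), (ε = 1 ∨ ε = -1) ∧
      IsFrenetSystem n h (fun t => ε * ‖deriv γ t‖) γ T ν ∧ IsFrame (γ t₀) (T t₀) (ν t₀) := by
  have hsys := H.isFrenetSystem
  have hv := H.speed_pos t₀
  rw [h0]
  rcases isFrame_pole_or (b := ‖deriv γ t₀‖⁻¹ • deriv γ t₀) (c := ν t₀)
    (by rw [norm_smul, norm_inv, norm_norm, inv_mul_cancel₀ hv.ne']) (H.norm_normal t₀)
    (by rw [← h0, real_inner_smul_right,
      inner_deriv_eq_zero_of_norm_eq_one H.norm_eq_one (H.hasDerivAt t₀), mul_zero])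
    (by rw [← h0, real_inner_comm]; exact H.inner_normal t₀)
    (by rw [real_inner_smul_left, real_inner_comm, H.inner_normal_deriv, mul_zero]) with h1 | h1
  · exact ⟨1, _, Or.inl rfl, by simpa only [one_mul] using hsys, h1⟩
  · exact ⟨-1, _, Or.inr rfl, by simpa only [neg_one_mul] using hsys.neg_tangent, h1⟩

/-- The arc length of a complete curve. -/
theorem IsCompleteCurve.bijective {γ : ℝ → Space3} (H : IsCompleteCurve γ)
    (hc : Continuous fun t => ‖deriv γ t‖) (h0 : ∀ t, deriv γ t ≠ 0) :
    Function.Bijective fun t => ∫ τ in (0 : ℝ)..t, ‖deriv γ τ‖ := by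
  have hd : ∀ t, HasDerivAt (fun t => ∫ τ in (0 : ℝ)..t, ‖deriv γ τ‖) ‖deriv γ t‖ t := fun t =>
    intervalIntegral.integral_hasDerivAt_right (hc.intervalIntegrable _ _)
      (hc.stronglyMeasurableAtFilter _ _) hc.continuousAt
  refine ⟨(strictMono_of_deriv_pos fun t => ?_).injective,
    (continuous_iff_continuousAt.2 fun t => (hd t).continuousAt).surjective H.1 H.2⟩
  rw [(hd t).deriv]
  exact norm_pos_iff.2 (h0 t)

theorem energy_pole (n : ℕ) (h : ℝ) {w : Space3} (hw : w.snd = 0) :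
    energy n h pole w = h / ((n : ℝ) - 1) := by
  simp [energy, pole, hw]

/-- The complete curve through the pole is unique up to a phase rotation and a change of
parameter. -/
theorem IsSolution.exists_phaseRotation_comp_eq {n : ℕ} {h C ℓ : ℝ} {γ T ν γ' ν' : ℝ → Space3}
    (S : IsSolution n h C (fun _ => 1) γ T ν) (hn : 3 ≤ n) (hh : 0 < h) (hC : 0 < C)
    (hℓ : γ ℓ = pole) (H : IsCMCCurve n (-h) γ' ν') (hcomp : IsCompleteCurve γ') {t₀ : ℝ}
    (h0 : γ' t₀ = pole) :
    ∃ (θ : ℝ) (φ : ℝ → ℝ), Function.Bijective φ ∧ ContDiff ℝ 2 φ ∧ (∀ t, deriv φ t ≠ 0) ∧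
      ∀ t, γ' t = phaseRotation θ (γ (φ t)) ∧ ν' t = phaseRotation θ (ν (φ t)) := by
  obtain ⟨ε, T', hε, hsys, hfr⟩ := H.exists_isFrenetSystem_of_eq_pole h0
  have hε0 : ε ≠ 0 := by rcases hε with rfl | rfl <;> norm_num
  have hvc := H.contDiff_speed.continuous
  have hL : ∀ t, HasDerivAt (fun t => ∫ τ in (0 : ℝ)..t, ‖deriv γ' τ‖) ‖deriv γ' t‖ t := fun t =>
    intervalIntegral.integral_hasDerivAt_right (hvc.intervalIntegrable _ _)
      (hvc.stronglyMeasurableAtFilter _ _) hvc.continuousAt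
  have hLb := hcomp.bijective hvc H.regular
  set L : ℝ → ℝ := fun t => ∫ τ in (0 : ℝ)..t, ‖deriv γ' τ‖
  -- Signed arc length of `γ'`, shifted so that `t₀` goes to the parameter `ℓ` of the pole; `ε` is
  -- the direction of travel relative to `γ`.
  set φ : ℝ → ℝ := fun t => ε * L t + (ℓ - ε * L t₀) with hφdef
  have hφ : ∀ t, HasDerivAt φ (ε * ‖deriv γ' t‖) t := fun t => ((hL t).const_mul ε).add_const _
  have hφ0 : φ t₀ = ℓ := by rw [hφdef]; ring
  have hφd : deriv φ = fun t => ε * ‖deriv γ' t‖ := funext fun t => (hφ t).deriv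
  have hf' := hfr
  rw [h0] at hf'
  have hf := S.frame ℓ
  rw [hℓ] at hf
  obtain ⟨θ, r1, r2, r3⟩ := hf.exists_phaseRotation hf'
  refine ⟨θ, φ, ?_, ?_, fun t => ?_, fun t => ?_⟩
  · exact ((Equiv.addRight (ℓ - ε * L t₀)).bijective.comp
      ((Equiv.mulLeft₀ ε hε0).bijective.comp hLb) : _)
  · rw [← one_add_one_eq_two, contDiff_succ_iff_deriv]
    refine ⟨fun t => (hφ t).differentiableAt, by simp, ?_⟩
    rw [hφd]
    exact contDiff_const.mul H.contDiff_speed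
  · rw [hφd]
    exact mul_ne_zero hε0 (H.speed_pos t).ne'
  · have hen : C = h / ((n : ℝ) - 1) := by
      rw [← S.energy_eq ℓ, hℓ, energy_pole n h hf.of_pole.2.1]
    have h1 : IsSolution n h C (fun t => ε * ‖deriv γ' t‖) γ' T' ν' := by
      refine IsSolution.of_isFrenetSystem hsys hfr H.height_pos fun t => ?_
      rw [hsys.energy_eq hn (fun s hs => absurd hs (H.height_pos s).ne') t t₀, h0,
        energy_pole n h hf'.of_pole.2.1, hen]
    have e1 : γ' t₀ = phaseRotationL θ (γ (φ t₀)) := by rw [phaseRotationL_apply, hφ0, hℓ, h0, ← r1]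
    have e2 : T' t₀ = phaseRotationL θ (T (φ t₀)) := by rw [phaseRotationL_apply, hφ0, r2]
    have e3 : ν' t₀ = phaseRotationL θ (ν (φ t₀)) := by rw [phaseRotationL_apply, hφ0, r3]
    -- The rotated and reparametrized model solves the system with the same factor `ε ‖γ'‖` as the
    -- given curve, so uniqueness with variable speed applies.
    have h2 : IsSolution n h C (fun t => ε * ‖deriv γ' t‖) (fun t => phaseRotationL θ (γ (φ t)))
        (fun t => phaseRotationL θ (T (φ t))) (fun t => phaseRotationL θ (ν (φ t))) := by
      have hs := (S.system.comp hφ).map (phaseRotationL θ) fun _ => rfl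
      simp only [mul_one] at hs
      refine IsSolution.of_isFrenetSystem hs (t₀ := t₀) ?_ (fun t => S.height_pos (φ t))
        fun t => S.energy_eq (φ t)
      rw [← e1, ← e2, ← e3]
      exact hfr
    have := h1.unique h2 hn hh hC (continuous_const.mul hvc) e1 e2 e3 t
    exact ⟨this.1, this.2.2⟩

end

/-! ### Proof of the theorem -/

theorem mainTheorem1 (n : ℕ) (hn : 3 ≤ n) (h : ℝ) (hh : 0 < h) :
    ∃ γ ν : ℝ → Space3,
      -- a complete `(-h)`-curve through the pole, smooth and parametrized by arc length
      IsCMCCurve n (-h) γ ν ∧ IsCompleteCurve γ ∧ ContDiff ℝ ∞ γ ∧ (∀ t, ‖deriv γ t‖ = 1) ∧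
      PointsAwayFromPole γ ν ∧ (∃ t, γ t = pole) ∧
      -- its integration constant, and its assembly from local pieces
      HasIntegrationConstant n (-h) (h / ((n : ℝ) - 1)) γ ∧
      IsAssembledByReflections n (-h) (h / ((n : ℝ) - 1)) γ ν ∧
      -- uniqueness up to a phase rotation and a change of parameter
      (∀ γ' ν' : ℝ → Space3, IsCMCCurve n (-h) γ' ν' → IsCompleteCurve γ' →
        (∃ t, γ' t = pole) →
          ∃ (θ : ℝ) (φ : ℝ → ℝ), Function.Bijective φ ∧ ContDiff ℝ 2 φ ∧ (∀ t, deriv φ t ≠ 0) ∧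
            ∀ t, γ' t = phaseRotation θ (γ (φ t)) ∧ ν' t = phaseRotation θ (ν (φ t))) ∧
      -- it is neither of unduloid type nor of nodoid type, and it joins these two types
      ¬ IsUnduloidType γ ∧ ¬ IsNodoidType γ ∧
      ∃ Γ N : ℝ → ℝ → Space3,
        Γ (h / ((n : ℝ) - 1)) = γ ∧ N (h / ((n : ℝ) - 1)) = ν ∧
        ContinuousOn (fun q : ℝ × ℝ => (Γ q.1 q.2, N q.1 q.2))
          ((Ioi 0 ∩ belowContact n (-h)) ×ˢ univ) ∧
        h / ((n : ℝ) - 1) ∈ belowContact n (-h) ∧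
        ∀ C ∈ Ioi 0 ∩ belowContact n (-h),
          IsCMCCurve n (-h) (Γ C) (N C) ∧ IsCompleteCurve (Γ C) ∧ (∀ t, ‖deriv (Γ C) t‖ = 1) ∧
          HasIntegrationConstant n (-h) C (Γ C) ∧
          (C < h / ((n : ℝ) - 1) → IsNodoidType (Γ C)) ∧
          (h / ((n : ℝ) - 1) < C → IsUnduloidType (Γ C) ∧ PointsAwayFromPole (Γ C) (N C)) := by
  have hn' : (3 : ℝ) ≤ n := by exact_mod_cast hn
  have hpole : 0 < h / ((n : ℝ) - 1) := div_pos hh (by linarith)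
  obtain ⟨s, H⟩ := exists_isPeak hn hh
  -- The lowest angle as a continuous function of `C`, by inverting `level` on its rising branch; it
  -- makes the initial frames continuous in `C`.
  obtain ⟨z, hzc, -, hz⟩ := exists_continuous_inverse H.mem.1.le
    (continuous_level n h).continuousOn (H.strictMonoOn hn)
  rw [level_zero hn h] at hz
  set S : Set ℝ := Ioi 0 ∩ belowContact n (-h) with hS
  have hzS : ∀ C ∈ S, z C ∈ Ioo 0 s ∧ level n h (z C) = C := by
    intro C hC
    have hlt := (H.mem_belowContact_iff hn).1 hC.2
    obtain ⟨h1, h2⟩ := hz C ⟨(mem_Ioi.1 hC.1).le, hlt.le⟩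
    refine ⟨⟨lt_of_le_of_ne h1.1 fun h3 => ?_, lt_of_le_of_ne h1.2 fun h3 => ?_⟩, h2⟩
    · rw [← h3, level_zero hn h] at h2
      exact (mem_Ioi.1 hC.1).ne h2
    · rw [h3] at h2
      exact hlt.ne' h2
  -- The family is indexed by all real `C`; outside `S` it is filled with zero functions, about
  -- which nothing is claimed.
  have hex : ∀ C, ∃ γ T ν, C ∈ S → IsStandardSolution n h (z C) γ T ν := fun C => by
    by_cases hC : C ∈ S
    · obtain ⟨γ, T, ν, hst⟩ := exists_isStandardSolution H hn hh (hzS C hC).1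
      exact ⟨γ, T, ν, fun _ => hst⟩
    · exact ⟨0, 0, 0, fun h => absurd h hC⟩
  choose Γ T N hΓ using hex
  have hsol : ∀ C ∈ S, IsSolution n h C (fun _ => 1) (Γ C) (T C) (N C) := fun C hC => by
    have := (hΓ C hC).sol
    rwa [(hzS C hC).2] at this
  have hbelow : h / ((n : ℝ) - 1) ∈ belowContact n (-h) :=
    (H.mem_belowContact_iff hn).2 (H.level_pole_lt hn)
  have hpS : h / ((n : ℝ) - 1) ∈ S := ⟨hpole, hbelow⟩
  obtain ⟨hz0, hlev⟩ := hzS _ hpS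
  have hst := hΓ _ hpS
  have hs0 := hsol _ hpS
  obtain ⟨ℓ, hℓ, hTℓ, hpos⟩ := hst.exists_first_turning H hn hz0
  have hγℓ : Γ (h / ((n : ℝ) - 1)) ℓ = pole :=
    (eq_pole_iff (hs0.frame ℓ).norm₁).2 (hst.height_turning H hn hh hz0 hlev hℓ hTℓ hpos)
  -- A phase requires `γ_z ≠ 0` throughout, which fails at the pole; this excludes both types at
  -- once.
  have hphase : ∀ φ, ¬ IsPhase (Γ (h / ((n : ℝ) - 1))) φ := fun φ hφ =>
    (hφ.2 ℓ).1 (by rw [hγℓ]; rfl)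
  refine ⟨Γ (h / ((n : ℝ) - 1)), N (h / ((n : ℝ) - 1)), hs0.isCMCCurve hn hh hpole,
    hs0.isCompleteCurve, (hs0.contDiff hn hh hpole).1, hs0.norm_deriv,
    hs0.pointsAwayFromPole hn hh le_rfl, ⟨ℓ, hγℓ⟩, hs0.hasIntegrationConstant,
    hst.isAssembledByReflections H hn hh hz0 hlev hℓ hTℓ hpos,
    fun γ' ν' h1 h2 ⟨t₀, h3⟩ => hs0.exists_phaseRotation_comp_eq hn hh hpole hγℓ h1 h2 h3,
    fun ⟨_, φ, hφ, _⟩ => hphase φ hφ, fun ⟨_, φ, hφ, _⟩ => hphase φ hφ, Γ, N, rfl, rfl, ?_, hbelow,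
    fun C hC => ?_⟩
  · have h0 : ContinuousOn (fun C => (Γ C 0, T C 0, N C 0)) S := by
      have : Continuous fun C => (lowestPoint (z C), lowestTangent, lowestNormal (z C)) := by
        have h1 : Continuous fun C => lowestPoint (z C) :=
          (WithLp.prod_continuous_toLp 2 ℂ ℝ).comp
            ((Complex.continuous_ofReal.comp (Real.continuous_cos.comp hzc)).prodMk
              (Real.continuous_sin.comp hzc))
        have h2 : Continuous fun C => lowestNormal (z C) :=
          (WithLp.prod_continuous_toLp 2 ℂ ℝ).comp
            ((Complex.continuous_ofReal.comp (Real.continuous_sin.comp hzc)).prodMk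
              (Real.continuous_cos.comp hzc).neg)
        exact h1.prodMk (continuous_const.prodMk h2)
      refine this.continuousOn.congr fun C hC => ?_
      rw [(hΓ C hC).point_zero, (hΓ C hC).tangent_zero, (hΓ C hC).normal_zero]
    have := continuousOn_isSolution hn hh (fun C hC => hC.1) hsol h0
    exact this.fst.prodMk this.snd.snd
  · obtain ⟨hzC, hlC⟩ := hzS C hC
    have hs := hsol C hC
    refine ⟨hs.isCMCCurve hn hh hC.1, hs.isCompleteCurve, hs.norm_deriv, hs.hasIntegrationConstant,
      fun hlt => ?_, fun hlt => ⟨?_, hs.pointsAwayFromPole hn hh hlt.le⟩⟩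
    · exact (hΓ C hC).isNodoidType H hn hh hzC (by rwa [hlC])
    · exact (hΓ C hC).isUnduloidType H hn hh hzC (by rwa [hlC])
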